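/- **Model.** Fix $k_1,k_2,k_3\ge 0$. For each sample size $n$ let $Z^{(n)}=(Z_1\;Z_2\;Z_3)$ be a fixed $n\times(k_1+k_2+k_3)$ matrix with blocks of $k_1,k_2,k_3$ columns, $Z_{12}=(Z_1\;Z_2)$, $Z_{23}=(Z_2\;Z_3)$, and let $p=p_n$ be the number of variables (fixed or varying with $n$). The data are $Y=1_n\mu^T+Z_{23}\Lambda^T+\mathcal E$ with $\Lambda=(\Lambda_2\;\Lambda_3)$ a $p\times(k_2+k_3)$ matrix, where the rows of $\mathcal E$ are i.i.d. with mean $0$ and covariance $\Psi=\mathrm{diag}(\Psi_{11},\Psi_{22},\dots)$, and a binary matrix $A$, independent of $\mathcal E$, whose entries $A_{ij}$, $i<j$, are independent Bernoulli$(P_{ij})$, where $P=\alpha 1_n^T+1_n\alpha^T+Z_{12}Z_{12}^T$ has entries in $[0,1]$. Write $\Lambda_{12}=(0\;\Lambda_2)$, with $j$-th row $\lambda_{j,12}$, and $\lambda_j$ for the $j$-th row of $\Lambda$. The parameters may depend on $n$, but $\Psi_{jj}$ and the distribution of the noise of each variable do not. **Assumptions.** (I) $Z^TZ/n\to\overline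 M_Z$, where $\overline M_Z$ has full rank $k_1+k_2+k_3$; let $\overline M_{12}=\lim_n Z_{12}^TZ_{12}/n$. (II) $A$ is symmetric with zero diagonal. (III) For all large $n$, $P$ is positive semidefinite with rank at most $k_1+k_2$ (so $P=XX^T$ with an $n\times(k_1+k_2)$ matrix $X$), and for some $a>0$, $\max_i\sum_jP_{ij}>(\log n)^{4+a}$. (IV) For some constant $C$: $0<\Psi_{jj}\le C$ and $\|\lambda_j\|_2\le C$ for all $j\le p$ and all $n$, and $\max_{a,b}|(\overline M_Z)_{ab}|\le C$. (V) For all large $n$ the columns of $Z$ sum to zero and one of the following sets of identifiability conditions holds: (1) $Z_{12}^TZ_3=0$, $\Lambda_2^T\Psi^{-1}\Lambda_2/p$ is diagonal with distinct diagonal elements, and $\Lambda_3$ contains $I_{k_3}$ as a submatrix of rows; (2) $Z^TZ$ is diagonal with distinct diagonal elements and $\Lambda_3^T\Psi^{-1}\Lambda_3/p=I_{k_3}$; (3) $Z_{12}^TZ_3=0$, $Z_{12}^TZ_{12}$ has distinct eigenvalues, $Z_3^TZ_3$ is diagonal with distinct diagonal elements, $\Lambda_2$ is lower triangular, and $\Lambda_3^T\Psi^{-1}\Lambda_3/p=I_{k_3}$.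 **Estimator.** Let $\hat X=U_AS_A^{1/2}$ be the adjacency spectral embedding of $A$ in dimension $k_1+k_2$: $S_A$ is the diagonal matrix of the $k_1+k_2$ largest singular values of $A$ in descending order, and $U_A$ has corresponding orthonormal singular vectors as columns. For an orthogonal matrix $W$ put $\hat Z_{12}=(I-\tfrac1n1_n1_n^T)\hat XW$, and let $\hat\Lambda_{12}$, with rows $\hat\lambda_{j,12}$, be given by the OLS regression of the centered $Y$ on $\hat Z_{12}$: $\hat\Lambda_{12}^T=(\hat Z_{12}^T\hat Z_{12})^{-1}\hat Z_{12}^T(I-\tfrac1n1_n1_n^T)Y$. (The inverse of a singular matrix, which occurs with probability tending to $0$, is read as $0$.) **Theorem.** Under Assumptions I–V, for each $j$ (with $j\le p_n$ for all large $n$), as $n\to\infty$, $$\sqrt n\,(\hat\lambda_{j,12}-\lambda_{j,12})\;\longrightarrow\;\mathcal N\bigl(0,\ \Psi_{jj}\,\overline M_{12}^{-1}\bigr)\quad\text{in distribution,}$$ in each of the following cases: (a) under any of the sets of identifiability conditions, when the rotational indeterminacy of the embedding is removed by aligning it with $Z_{12}$, i.e. $W$ is any orthogonal matrix (a function of $A$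 and $Z_{12}$) that minimizes $\|\hat Z_{12}-Z_{12}\|_F$; (b) if set (2) holds for all large $n$ and the diagonal elements of the (diagonal) matrix $\overline M_{12}$ are distinct, when $W$ is any orthogonal matrix chosen such that $\hat Z_{12}^T\hat Z_{12}$ is diagonal, with its diagonal elements in the same order as those of $Z_{12}^TZ_{12}$ and with column signs such that $\hat Z_{12}^TZ_{12}$ has nonnegative diagonal. This is the oracle variance: the OLS regression of the centered $Y$ on the true $Z_{12}$ has the same limit law. -/

import Mathlib

open MeasureTheory ProbabilityTheory Filter Topology

namespace GFM

/-- The `n × n` centering matrix `I - 1 1ᵀ / n`. -/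
noncomputable def centering (n : ℕ) : Matrix (Fin n) (Fin n) ℝ :=
  1 - (n : ℝ)⁻¹ • Matrix.of (fun _ _ => (1 : ℝ))

/-- Deterministic parameters of the generalized factor model, for every sample size `n`.
`k1`, `k2`, `k3` are the numbers of network-only, shared and variable-only factors; there are `p n`
variables at sample size `n`, and `Ψ j` is the noise variance of the `j`-th variable. -/
structure Params (k1 k2 k3 : ℕ) where
  p : ℕ → ℕ
  Z1 : (n : ℕ) → Matrix (Fin n) (Fin k1) ℝ
  Z2 : (n : ℕ) → Matrix (Fin n) (Fin k2) ℝ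
  Z3 : (n : ℕ) → Matrix (Fin n) (Fin k3) ℝ
  α : (n : ℕ) → Fin n → ℝ
  mean : (n : ℕ) → Fin (p n) → ℝ
  Λ2 : (n : ℕ) → Matrix (Fin (p n)) (Fin k2) ℝ
  Λ3 : (n : ℕ) → Matrix (Fin (p n)) (Fin k3) ℝ
  Ψ : ℕ → ℝ

namespace Params

variable {k1 k2 k3 : ℕ}

/-- The latent factors of the network, `Z₁₂ = (Z₁ Z₂)`. -/
def Z12 (M : Params k1 k2 k3) (n : ℕ) : Matrix (Fin n) (Fin k1 ⊕ Fin k2) ℝ :=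
  Matrix.fromCols (M.Z1 n) (M.Z2 n)

/-- The latent factors of the variables, `Z₂₃ = (Z₂ Z₃)`. -/
def Z23 (M : Params k1 k2 k3) (n : ℕ) : Matrix (Fin n) (Fin k2 ⊕ Fin k3) ℝ :=
  Matrix.fromCols (M.Z2 n) (M.Z3 n)

/-- All latent factors, `Z = (Z₁ Z₂ Z₃)`. -/
def Z (M : Params k1 k2 k3) (n : ℕ) : Matrix (Fin n) ((Fin k1 ⊕ Fin k2) ⊕ Fin k3) ℝ :=
  Matrix.fromCols (M.Z12 n) (M.Z3 n)

/-- The factor loadings `Λ = (Λ₂ Λ₃)`. -/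
def Λ (M : Params k1 k2 k3) (n : ℕ) : Matrix (Fin (M.p n)) (Fin k2 ⊕ Fin k3) ℝ :=
  Matrix.fromCols (M.Λ2 n) (M.Λ3 n)

/-- The loadings `Λ₁₂ = (0 Λ₂)` of the variables on the network factors `Z₁₂`. -/
def Λ12 (M : Params k1 k2 k3) (n : ℕ) : Matrix (Fin (M.p n)) (Fin k1 ⊕ Fin k2) ℝ :=
  Matrix.fromCols 0 (M.Λ2 n)

/-- The `p n × p n` diagonal noise covariance matrix. -/
def Ψmat (M : Params k1 k2 k3) (n : ℕ) : Matrix (Fin (M.p n)) (Fin (M.p n)) ℝ :=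
  Matrix.diagonal (fun j => M.Ψ j)

/-- The link probabilities `P = α 1ᵀ + 1 αᵀ + Z₁₂ Z₁₂ᵀ`. -/
def P (M : Params k1 k2 k3) (n : ℕ) : Matrix (Fin n) (Fin n) ℝ :=
  Matrix.of (fun i j => M.α n i + M.α n j) + M.Z12 n * (M.Z12 n).transpose

/-- The data matrix `Y = 1 μᵀ + Z₂₃ Λᵀ + E`, where `E` has the entries `ε i j`. -/
def Y {Ω : Type*} (M : Params k1 k2 k3) (ε : ℕ → ℕ → Ω → ℝ) (n : ℕ) (ω : Ω) :
    Matrix (Fin n) (Fin (M.p n)) ℝ :=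
  Matrix.of (fun _ j => M.mean n j) + M.Z23 n * (M.Λ n).transpose
    + Matrix.of (fun (i : Fin n) (j : Fin (M.p n)) => ε i j ω)

/-- The normalized loading Gram matrix `Lᵀ Ψ⁻¹ L / p` (used with `L = Λ₂` and `L = Λ₃`). -/
noncomputable def gram (M : Params k1 k2 k3) (n : ℕ) {k : ℕ}
    (L : Matrix (Fin (M.p n)) (Fin k) ℝ) : Matrix (Fin k) (Fin k) ℝ :=
  (M.p n : ℝ)⁻¹ • (L.transpose * (M.Ψmat n)⁻¹ * L)

end Params

/-- A diagonal matrix with pairwise distinct diagonal elements. -/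
def DistinctDiag {ι : Type*} (D : Matrix ι ι ℝ) : Prop :=
  D.IsDiag ∧ Function.Injective (fun a => D a a)

/-- A symmetric matrix with pairwise distinct eigenvalues. -/
def DistinctEigenvalues {ι : Type*} [Fintype ι] [DecidableEq ι] (D : Matrix ι ι ℝ) : Prop :=
  ∃ h : D.IsHermitian, Function.Injective h.eigenvalues

section Conditions

variable {k1 k2 k3 : ℕ}

/-- Every column of `Z` sums to zero. -/
def Centered (M : Params k1 k2 k3) (n : ℕ) : Prop :=
  ∀ a, ∑ i, M.Z n i a = 0

/-- First set of identifiability conditions. -/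
def Ident1 (M : Params k1 k2 k3) (n : ℕ) : Prop :=
  Centered M n ∧ (M.Z12 n).transpose * M.Z3 n = 0 ∧ DistinctDiag (M.gram n (M.Λ2 n)) ∧
    ∃ r : Fin k3 → Fin (M.p n), (M.Λ3 n).submatrix r id = 1

/-- Second set of identifiability conditions. -/
def Ident2 (M : Params k1 k2 k3) (n : ℕ) : Prop :=
  Centered M n ∧ DistinctDiag ((M.Z n).transpose * M.Z n) ∧ M.gram n (M.Λ3 n) = 1

/-- Third set of identifiability conditions. -/
def Ident3 (M : Params k1 k2 k3) (n : ℕ) : Prop :=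
  Centered M n ∧ (M.Z12 n).transpose * M.Z3 n = 0 ∧
    DistinctEigenvalues ((M.Z12 n).transpose * M.Z12 n) ∧
    DistinctDiag ((M.Z3 n).transpose * M.Z3 n) ∧
    (∀ (i : Fin (M.p n)) (l : Fin k2), (i : ℕ) < (l : ℕ) → M.Λ2 n i l = 0) ∧
    M.gram n (M.Λ3 n) = 1

/-- Assumption I: `Zᵀ Z / n` converges to a matrix `Mbar` of full rank. -/
def AssumptionI (M : Params k1 k2 k3)
    (Mbar : Matrix ((Fin k1 ⊕ Fin k2) ⊕ Fin k3) ((Fin k1 ⊕ Fin k2) ⊕ Fin k3) ℝ) : Prop :=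
  Tendsto (fun n : ℕ => (n : ℝ)⁻¹ • ((M.Z n).transpose * M.Z n)) atTop (𝓝 Mbar) ∧
    Mbar.rank = k1 + k2 + k3

/-- The value set of the adjacency matrix: symmetric, hollow and binary matrices. -/
def IsAdjacency {n : ℕ} (B : Matrix (Fin n) (Fin n) ℝ) : Prop :=
  B.IsSymm ∧ (∀ i, B i i = 0) ∧ ∀ i j, B i j = 0 ∨ B i j = 1

/-- Assumption II: the random adjacency matrix is symmetric with zero diagonal (and binary). -/
def AssumptionII {Ω : Type*} (A : (n : ℕ) → Ω → Matrix (Fin n) (Fin n) ℝ) : Prop :=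
  ∀ n ω, IsAdjacency (A n ω)

/-- Assumption III: `P` is positive semidefinite, of rank at most `k1 + k2`, so that
`P = X Xᵀ` with `X` having `k1 + k2` columns (a random dot product graph whose dimension is that of
the spectral embedding), and the largest expected degree exceeds `(log n) ^ (4 + a)`. -/
def AssumptionIII (M : Params k1 k2 k3) : Prop :=
  (∀ᶠ n in atTop, (M.P n).PosSemidef ∧ (M.P n).rank ≤ k1 + k2) ∧
    ∃ a : ℝ, 0 < a ∧ ∀ᶠ n : ℕ in atTop, ∃ i, (Real.log n) ^ (4 + a) < ∑ j, M.P n i j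

/-- Assumption IV: boundedness of the variances, the loadings and the limit covariance. -/
def AssumptionIV (M : Params k1 k2 k3)
    (Mbar : Matrix ((Fin k1 ⊕ Fin k2) ⊕ Fin k3) ((Fin k1 ⊕ Fin k2) ⊕ Fin k3) ℝ) : Prop :=
  ∃ C : ℝ, 0 < C ∧
    (∀ n (j : Fin (M.p n)), 0 < M.Ψ j ∧ M.Ψ j ≤ C ∧ √(∑ l, M.Λ n j l ^ 2) ≤ C) ∧
    ∀ a b, |Mbar a b| ≤ C

/-- Assumption V: for all large `n` one of the sets of identifiability conditions holds. -/
def AssumptionV (M : Params k1 k2 k3) : Prop :=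
  ∀ᶠ n in atTop, Ident1 M n ∨ Ident2 M n ∨ Ident3 M n

/-- The network model: above the diagonal the entries of `A n` are independent Bernoulli variables
with success probabilities `P n i j ∈ [0, 1]`. -/
structure IsNetwork {Ω : Type*} [MeasurableSpace Ω] (Pr : Measure Ω) (M : Params k1 k2 k3)
    (A : (n : ℕ) → Ω → Matrix (Fin n) (Fin n) ℝ) : Prop where
  prob_mem : ∀ n i j, M.P n i j ∈ Set.Icc (0 : ℝ) 1
  measurable : ∀ n i j, Measurable (fun ω => A n ω i j)
  law : ∀ n i j, i < j → Pr {ω | A n ω i j = 1} = ENNReal.ofReal (M.P n i j)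
  indep : ∀ n, iIndepFun
    (fun (e : {e : Fin n × Fin n // e.1 < e.2}) (ω : Ω) => A n ω e.1.1 e.1.2) Pr

/-- The noise: the rows `(ε i j)_j` are i.i.d. in `i`, with mean zero and diagonal covariance matrix
with entries `Ψ j`. Only the variables `j < p n` that occur for some `n` are restricted. -/
structure IsNoise {Ω : Type*} [MeasurableSpace Ω] (Pr : Measure Ω) (M : Params k1 k2 k3)
    (ε : ℕ → ℕ → Ω → ℝ) : Prop where
  indep : ∀ n, iIndepFun (fun (i : ℕ) (ω : Ω) (j : Fin (M.p n)) => ε i j ω) Pr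
  ident : ∀ n (i : ℕ), IdentDistrib (fun (ω : Ω) (j : Fin (M.p n)) => ε i j ω)
    (fun (ω : Ω) (j : Fin (M.p n)) => ε 0 j ω) Pr Pr
  memLp : ∀ n (i : ℕ) (j : Fin (M.p n)), MemLp (ε i j) 2 Pr
  mean : ∀ n (i : ℕ) (j : Fin (M.p n)), ∫ ω, ε i j ω ∂Pr = 0
  cov : ∀ n (i : ℕ) (j l : Fin (M.p n)), ∫ ω, ε i j ω * ε i l ω ∂Pr = M.Ψmat n j l

/-- The joint model: network, noise, and independence of the two. -/
structure IsModel {Ω : Type*} [MeasurableSpace Ω] (Pr : Measure Ω) (M : Params k1 k2 k3)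
    (A : (n : ℕ) → Ω → Matrix (Fin n) (Fin n) ℝ) (ε : ℕ → ℕ → Ω → ℝ) : Prop where
  network : IsNetwork Pr M A
  noise : IsNoise Pr M ε
  indep : ∀ n, IndepFun (fun ω (i j : Fin n) => A n ω i j)
    (fun ω (i : Fin n) (j : Fin (M.p n)) => ε i j ω) Pr

end Conditions

section Estimator

/-- `X = U S^{1/2}` is a `d`-dimensional adjacency spectral embedding of `B`: `S` is diagonal with
the `d` largest singular values of `B` in descending order, and `U` has as columns corresponding
orthonormal (left) singular vectors. -/
def IsASE {n : ℕ} (d : ℕ) (B : Matrix (Fin n) (Fin n) ℝ) (X : Matrix (Fin n) (Fin d) ℝ) : Prop :=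
  ∃ (U : Matrix (Fin n) (Fin d) ℝ) (s : Fin d → ℝ),
    (∀ a : Fin d, s a = (Matrix.toEuclideanLin B).singularValues a) ∧
    U.transpose * U = 1 ∧
    B * B.transpose * U = U * Matrix.diagonal (fun a => s a ^ 2) ∧
    X = U * Matrix.diagonal (fun a => √(s a))

/-- An orthogonal matrix whose rows and columns are indexed by different types. -/
def IsOrthogonal {ι κ : Type*} [Fintype ι] [Fintype κ] [DecidableEq ι] [DecidableEq κ]
    (W : Matrix ι κ ℝ) : Prop :=
  W.transpose * W = 1 ∧ W * W.transpose = 1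

variable {k1 k2 n : ℕ}

/-- `Zhat` is the centered adjacency spectral embedding of `B`, rotated so as to be closest to `Z12`
in Frobenius norm. -/
def IsAlignedEmbedding (Z12 : Matrix (Fin n) (Fin k1 ⊕ Fin k2) ℝ) (B : Matrix (Fin n) (Fin n) ℝ)
    (Zhat : Matrix (Fin n) (Fin k1 ⊕ Fin k2) ℝ) : Prop :=
  ∃ X : Matrix (Fin n) (Fin (k1 + k2)) ℝ, IsASE (k1 + k2) B X ∧
    (∃ W : Matrix (Fin (k1 + k2)) (Fin k1 ⊕ Fin k2) ℝ,
      IsOrthogonal W ∧ Zhat = centering n * X * W) ∧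
    ∀ W : Matrix (Fin (k1 + k2)) (Fin k1 ⊕ Fin k2) ℝ, IsOrthogonal W →
      ∑ i, ∑ a, (Zhat i a - Z12 i a) ^ 2 ≤ ∑ i, ∑ a, ((centering n * X * W) i a - Z12 i a) ^ 2

/-- `Zhat` is the centered adjacency spectral embedding of `B`, rotated so that `Zhatᵀ Zhat` is
diagonal, with the order and the signs of the columns fixed as those of `Z12`. -/
def IsDiagonalizedEmbedding (Z12 : Matrix (Fin n) (Fin k1 ⊕ Fin k2) ℝ)
    (B : Matrix (Fin n) (Fin n) ℝ) (Zhat : Matrix (Fin n) (Fin k1 ⊕ Fin k2) ℝ) : Prop :=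
  (∃ X : Matrix (Fin n) (Fin (k1 + k2)) ℝ, IsASE (k1 + k2) B X ∧
    ∃ W : Matrix (Fin (k1 + k2)) (Fin k1 ⊕ Fin k2) ℝ,
      IsOrthogonal W ∧ Zhat = centering n * X * W) ∧
    (Zhat.transpose * Zhat).IsDiag ∧
    (∀ a b, (Z12.transpose * Z12) a a < (Z12.transpose * Z12) b b →
      (Zhat.transpose * Zhat) a a ≤ (Zhat.transpose * Zhat) b b) ∧
    ∀ a, 0 ≤ ∑ i, Zhat i a * Z12 i a

/-- The OLS coefficients of the centered `Y` on `F`: the matrix `L` with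
`Lᵀ = (Fᵀ F)⁻¹ Fᵀ (I - 1 1ᵀ / n) Y`. -/
noncomputable def ols {p : ℕ} (F : Matrix (Fin n) (Fin k1 ⊕ Fin k2) ℝ)
    (Y : Matrix (Fin n) (Fin p) ℝ) : Matrix (Fin p) (Fin k1 ⊕ Fin k2) ℝ :=
  ((F.transpose * F)⁻¹ * F.transpose * (centering n * Y)).transpose

end Estimator

/-- The scaled error `√n (L j - Λ₁₂ j)` of the `j`-th loading row (`0` if there is no such row). -/
noncomputable def scaledError {k1 k2 k3 : ℕ} (M : Params k1 k2 k3) (n : ℕ)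
    (L : Matrix (Fin (M.p n)) (Fin k1 ⊕ Fin k2) ℝ) (j : ℕ) : EuclideanSpace ℝ (Fin k1 ⊕ Fin k2) :=
  WithLp.toLp 2 (fun a => if h : j < M.p n then √(n : ℝ) * (L ⟨j, h⟩ a - M.Λ12 n ⟨j, h⟩ a) else 0)

end GFM

/-! Write J for the centering matrix. Centering removes the degree terms of P, so J P J = Z₁₂ Z₁₂ᵀ;
as P has rank at most k₁ + k₂, it factors as P = X Xᵀ with J X = Z₁₂ (`exists_factor_of_centering`).
Since Z₁₂ᵀ Z₁₂ / n has a nonsingular limit, the signal eigenvalues are of order n. The noise E = A -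
P is smaller in two ways. Its operator norm is o(n), because the off-diagonal part F has E tr F⁴ =
O(n³). When tested against X, Z₁₂ or Z₃ it averages out: Uᵀ E and Uᵀ E X are O(n) in Frobenius norm
(`IsNetwork.eventually_isTypical`).

A rotated embedding Y solves (X Xᵀ + E) Y T = Y with T = (Yᵀ Y)⁻¹ = O(1/n). Hence Y = X R + Δ with R
= Xᵀ Y T and Δ = E Y T. Inserting this into Δ once more gives Δ = E X R T + E Δ T, so Δ = O(1), and
also Uᵀ Δ = O(1) where Cauchy–Schwarz would give only √n. It follows that Rᵀ R - 1 = O(1/n). Both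
ways of fixing the rotation then force R - 1 = O(1/n): alignment makes Ẑᵀ Z₁₂ positive semidefinite,
hence the square root of a matrix near (Z₁₂ᵀ Z₁₂)² (`bigO_sub_one_of_posSemidef`); diagonality
allows the eigenvalues to be matched (`bigO_sub_one_of_isDiag`).

The regression on Ẑ therefore differs from the one on Z₁₂ by a change of the noise response, a bias
from Z₁₂ - Ẑ and a leakage from Z₃, whose coefficient matrices are all O(1/n). After multiplication
by √n they vanish; for the noise response this is Chebyshev's inequality given A, by the
independence of A and the noise. What remains is √n (Z₁₂ᵀ Z₁₂)⁻¹ Z₁₂ᵀ ε, a weighted sum of i.i.d.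
variables. Its weights are uniformly small because the rows of X are bounded, so characteristic
functions give the normal limit (`tendstoInDistribution_mulVec`).

The spectral part is deterministic: it is carried out for all typical realizations at once, along a
filter on pairs of a sample size and an adjacency matrix, with h = √n as the scale. -/

set_option linter.unusedSectionVars false

namespace GFM

/-! ### Frobenius norm and trace inequalities -/

section Frobenius

variable {l m n : Type*} [Fintype l] [Fintype m] [Fintype n]

/-- The Frobenius norm of a real matrix. -/
noncomputable def fro (M : Matrix m n ℝ) : ℝ := √(∑ i, ∑ j, M i j ^ 2)

theorem fro_nonneg (M : Matrix m n ℝ) : 0 ≤ fro M := Real.sqrt_nonneg _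

theorem fro_sq (M : Matrix m n ℝ) : fro M ^ 2 = ∑ i, ∑ j, M i j ^ 2 :=
  Real.sq_sqrt (by positivity)

attribute [local instance] Matrix.frobeniusNormedAddCommGroup Matrix.frobeniusNormedSpace

theorem fro_eq_norm (M : Matrix m n ℝ) : fro M = ‖M‖ := by
  rw [Matrix.frobenius_norm_def, fro, Real.sqrt_eq_rpow]
  simp

theorem fro_mul_le (M : Matrix l m ℝ) (N : Matrix m n ℝ) : fro (M * N) ≤ fro M * fro N := by
  simpa only [fro_eq_norm] using Matrix.frobenius_norm_mul M N

theorem fro_add_le (M N : Matrix m n ℝ) : fro (M + N) ≤ fro M + fro N := by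
  simpa only [fro_eq_norm] using norm_add_le M N

theorem fro_sub_le (M N : Matrix m n ℝ) : fro (M - N) ≤ fro M + fro N := by
  simpa only [fro_eq_norm] using norm_sub_le M N

theorem fro_neg (M : Matrix m n ℝ) : fro (-M) = fro M := by
  simp only [fro_eq_norm, norm_neg]

theorem fro_smul (c : ℝ) (M : Matrix m n ℝ) : fro (c • M) = |c| * fro M := by
  simp only [fro_eq_norm, norm_smul, Real.norm_eq_abs]

theorem fro_transpose (M : Matrix m n ℝ) : fro M.transpose = fro M := by
  rw [fro, fro, Finset.sum_comm]; rfl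

theorem fro_eq_zero {M : Matrix m n ℝ} : fro M = 0 ↔ M = 0 := by
  rw [fro_eq_norm, norm_eq_zero]

theorem abs_apply_le_fro (M : Matrix m n ℝ) (i : m) (j : n) : |M i j| ≤ fro M := by
  refine Real.abs_le_sqrt ?_
  refine le_trans ?_ (Finset.single_le_sum (f := fun i => ∑ j, M i j ^ 2)
    (fun i _ => by positivity) (Finset.mem_univ i))
  exact Finset.single_le_sum (f := fun j => M i j ^ 2) (fun j _ => by positivity)
    (Finset.mem_univ j)

theorem fro_le_sum (M : Matrix m n ℝ) : fro M ≤ ∑ i, ∑ j, |M i j| := by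
  refine Real.sqrt_le_iff.2 ⟨by positivity, ?_⟩
  have h (s : Finset (m × n)) : ∑ q ∈ s, |M q.1 q.2| ^ 2 ≤ (∑ q ∈ s, |M q.1 q.2|) ^ 2 :=
    Finset.sum_sq_le_sq_sum_of_nonneg fun _ _ => abs_nonneg _
  simpa [← Finset.univ_product_univ, Finset.sum_product] using h Finset.univ

theorem fro_sq_eq_trace (M : Matrix m n ℝ) : fro M ^ 2 = (M.transpose * M).trace := by
  rw [fro_sq, Finset.sum_comm]
  simp [Matrix.trace, Matrix.mul_apply, pow_two]

theorem abs_trace_mul_le (M : Matrix m n ℝ) (N : Matrix n m ℝ) :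
    |(M * N).trace| ≤ fro M * fro N := by
  rw [← fro_transpose N]
  have h := abs_real_inner_le_norm (WithLp.toLp 2 fun q : m × n => M q.1 q.2)
    (WithLp.toLp 2 fun q : m × n => N q.2 q.1)
  simp only [EuclideanSpace.norm_eq, PiLp.inner_apply, Real.norm_eq_abs, sq_abs] at h
  simp only [← Finset.univ_product_univ, Finset.sum_product] at h
  convert h using 2
  · simp [Matrix.trace, Matrix.mul_apply, mul_comm]
  · rfl
  · rfl

theorem trace_le_fro [DecidableEq m] (M : Matrix m m ℝ) :
    M.trace ≤ fro (1 : Matrix m m ℝ) * fro M := by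
  have := abs_trace_mul_le (1 : Matrix m m ℝ) M
  rw [one_mul] at this
  exact (le_abs_self _).trans this

/-- Both squares expand into traces of powers of the two Gram matrices, which agree by cyclicity.
Near-orthogonality of the columns thus passes to the rows without loss. -/
theorem fro_mul_transpose_sub_one [DecidableEq m] (M : Matrix m m ℝ) :
    fro (M * M.transpose - 1) = fro (M.transpose * M - 1) := by
  have h : fro (M * M.transpose - 1) ^ 2 = fro (M.transpose * M - 1) ^ 2 := by
    rw [fro_sq_eq_trace, fro_sq_eq_trace]
    simp only [Matrix.transpose_sub, Matrix.transpose_mul, Matrix.transpose_transpose,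
      Matrix.transpose_one, sub_mul, mul_sub, one_mul, mul_one, Matrix.trace_sub]
    have h1 : (M * M.transpose * (M * M.transpose)).trace
        = (M.transpose * M * (M.transpose * M)).trace := by
      rw [Matrix.mul_assoc, Matrix.trace_mul_comm]
      simp only [Matrix.mul_assoc]
    rw [h1, Matrix.trace_mul_comm M]
  exact (pow_left_inj₀ (fro_nonneg _) (fro_nonneg _) two_ne_zero).1 h

/-- A square matrix acts on the Frobenius norm through the norm of `MᵀM`. -/
theorem fro_mul_sq_le (M : Matrix l m ℝ) (N : Matrix m n ℝ) :
    fro (M * N) ^ 2 ≤ fro (M.transpose * M) * fro N ^ 2 := by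
  have h : fro (M * N) ^ 2 = ((M.transpose * M) * (N * N.transpose)).trace := by
    rw [fro_sq_eq_trace, Matrix.transpose_mul, Matrix.mul_assoc, Matrix.trace_mul_comm]
    simp only [Matrix.mul_assoc]
  rw [h]
  refine ((le_abs_self _).trans (abs_trace_mul_le _ _)).trans ?_
  refine mul_le_mul_of_nonneg_left ?_ (fro_nonneg _)
  simpa [fro_transpose, pow_two] using fro_mul_le N N.transpose

end Frobenius

/-! ### Orders of magnitude of matrix families -/

section BigO

variable {ι : Type*} {L : Filter ι} {h : ι → ℝ}

/-- `BigO L h k M` says that `‖M x‖_F ≤ C h(x) ^ k` eventually along `L`. -/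
def BigO (L : Filter ι) (h : ι → ℝ) (k : ℤ) {m n : ι → Type} [∀ x, Fintype (m x)]
    [∀ x, Fintype (n x)] (M : ∀ x, Matrix (m x) (n x) ℝ) : Prop :=
  ∃ C : ℝ, ∀ᶠ x in L, fro (M x) ≤ C * h x ^ k

variable {l m n : ι → Type} [∀ x, Fintype (l x)] [∀ x, Fintype (m x)] [∀ x, Fintype (n x)]
  {j k : ℤ}

theorem BigO.mono (hh : Tendsto h L atTop) {M : ∀ x, Matrix (m x) (n x) ℝ} (hM : BigO L h j M)
    (hjk : j ≤ k) : BigO L h k M := by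
  obtain ⟨C, hC⟩ := hM
  refine ⟨max C 0, ?_⟩
  filter_upwards [hC, hh.eventually_ge_atTop 1] with x hx h1
  have : C * h x ^ j ≤ max C 0 * h x ^ j :=
    mul_le_mul_of_nonneg_right (le_max_left _ _) (by positivity)
  refine (hx.trans this).trans (mul_le_mul_of_nonneg_left ?_ (le_max_right _ _))
  exact zpow_le_zpow_right₀ h1 hjk

theorem BigO.add {M N : ∀ x, Matrix (m x) (n x) ℝ} (hM : BigO L h k M) (hN : BigO L h k N) :
    BigO L h k fun x => M x + N x := by
  obtain ⟨C, hC⟩ := hM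
  obtain ⟨C', hC'⟩ := hN
  refine ⟨C + C', ?_⟩
  filter_upwards [hC, hC'] with x h1 h2
  rw [add_mul]
  exact (fro_add_le _ _).trans (add_le_add h1 h2)

theorem BigO.neg {M : ∀ x, Matrix (m x) (n x) ℝ} (hM : BigO L h k M) :
    BigO L h k fun x => -M x := by
  simpa only [BigO, fro_neg] using hM

theorem BigO.sub {M N : ∀ x, Matrix (m x) (n x) ℝ} (hM : BigO L h k M) (hN : BigO L h k N) :
    BigO L h k fun x => M x - N x := by
  simpa only [sub_eq_add_neg] using hM.add hN.neg

theorem BigO.transpose {M : ∀ x, Matrix (m x) (n x) ℝ} (hM : BigO L h k M) :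
    BigO L h k fun x => (M x).transpose := by
  simpa only [BigO, fro_transpose] using hM

theorem BigO.mul (hh : Tendsto h L atTop) {M : ∀ x, Matrix (l x) (m x) ℝ}
    {N : ∀ x, Matrix (m x) (n x) ℝ} (hM : BigO L h j M) (hN : BigO L h k N) :
    BigO L h (j + k) fun x => M x * N x := by
  obtain ⟨C, hC⟩ := hM
  obtain ⟨C', hC'⟩ := hN
  refine ⟨C * C', ?_⟩
  filter_upwards [hC, hC', hh.eventually_ge_atTop 1] with x h1 h2 h3
  have h0 : h x ≠ 0 := by positivity
  rw [zpow_add₀ h0, mul_mul_mul_comm]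
  exact (fro_mul_le _ _).trans (mul_le_mul h1 h2 (fro_nonneg _) ((fro_nonneg _).trans h1))

theorem BigO.congr {M N : ∀ x, Matrix (m x) (n x) ℝ} (hM : BigO L h k M)
    (hMN : ∀ᶠ x in L, M x = N x) : BigO L h k N := by
  obtain ⟨C, hC⟩ := hM
  refine ⟨C, ?_⟩
  filter_upwards [hC, hMN] with x h1 h2
  rwa [← h2]

theorem BigO.of_entries {m n : Type} [Fintype m] [Fintype n] {M : ι → Matrix m n ℝ}
    (hM : ∀ a b, ∃ C, ∀ᶠ x in L, |M x a b| ≤ C * h x ^ k) : BigO L h k M := by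
  choose C hC using hM
  refine ⟨∑ a, ∑ b, C a b, ?_⟩
  filter_upwards [eventually_all.2 fun a => eventually_all.2 (hC a)] with x hx
  refine (fro_le_sum _).trans ?_
  rw [Finset.sum_mul]
  refine Finset.sum_le_sum fun a _ => ?_
  rw [Finset.sum_mul]
  exact Finset.sum_le_sum fun b _ => hx a b

theorem BigO.tendsto_zero (hh : Tendsto h L atTop) {M : ∀ x, Matrix (m x) (n x) ℝ}
    (hM : BigO L h k M) (hk : k < 0) : Tendsto (fun x => fro (M x)) L (𝓝 0) := by
  obtain ⟨C, hC⟩ := hM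
  have : Tendsto (fun x => C * h x ^ k) L (𝓝 (C * 0)) := by
    refine Tendsto.const_mul C ?_
    exact (tendsto_zpow_atTop_zero hk).comp hh
  rw [mul_zero] at this
  exact tendsto_of_tendsto_of_tendsto_of_le_of_le' tendsto_const_nhds this
    (Eventually.of_forall fun x => fro_nonneg _) hC

end BigO

/-! ### Perturbation expansion of the leading eigenspace -/

section Expansion

variable {ι : Type*} {L : Filter ι} {h : ι → ℝ} {n : ι → Type} [∀ x, Fintype (n x)]
  {D : Type} [Fintype D] [DecidableEq D]

/-- A perturbed low-rank spectral problem: `X Xᵀ + E` has the eigenspace spanned by `Y`, with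
`Y = (X Xᵀ + E) Y T` and `T = (Yᵀ Y)⁻¹` of order `h⁻²`; the perturbation `E` is negligible in
operator norm and of order `h²` when tested against `X`. -/
structure IsPerturbation (L : Filter ι) (h : ι → ℝ) (X : ∀ x, Matrix (n x) D ℝ)
    (E : ∀ x, Matrix (n x) (n x) ℝ) (Y : ∀ x, Matrix (n x) D ℝ) (T : ι → Matrix D D ℝ) :
    Prop where
  scale : Tendsto h L atTop
  symm : ∀ᶠ x in L, (E x).transpose = E x
  eigen : ∀ᶠ x in L, (X x * (X x).transpose + E x) * (Y x * T x) = Y x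
  gram : ∀ᶠ x in L, (Y x).transpose * Y x * T x = 1
  inv : BigO L h (-2) T
  signal : BigO L h 1 X
  noise : BigO L h 2 fun x => (X x).transpose * E x
  noise_quadratic : BigO L h 2 fun x => (X x).transpose * E x * X x
  small : ∀ δ > 0, ∀ᶠ x in L, ∀ M : Matrix (n x) D ℝ, fro (E x * M) ≤ δ * h x ^ (2 : ℤ) * fro M

variable {X : ∀ x, Matrix (n x) D ℝ} {E : ∀ x, Matrix (n x) (n x) ℝ} {Y : ∀ x, Matrix (n x) D ℝ}
  {T : ι → Matrix D D ℝ}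

namespace IsPerturbation

/-- Because Yᵀ Y T = 1, the Gram matrix of Y T is Tᵀ; its trace, the squared Frobenius norm, is of
order h⁻². -/
theorem bigO_mul_inv (H : IsPerturbation L h X E Y T) : BigO L h (-1) fun x => Y x * T x := by
  obtain ⟨C, hC⟩ := H.inv
  refine ⟨√(fro (1 : Matrix D D ℝ) * C), ?_⟩
  filter_upwards [hC, H.gram, H.scale.eventually_ge_atTop 1] with x hx hg h1
  have h0 : 0 < h x := by positivity
  have key : fro (Y x * T x) ^ 2 ≤ fro (1 : Matrix D D ℝ) * (C * h x ^ (-2 : ℤ)) := by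
    have : (Y x * T x).transpose * (Y x * T x) = (T x).transpose := by
      rw [Matrix.transpose_mul, Matrix.mul_assoc, ← Matrix.mul_assoc (Y x).transpose, hg,
        Matrix.mul_one]
    rw [fro_sq_eq_trace, this]
    refine (trace_le_fro _).trans ?_
    rw [fro_transpose]
    exact mul_le_mul_of_nonneg_left hx (fro_nonneg _)
  have h2 : h x ^ (-2 : ℤ) = (h x ^ (-1 : ℤ)) ^ 2 := by
    rw [← zpow_natCast, ← zpow_mul]; norm_num
  rw [h2, ← mul_assoc] at key
  have := Real.le_sqrt_of_sq_le key
  rwa [Real.sqrt_mul' _ (by positivity), Real.sqrt_sq (by positivity)] at this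

theorem bigO_coeff (H : IsPerturbation L h X E Y T) :
    BigO L h 0 fun x => (X x).transpose * (Y x * T x) :=
  H.signal.transpose.mul H.scale H.bigO_mul_inv

theorem eq_add (H : IsPerturbation L h X E Y T) :
    ∀ᶠ x in L, Y x = X x * ((X x).transpose * (Y x * T x)) + E x * (Y x * T x) := by
  filter_upwards [H.eigen] with x hx
  rw [← Matrix.mul_assoc (X x), ← Matrix.add_mul, hx]

/-- The expansion of Y substituted into Δ = E Y T: the first term involves the noise only through E
X, and the second is a contraction of Δ. -/
theorem residual_eq (H : IsPerturbation L h X E Y T) :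
    ∀ᶠ x in L, E x * (Y x * T x) = E x * X x * ((X x).transpose * (Y x * T x)) * T x
      + E x * (E x * (Y x * T x)) * T x := by
  filter_upwards [H.eq_add] with x hx
  rw [Matrix.mul_assoc (E x) (X x), ← Matrix.add_mul, ← Matrix.mul_add, ← hx, Matrix.mul_assoc]

theorem bigO_noise_mul (H : IsPerturbation L h X E Y T) : BigO L h 2 fun x => E x * X x := by
  refine H.noise.transpose.congr ?_
  filter_upwards [H.symm] with x hx
  rw [Matrix.transpose_mul, Matrix.transpose_transpose, hx]

/-- The residual `Δ = E Y T` of the expansion `Y = X R + Δ` is bounded. -/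
theorem bigO_residual (H : IsPerturbation L h X E Y T) :
    BigO L h 0 fun x => E x * (Y x * T x) := by
  obtain ⟨C, hC⟩ := (H.bigO_noise_mul.mul H.scale H.bigO_coeff).mul H.scale H.inv
  obtain ⟨C', hC'⟩ := H.inv
  -- With C' bounding h² T, this δ gives ‖E Δ T‖ ≤ ‖Δ‖ / 2, which is absorbed on the left and
  -- doubles the constant.
  have hδ : 0 < 1 / (2 * (|C'| + 1)) := by positivity
  refine ⟨2 * C, ?_⟩
  filter_upwards [hC, hC', H.small _ hδ, H.residual_eq, H.scale.eventually_ge_atTop 1]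
    with x h1 h2 h3 h4 h5
  have h0 : 0 < h x := by positivity
  set Δ := E x * (Y x * T x) with hΔ
  have hΔ' : fro (E x * Δ * T x) ≤ fro Δ / 2 := by
    have e1 := (fro_mul_le (E x * Δ) (T x)).trans (mul_le_mul (h3 Δ) h2 (fro_nonneg _)
      (mul_nonneg (by positivity) (fro_nonneg _)))
    refine e1.trans ?_
    have e2 : h x ^ (2 : ℤ) * h x ^ (-2 : ℤ) = 1 := by
      rw [← zpow_add₀ h0.ne']; norm_num
    have e3 : 1 / (2 * (|C'| + 1)) * C' ≤ 1 / 2 := by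
      rw [div_mul_eq_mul_div, one_mul, div_le_iff₀ (by positivity)]
      linarith [le_abs_self C']
    calc 1 / (2 * (|C'| + 1)) * h x ^ (2 : ℤ) * fro Δ * (C' * h x ^ (-2 : ℤ))
        = (1 / (2 * (|C'| + 1)) * C') * (h x ^ (2 : ℤ) * h x ^ (-2 : ℤ)) * fro Δ := by ring
      _ ≤ 1 / 2 * fro Δ := by
        rw [e2, mul_one]; exact mul_le_mul_of_nonneg_right e3 (fro_nonneg _)
      _ = fro Δ / 2 := by ring
  have h6 := fro_add_le (E x * X x * ((X x).transpose * (Y x * T x)) * T x) (E x * Δ * T x)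
  rw [← h4] at h6
  norm_num at h1 ⊢
  linarith

/-- Test matrices against which the noise averages out also average out the residual. -/
theorem bigO_transpose_mul_residual (H : IsPerturbation L h X E Y T) {m : Type} [Fintype m]
    {U : ∀ x, Matrix (n x) m ℝ} (hU : BigO L h 2 fun x => (U x).transpose * E x)
    (hUX : BigO L h 2 fun x => (U x).transpose * E x * X x) :
    BigO L h 0 fun x => (U x).transpose * (E x * (Y x * T x)) := by
  -- Both terms of `residual_eq` have order 2 + 0 - 2 = 0; the second one because Δ itself is
  -- already known to be bounded.
  have h1 := (hUX.mul H.scale H.bigO_coeff).mul H.scale H.inv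
  have h2 := (hU.mul H.scale H.bigO_residual).mul H.scale H.inv
  refine (h1.add h2).congr ?_
  filter_upwards [H.residual_eq] with x hx
  conv_rhs => rw [hx]
  simp only [Matrix.mul_add, Matrix.mul_assoc]

/-- From (Y T)ᵀ Y = 1 and Y = X R + Δ one gets 1 - Rᵀ R = Tᵀ Yᵀ Δ = Tᵀ (Rᵀ Xᵀ Δ + Δᵀ Δ). The bracket
is O(1) since Xᵀ Δ is; bounding (Y T)ᵀ Δ by norms would give only h⁻¹. -/
theorem bigO_gram_coeff_sub_one (H : IsPerturbation L h X E Y T) :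
    BigO L h (-2) fun x => ((X x).transpose * (Y x * T x)).transpose *
      ((X x).transpose * (Y x * T x)) - 1 := by
  have hX := H.bigO_transpose_mul_residual H.noise H.noise_quadratic
  have hΔ := H.bigO_residual
  have key : BigO L h (-2) fun x => (T x).transpose *
      (((X x).transpose * (Y x * T x)).transpose * ((X x).transpose * (E x * (Y x * T x)))
        + (E x * (Y x * T x)).transpose * (E x * (Y x * T x))) :=
    H.inv.transpose.mul H.scale
      ((H.bigO_coeff.transpose.mul H.scale hX).add (hΔ.transpose.mul H.scale hΔ))
  refine key.neg.congr ?_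
  filter_upwards [H.eq_add, H.gram, H.eigen] with x h1 h2 h3
  set R := (X x).transpose * (Y x * T x) with hR
  set Δ := E x * (Y x * T x) with hΔ
  have e1 : (Y x * T x).transpose * Y x = 1 := by
    have := congrArg Matrix.transpose h2
    simpa [Matrix.transpose_mul, Matrix.mul_assoc] using this
  have e2 : (Y x * T x).transpose * Δ = 1 - R.transpose * R := by
    have : Δ = Y x - X x * R := by rw [eq_sub_iff_add_eq, add_comm, ← h1]
    rw [this, Matrix.mul_sub, e1]
    simp [hR, Matrix.transpose_mul, Matrix.mul_assoc]
  have e3 : R.transpose * ((X x).transpose * Δ) + Δ.transpose * Δ = (Y x).transpose * Δ := by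
    conv_rhs => rw [h1]
    rw [Matrix.transpose_add, Matrix.add_mul, Matrix.transpose_mul (X x) R, Matrix.mul_assoc]
  rw [e3, ← Matrix.mul_assoc, ← Matrix.transpose_mul, e2, neg_sub]

end IsPerturbation

end Expansion

/-! ### Orthogonal Procrustes problem and stability of the square root -/

section Procrustes

open Matrix

variable {D : Type*} [Fintype D] [DecidableEq D]

theorem householder_mul_self {u : D → ℝ} {c : ℝ} (hc : c * (u ⬝ᵥ u) = 2) :
    (1 - c • vecMulVec u u) * (1 - c • vecMulVec u u) = (1 : Matrix D D ℝ) := by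
  have : (vecMulVec u u) * (vecMulVec u u) = (u ⬝ᵥ u) • vecMulVec u u := by
    rw [vecMulVec_mul_vecMulVec, vecMulVec_smul]
  rw [mul_sub, sub_mul, sub_mul, one_mul, one_mul, mul_one, smul_mul_smul_comm, this, smul_smul,
    mul_assoc, hc, mul_smul]
  module

theorem householder_transpose {D : Type*} [DecidableEq D] (u : D → ℝ) (c : ℝ) :
    (1 - c • vecMulVec u u)ᵀ = (1 - c • vecMulVec u u : Matrix D D ℝ) := by
  simp [transpose_sub, transpose_vecMulVec]

theorem trace_vecMulVec_mul {D : Type*} [Fintype D] (u v : D → ℝ) (T : Matrix D D ℝ) :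
    (vecMulVec u v * T).trace = v ⬝ᵥ T *ᵥ u := by
  rw [vecMulVec_mul, trace_vecMulVec, dotProduct_comm, dotProduct_mulVec]

/-- A matrix whose trace cannot be increased by an orthogonal factor is positive semidefinite. -/
theorem posSemidef_of_trace_maximal {T : Matrix D D ℝ}
    (hT : ∀ V : Matrix D D ℝ, IsOrthogonal V → (V * T).trace ≤ T.trace) : T.PosSemidef := by
  -- The reflection in v lowers the trace by 2 vᵀ T v / vᵀ v.
  have hpos (v : D → ℝ) : 0 ≤ v ⬝ᵥ T *ᵥ v := by
    by_cases hv : v = 0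
    · simp [hv]
    have hs : 0 < v ⬝ᵥ v :=
      lt_of_le_of_ne (Finset.sum_nonneg fun i _ => mul_self_nonneg _)
        fun h => hv (dotProduct_self_eq_zero.1 h.symm)
    have hc : 2 / (v ⬝ᵥ v) * (v ⬝ᵥ v) = 2 := div_mul_cancel₀ _ hs.ne'
    have h1 := hT (1 - (2 / (v ⬝ᵥ v)) • vecMulVec v v)
      ⟨by rw [householder_transpose, householder_mul_self hc],
        by rw [householder_transpose, householder_mul_self hc]⟩
    rw [sub_mul, one_mul, trace_sub, smul_mul_assoc, trace_smul, trace_vecMulVec_mul,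
      smul_eq_mul] at h1
    have h2 : 0 ≤ 2 / (v ⬝ᵥ v) * (v ⬝ᵥ T *ᵥ v) := by linarith
    exact nonneg_of_mul_nonneg_right h2 (by positivity)
  have hsymm (a b : D) : T b a = T a b := by
    by_cases hab : a = b
    · rw [hab]
    have hdiag (a : D) : 0 ≤ T a a := by simpa using hpos (Pi.single a 1)
    set δ := T b a - T a b with hδ
    set m := T a a + T b b with hm
    have hm0 : 0 ≤ m := add_nonneg (hdiag a) (hdiag b)
    -- The product of the reflections in e_a and e_a + s e_b is a plane rotation. Maximality for it
    -- reads s δ ≤ s² m; since δ = s (m + 1) for this s, it follows that s² ≤ 0 and δ = 0.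
    set s := δ / (m + 1) with hs
    set u : D → ℝ := Pi.single a 1 with hu
    set v : D → ℝ := Pi.single a 1 + Pi.single b s with hv
    have huu : u ⬝ᵥ u = 1 := by simp [hu]
    have huv : u ⬝ᵥ v = 1 := by simp [hu, hv, hab]
    have hvv : v ⬝ᵥ v = 1 + s ^ 2 := by
      simp [hv, hab, Ne.symm hab]; ring
    have hpos' : 0 < 1 + s ^ 2 := by positivity
    have hcu : 2 * (u ⬝ᵥ u) = 2 := by rw [huu]; norm_num
    have hcv : 2 / (1 + s ^ 2) * (v ⬝ᵥ v) = 2 := by rw [hvv]; field_simp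
    set H := (1 - (2 : ℝ) • vecMulVec u u : Matrix D D ℝ) with hH
    set K := (1 - (2 / (1 + s ^ 2)) • vecMulVec v v : Matrix D D ℝ) with hK
    have hHH : H * H = 1 := householder_mul_self hcu
    have hKK : K * K = 1 := householder_mul_self hcv
    have hHt : Hᵀ = H := householder_transpose _ _
    have hKt : Kᵀ = K := householder_transpose _ _
    have h1 := hT (H * K) ⟨by
      rw [transpose_mul, hHt, hKt, mul_assoc, ← mul_assoc H, hHH, one_mul, hKK], by
      rw [transpose_mul, hHt, hKt, mul_assoc, ← mul_assoc K, hKK, one_mul, hHH]⟩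
    have e1 : v ⬝ᵥ T *ᵥ u = T a a + s * T b a := by
      simp [hu, hv, add_dotProduct]
    have e2 : v ⬝ᵥ T *ᵥ v = T a a + s * (T a b + T b a) + s ^ 2 * T b b := by
      simp [hv, add_dotProduct, mulVec_add]; ring
    have e3 : u ⬝ᵥ T *ᵥ u = T a a := by simp [hu]
    have e4 : (H * K * T).trace = T.trace - 2 * T a a
        - 2 / (1 + s ^ 2) * (T a a + s * (T a b + T b a) + s ^ 2 * T b b)
        + 4 / (1 + s ^ 2) * (T a a + s * T b a) := by
      have : vecMulVec u u * vecMulVec v v = vecMulVec u v := by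
        rw [vecMulVec_mul_vecMulVec, huv, one_smul]
      have hexp (c : ℝ) (M N : Matrix D D ℝ) : (1 - (2 : ℝ) • M) * (1 - c • N)
          = 1 - (2 : ℝ) • M - c • N + (2 * c) • (M * N) := by
        simp only [Matrix.sub_mul, Matrix.mul_sub, Matrix.one_mul, Matrix.mul_one,
          smul_mul_smul_comm]
        abel
      rw [hH, hK, hexp, this]
      simp only [Matrix.sub_mul, Matrix.add_mul, trace_add, trace_sub, smul_mul_assoc, trace_smul, trace_vecMulVec_mul, Matrix.one_mul,
        smul_eq_mul, e1, e2, e3]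
      ring
    rw [e4] at h1
    have h2 : 0 ≤ s ^ 2 * m - s * δ := by
      have : 2 * (s ^ 2 * m - s * δ) = (1 + s ^ 2) * (T.trace - (T.trace - 2 * T a a
        - 2 / (1 + s ^ 2) * (T a a + s * (T a b + T b a) + s ^ 2 * T b b)
        + 4 / (1 + s ^ 2) * (T a a + s * T b a))) := by
        field_simp
        rw [hm, hδ]
        ring
      nlinarith [mul_nonneg hpos'.le (sub_nonneg.2 h1)]
    have hδs : δ = s * (m + 1) := by rw [hs]; field_simp
    have h3 : s ^ 2 ≤ 0 := by rw [hδs] at h2; nlinarith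
    have h4 : s = 0 := by nlinarith
    have : δ = 0 := by rw [hδs, h4, zero_mul]
    exact sub_eq_zero.1 this
  refine PosSemidef.of_dotProduct_mulVec_nonneg ?_ fun v => by simpa using hpos v
  ext a b
  simpa using hsymm a b

/-- Lipschitz estimate for the square root near a Gram matrix `Zᵀ Z`. -/
theorem fro_sub_gram_le {n : Type*} [Fintype n] {T : Matrix D D ℝ} (hT : T.PosSemidef)
    (Z : Matrix n D ℝ) (hZ : (Zᵀ * Z)⁻¹ * (Zᵀ * Z) = 1) :
    fro (T - Zᵀ * Z) ≤
      fro ((Zᵀ * Z)⁻¹ * Zᵀ) ^ 2 * fro (T * T - (Zᵀ * Z) * (Zᵀ * Z)) := by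
  set G := Zᵀ * Z with hG
  set δ := T - G with hδ
  have hTt : Tᵀ = T := by simpa using hT.isHermitian.eq
  have hGt : Gᵀ = G := by simp [hG, transpose_mul]
  have hδt : δᵀ = δ := by rw [hδ, transpose_sub, hTt, hGt]
  have h1 : 0 ≤ (δ * (T * δ)).trace := by
    have := (hT.conjTranspose_mul_mul_same δ).trace_nonneg
    rwa [conjTranspose_eq_transpose_of_trivial, hδt, Matrix.mul_assoc] at this
  have h2 : fro (Z * δ) ^ 2 = (δ * (δ * G)).trace := by
    rw [fro_sq_eq_trace, transpose_mul, hδt, Matrix.mul_assoc, ← Matrix.mul_assoc Zᵀ, ← hG,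
      trace_mul_comm, Matrix.mul_assoc, trace_mul_comm, Matrix.mul_assoc]
  -- Pairing this identity with δ produces tr(δ T δ) ≥ 0 and tr(δ δ G) = ‖Z δ‖², so the difference
  -- of the squares controls ‖Z δ‖, and δ = G⁻¹ Zᵀ (Z δ).
  have h3 : T * δ + δ * G = T * T - G * G := by
    rw [hδ, mul_sub, sub_mul]; abel
  have h4 : fro (Z * δ) ^ 2 ≤ fro δ * fro (T * T - G * G) := by
    refine le_trans ?_ ((le_abs_self _).trans (abs_trace_mul_le _ _))
    rw [← h3, mul_add, trace_add, h2]
    linarith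
  have h5 : fro δ ≤ fro (G⁻¹ * Zᵀ) * fro (Z * δ) := by
    refine le_trans (le_of_eq ?_) (fro_mul_le _ _)
    rw [Matrix.mul_assoc, ← Matrix.mul_assoc Zᵀ, ← hG, ← Matrix.mul_assoc, hZ, Matrix.one_mul]
  rcases (fro_nonneg δ).eq_or_lt with h0 | h0
  · rw [← h0]
    exact mul_nonneg (sq_nonneg _) (fro_nonneg _)
  refine le_of_mul_le_mul_left ?_ h0
  calc fro δ * fro δ ≤ (fro (G⁻¹ * Zᵀ) * fro (Z * δ)) * (fro (G⁻¹ * Zᵀ) * fro (Z * δ)) :=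
        mul_self_le_mul_self h0.le h5
    _ = fro (G⁻¹ * Zᵀ) ^ 2 * fro (Z * δ) ^ 2 := by ring
    _ ≤ fro (G⁻¹ * Zᵀ) ^ 2 * (fro δ * fro (T * T - G * G)) :=
        mul_le_mul_of_nonneg_left h4 (sq_nonneg _)
    _ = _ := by ring

end Procrustes

/-! ### Matching of well-separated eigenvalues -/

section Matching

variable {D : Type*} [Fintype D] [DecidableEq D]

/-- Eigenvalue matching: if `R` is nearly orthogonal and nearly intertwines two diagonal matrices
with the same ordering of the diagonals, the second one with separated entries, then the
off-diagonal entries of `R` are small. -/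
theorem abs_offDiag_le_of_intertwine {R : Matrix D D ℝ} {e g : D → ℝ} {C γ : ℝ}
    (hγ : 0 < γ) (hR : ∀ a b, |R a b * (e b - g a)| ≤ C)
    (horth : fro (R.transpose * R - 1) ≤ 1 / (16 * (Fintype.card D + 1) ^ 2))
    (hgap : ∀ a b, a ≠ b → γ ≤ |g a - g b|) (hmono : ∀ a b, g a < g b → e a ≤ e b)
    (hlarge : 8 * (Fintype.card D + 1) ^ 2 * C ≤ γ) {a b : D} (hab : a ≠ b) :
    |R a b| ≤ 2 * C / γ := by
  set d : ℝ := Fintype.card D + 1 with hd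
  have hd1 : 1 ≤ d := by rw [hd]; linarith [Nat.cast_nonneg (α := ℝ) (Fintype.card D)]
  have hd2 : d ≤ d ^ 2 := by nlinarith
  have hd8 : 1 / (16 * d ^ 2) ≤ 1 / 16 := by
    apply one_div_le_one_div_of_le <;> linarith
  have hent (b c : D) : |∑ a, R a b * R a c - (1 : Matrix D D ℝ) b c| ≤ 1 / (16 * d ^ 2) := by
    have := (abs_apply_le_fro (R.transpose * R - 1) b c).trans horth
    simpa [Matrix.mul_apply] using this
  -- Every column of R has norm close to one, so some entry in it is large. Its row σ b is where e b
  -- must be close to g (σ b); all other entries of the column are small by the gap.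
  have hex (b : D) : ∃ a, 1 / 2 ≤ d * R a b ^ 2 := by
    by_contra! hcon
    have h1 := abs_le.1 (hent b b)
    have h2 : ∑ a, R a b * R a b ≤ ∑ _a : D, 1 / (2 * d) := by
      refine Finset.sum_le_sum fun a _ => ?_
      rw [le_div_iff₀ (by positivity)]
      nlinarith [hcon a]
    have h3 : ∑ _a : D, 1 / (2 * d) ≤ 1 / 2 := by
      rw [Finset.sum_const, Finset.card_univ, nsmul_eq_mul, mul_one_div, div_le_div_iff₀]
        <;> linarith
    rw [Matrix.one_apply_eq] at h1
    linarith [h1.1]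
  choose σ hσ using hex
  have hRd (b : D) : 1 / 2 ≤ d * |R (σ b) b| := by
    have h1 := hσ b
    rw [← sq_abs] at h1
    have h0 := abs_nonneg (R (σ b) b)
    nlinarith [sq_nonneg (d * |R (σ b) b| - 1 / 2)]
  have hclose (b : D) : |e b - g (σ b)| ≤ γ / 4 := by
    have h1 := hR (σ b) b
    rw [abs_mul] at h1
    have h2 := hRd b
    have h3 := abs_nonneg (e b - g (σ b))
    nlinarith [mul_le_mul_of_nonneg_right h2 h3, mul_le_mul_of_nonneg_left h1 (by linarith : 0 ≤ d)]
  have hoff (a b : D) (hne : a ≠ σ b) : |R a b| ≤ 2 * C / γ := by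
    have h1 := hR a b
    have h2 : γ / 2 ≤ |e b - g a| := by
      have h3 := hgap (σ b) a hne.symm
      have h4 := hclose b
      have h5 : |g (σ b) - g a| ≤ |e b - g a| + |e b - g (σ b)| := by
        have := abs_sub (e b - g a) (e b - g (σ b))
        simpa using this
      linarith
    rw [abs_mul] at h1
    rw [le_div_iff₀ hγ]
    nlinarith [abs_nonneg (R a b), mul_le_mul_of_nonneg_left h2 (abs_nonneg (R a b))]
  have hCγ : 2 * C / γ ≤ 1 / (4 * d ^ 2) := by
    rw [div_le_div_iff₀ hγ (by positivity)]
    linarith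
  have hsq (a b : D) (hne : a ≠ σ b) : |R a b| ≤ 1 / (4 * d ^ 2) := (hoff a b hne).trans hCγ
  -- Two columns with their large entries in the same row would have inner product at least about 1
  -- / (4 d²), against near-orthogonality.
  have hinj : Function.Injective σ := by
    intro b c hbc
    by_contra hne
    have h1 := hent b c
    rw [Matrix.one_apply_ne hne, sub_zero,
      ← Finset.add_sum_erase _ _ (Finset.mem_univ (σ b))] at h1
    have h2 : |∑ a ∈ Finset.univ.erase (σ b), R a b * R a c| ≤
        ∑ _a : D, 1 / (4 * d ^ 2) * (1 / (4 * d ^ 2)) := by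
      refine (Finset.abs_sum_le_sum_abs _ _).trans ?_
      refine (Finset.sum_le_sum fun a ha => ?_).trans (Finset.sum_le_sum_of_subset_of_nonneg
        (Finset.erase_subset _ _) fun _ _ _ => by positivity)
      rw [abs_mul]
      have hne' := Finset.ne_of_mem_erase ha
      exact mul_le_mul (hsq a b hne') (hsq a c (hbc ▸ hne')) (abs_nonneg _) (by positivity)
    have h3 : ∑ _a : D, 1 / (4 * d ^ 2) * (1 / (4 * d ^ 2)) ≤ 1 / (16 * d ^ 2) := by
      rw [Finset.sum_const, Finset.card_univ, nsmul_eq_mul]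
      have : (Fintype.card D : ℝ) ≤ d := by rw [hd]; linarith
      calc (Fintype.card D : ℝ) * (1 / (4 * d ^ 2) * (1 / (4 * d ^ 2)))
          ≤ d * (1 / (4 * d ^ 2) * (1 / (4 * d ^ 2))) := mul_le_mul_of_nonneg_right this (by positivity)
        _ = 1 / (16 * d ^ 3) := by field_simp; norm_num
        _ ≤ 1 / (16 * d ^ 2) := by
          apply one_div_le_one_div_of_le (by positivity)
          nlinarith [mul_le_mul_of_nonneg_right hd1 (sq_nonneg d)]
    have h4 : 1 / 4 ≤ d * |R (σ b) b * R (σ b) c| * d := by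
      rw [abs_mul]
      have e1 := hRd b
      have e2 := hRd c
      rw [← hbc] at e2
      nlinarith
    have h5 : |R (σ b) b * R (σ b) c| ≤ 1 / (16 * d ^ 2) + 1 / (16 * d ^ 2) := by
      have := abs_sub (R (σ b) b * R (σ b) c + ∑ a ∈ Finset.univ.erase (σ b), R a b * R a c)
        (∑ a ∈ Finset.univ.erase (σ b), R a b * R a c)
      rw [add_sub_cancel_right] at this
      linarith
    have h6 : 1 / 4 ≤ d ^ 2 * (1 / (16 * d ^ 2) + 1 / (16 * d ^ 2)) :=
      calc 1 / 4 ≤ d ^ 2 * |R (σ b) b * R (σ b) c| := by linarith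
        _ ≤ _ := mul_le_mul_of_nonneg_left h5 (by positivity)
    have h7 : d ^ 2 * (1 / (16 * d ^ 2) + 1 / (16 * d ^ 2)) = 1 / 8 := by field_simp; norm_num
    linarith
  have hstrict (a b : D) (hlt : g a < g b) : g (σ a) < g (σ b) := by
    have h1 := hmono a b hlt
    have h2 := abs_le.1 (hclose a)
    have h3 := abs_le.1 (hclose b)
    have hne : σ a ≠ σ b := fun h => by
      have := hinj h
      rw [this] at hlt
      exact lt_irrefl _ hlt
    have h4 := hgap _ _ hne
    by_contra! hge
    rw [abs_of_nonneg (sub_nonneg.2 hge)] at h4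
    linarith [h2.1, h3.2]
  have hginj : Function.Injective g := fun a b h => by
    by_contra hne
    have := hgap a b hne
    rw [h, sub_self, abs_zero] at this
    linarith
  have hσid (b : D) : σ b = b := by
    -- Ordered by `g`, the finite set `D` has no strictly monotone self-map except the identity.
    let _ : LinearOrder D := LinearOrder.lift' g hginj
    have hm : StrictMono σ := fun a b h => hstrict a b h
    exact le_antisymm hm.apply_le hm.le_apply
  exact hoff a b (by rw [hσid]; exact hab)

end Matching

/-! ### Fixing the rotation -/

section Rotation

variable {ι : Type*} {L : Filter ι} {h : ι → ℝ} {n : ι → Type} [∀ x, Fintype (n x)]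
  {D : Type} [Fintype D] [DecidableEq D]

/-- The matrix `Y` is `Z` up to a nearly orthogonal factor `R` and a bounded error `Δ` that is
nearly orthogonal to `Z`. -/
structure IsNearRotation (L : Filter ι) (h : ι → ℝ) (Z : ∀ x, Matrix (n x) D ℝ)
    (R : ι → Matrix D D ℝ) (Δ Y : ∀ x, Matrix (n x) D ℝ) : Prop where
  scale : Tendsto h L atTop
  eq : ∀ᶠ x in L, Y x = Z x * R x + Δ x
  coeff : BigO L h 0 R
  orth : BigO L h (-2) fun x => (R x).transpose * R x - 1
  error : BigO L h 0 Δ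
  cross : BigO L h 0 fun x => (Z x).transpose * Δ x
  factor : BigO L h 1 Z
  inv : BigO L h (-2) fun x => ((Z x).transpose * Z x)⁻¹
  inv_mul : ∀ᶠ x in L, ((Z x).transpose * Z x)⁻¹ * ((Z x).transpose * Z x) = 1

variable {Z : ∀ x, Matrix (n x) D ℝ} {R : ι → Matrix D D ℝ} {Δ Y : ∀ x, Matrix (n x) D ℝ}

theorem gram_transpose {m D : Type*} [Fintype m] (Z : Matrix m D ℝ) :
    (Z.transpose * Z).transpose = Z.transpose * Z := by
  rw [Matrix.transpose_mul, Matrix.transpose_transpose]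

namespace IsNearRotation

theorem bigO_gram (H : IsNearRotation L h Z R Δ Y) :
    BigO L h 2 fun x => (Z x).transpose * Z x :=
  H.factor.transpose.mul H.scale H.factor

theorem bigO_orth' (H : IsNearRotation L h Z R Δ Y) :
    BigO L h (-2) fun x => R x * (R x).transpose - 1 := by
  simpa only [BigO, fro_mul_transpose_sub_one] using H.orth

theorem transpose_mul_eq (H : IsNearRotation L h Z R Δ Y) :
    ∀ᶠ x in L, (Y x).transpose * Z x =
      (R x).transpose * ((Z x).transpose * Z x) + ((Z x).transpose * Δ x).transpose := by
  filter_upwards [H.eq] with x hx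
  rw [hx, Matrix.transpose_add, Matrix.add_mul, Matrix.transpose_mul, Matrix.transpose_mul,
    Matrix.transpose_transpose, Matrix.mul_assoc]

/-- If `Yᵀ Z` is positive semidefinite then the factor is close to the identity. -/
theorem bigO_sub_one_of_posSemidef (H : IsNearRotation L h Z R Δ Y)
    (hY : ∀ᶠ x in L, ((Y x).transpose * Z x).PosSemidef) :
    BigO L h (-2) fun x => R x - 1 := by
  have hG := H.bigO_gram
  have h1 : BigO L h 2 fun x => (Z x).transpose * Z x * (R x * (R x).transpose - 1) *
      ((Z x).transpose * Z x) := (hG.mul H.scale H.bigO_orth').mul H.scale hG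
  have h2 : BigO L h 2 fun x => (Z x).transpose * Z x * R x * ((Z x).transpose * Δ x).transpose :=
    (hG.mul H.scale H.coeff).mul H.scale H.cross.transpose
  have h3 : BigO L h 2 fun x => (Z x).transpose * Δ x * ((Z x).transpose * Δ x).transpose :=
    (H.cross.mul H.scale H.cross.transpose).mono H.scale (by norm_num)
  -- With G = Zᵀ Z and S = Yᵀ Z = Rᵀ G + K symmetric, S² = Sᵀ S has leading term G R Rᵀ G = G² +
  -- O(h²), as R Rᵀ - 1 = O(h⁻²).
  have hsq : BigO L h 2 fun x => (Y x).transpose * Z x * ((Y x).transpose * Z x) -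
      (Z x).transpose * Z x * ((Z x).transpose * Z x) := by
    refine (((h1.add h2).add h2.transpose).add h3).congr ?_
    filter_upwards [hY, H.transpose_mul_eq] with x hp hx
    set G := (Z x).transpose * Z x with hGx
    set K := ((Z x).transpose * Δ x).transpose with hK
    have hKt : (Z x).transpose * Δ x = K.transpose := by rw [hK, Matrix.transpose_transpose]
    have hGt : G.transpose = G := gram_transpose _
    have hs : ((Y x).transpose * Z x).transpose = (Y x).transpose * Z x := by
      simpa using hp.isHermitian.eq
    have : (Y x).transpose * Z x * ((Y x).transpose * Z x)
        = ((R x).transpose * G + K).transpose * ((R x).transpose * G + K) := by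
      rw [← hx, hs]
    rw [this, hKt]
    simp only [Matrix.transpose_add, Matrix.transpose_mul, Matrix.transpose_transpose, hGt]
    noncomm_ring
  have hGZ : BigO L h (-1) fun x => ((Z x).transpose * Z x)⁻¹ * (Z x).transpose :=
    H.inv.mul H.scale H.factor.transpose
  -- Taking the square root near G ~ h² gains a factor h⁻².
  have hdiff : BigO L h 0 fun x => (Y x).transpose * Z x - (Z x).transpose * Z x := by
    obtain ⟨C, hC⟩ := hGZ
    obtain ⟨C', hC'⟩ := hsq
    refine ⟨C ^ 2 * C', ?_⟩
    filter_upwards [hC, hC', hY, H.inv_mul, H.scale.eventually_ge_atTop 1] with x e1 e2 e3 e4 e5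
    have h0 : h x ≠ 0 := by positivity
    refine (fro_sub_gram_le e3 (Z x) e4).trans ?_
    refine (mul_le_mul (pow_le_pow_left₀ (fro_nonneg _) e1 2) e2 (fro_nonneg _)
      (sq_nonneg _)).trans (le_of_eq ?_)
    have : h x ^ (-1 : ℤ) * h x = 1 := by rw [zpow_neg_one, inv_mul_cancel₀ h0]
    rw [show h x ^ (2 : ℤ) = h x ^ 2 by norm_cast, zpow_zero]
    linear_combination C ^ 2 * C' * (h x ^ (-1 : ℤ) * h x + 1) * this
  have hlast : BigO L h (-2) fun x => (R x).transpose - 1 := by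
    refine ((hdiff.sub H.cross.transpose).mul H.scale H.inv).congr ?_
    filter_upwards [H.transpose_mul_eq, H.inv_mul] with x hx hi
    rw [hx, add_sub_right_comm, add_sub_cancel_right, ← one_mul ((Z x).transpose * Z x),
      ← Matrix.mul_assoc, mul_one, ← Matrix.sub_mul, one_mul, Matrix.mul_assoc,
      mul_eq_one_comm.1 hi, Matrix.mul_one]
  simpa using hlast.transpose

/-- The cross terms Rᵀ Zᵀ Δ are bounded only because Zᵀ Δ is; the sizes of Z and Δ alone would leave
an error of order h. -/
theorem bigO_gram_sub (H : IsNearRotation L h Z R Δ Y) :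
    BigO L h 0 fun x => (Y x).transpose * Y x -
      (R x).transpose * ((Z x).transpose * Z x) * R x := by
  have h1 : BigO L h 0 fun x => (R x).transpose * ((Z x).transpose * Δ x) :=
    H.coeff.transpose.mul H.scale H.cross
  have h2 : BigO L h 0 fun x => (Δ x).transpose * Δ x := H.error.transpose.mul H.scale H.error
  refine ((h1.add h1.transpose).add h2).congr ?_
  filter_upwards [H.eq] with x hx
  rw [hx]
  simp only [Matrix.transpose_add, Matrix.transpose_mul, Matrix.transpose_transpose,
    Matrix.add_mul, Matrix.mul_add, Matrix.mul_assoc]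
  abel

/-- If `Yᵀ Y` and `Zᵀ Z` are diagonal with the same order of the diagonal entries, those of `Zᵀ Z`
being well separated, and the columns of `Y` and `Z` have nonnegative inner products, then the
factor is close to the identity. -/
theorem bigO_sub_one_of_isDiag (H : IsNearRotation L h Z R Δ Y)
    (hY : ∀ᶠ x in L, ((Y x).transpose * Y x).IsDiag)
    (hZ : ∀ᶠ x in L, ((Z x).transpose * Z x).IsDiag) {c : ℝ} (hc : 0 < c)
    (hgap : ∀ᶠ x in L, ∀ a b, a ≠ b →
      c * h x ^ (2 : ℤ) ≤ |((Z x).transpose * Z x) a a - ((Z x).transpose * Z x) b b|)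
    (hpos : ∀ᶠ x in L, ∀ a, c * h x ^ (2 : ℤ) ≤ ((Z x).transpose * Z x) a a)
    (horder : ∀ᶠ x in L, ∀ a b, ((Z x).transpose * Z x) a a < ((Z x).transpose * Z x) b b →
      ((Y x).transpose * Y x) a a ≤ ((Y x).transpose * Y x) b b)
    (hsign : ∀ᶠ x in L, ∀ a, 0 ≤ ((Y x).transpose * Z x) a a) :
    BigO L h (-2) fun x => R x - 1 := by
  -- Since Yᵀ Y is Rᵀ G R up to O(1) and R Rᵀ is nearly 1, R intertwines the diagonal matrices Yᵀ Y
  -- and G up to O(1), whereas the gaps of G are of order h².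
  have hint : BigO L h 0 fun x => R x * ((Y x).transpose * Y x) -
      (Z x).transpose * Z x * R x := by
    have h1 : BigO L h 0 fun x => (R x * (R x).transpose - 1) * ((Z x).transpose * Z x) * R x :=
      (H.bigO_orth'.mul H.scale H.bigO_gram).mul H.scale H.coeff
    refine (h1.add (H.coeff.mul H.scale H.bigO_gram_sub)).congr (Eventually.of_forall fun x => ?_)
    noncomm_ring
  obtain ⟨C, hC⟩ := hint
  obtain ⟨C₂, hC₂⟩ := H.cross
  obtain ⟨C₁, hC₁⟩ := H.orth
  have horth0 := H.orth.tendsto_zero H.scale (by norm_num)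
  have hsmall : (0 : ℝ) < 1 / (16 * (Fintype.card D + 1) ^ 2) := by positivity
  have hh2 : Tendsto (fun x => h x ^ (2 : ℤ)) L atTop := by
    exact (tendsto_zpow_atTop_atTop (α := ℝ) (n := 2) (by norm_num)).comp H.scale
  have hoff : ∀ᶠ x in L, ∀ a b, a ≠ b → |R x a b| ≤ 2 * C / c * h x ^ (-2 : ℤ) := by
    filter_upwards [hC, hY, hZ, hgap, horder, horth0.eventually (ge_mem_nhds hsmall),
      hh2.eventually_ge_atTop (8 * (Fintype.card D + 1) ^ 2 * C / c),
      H.scale.eventually_ge_atTop 1] with x e1 e2 e3 e4 e5 e6 e7 e8 a b hab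
    have h0 : 0 < h x := by positivity
    have key := abs_offDiag_le_of_intertwine (R := R x) (C := C) (γ := c * h x ^ (2 : ℤ))
      (e := fun b => ((Y x).transpose * Y x) b b) (g := fun a => ((Z x).transpose * Z x) a a)
      (by positivity) (fun a b => ?_) e6 e4 e5 ?_ hab
    · refine key.trans (le_of_eq ?_)
      rw [zpow_neg]
      field_simp
    · have := (abs_apply_le_fro _ a b).trans e1
      rw [zpow_zero, mul_one, Matrix.sub_apply, Matrix.mul_apply, Matrix.mul_apply,
        Finset.sum_eq_single b (fun i _ hi => by rw [e2 hi, mul_zero]) (by simp),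
        Finset.sum_eq_single a (fun i _ hi => by rw [e3 hi.symm, zero_mul]) (by simp)] at this
      rwa [mul_comm (((Z x).transpose * Z x) a a), ← mul_sub] at this
    · rw [div_le_iff₀ hc] at e7
      linarith
  have hdiag : ∀ᶠ x in L, ∀ a, |R x a a - 1| ≤
      (|C₁| + Fintype.card D * (2 * C / c) ^ 2) * h x ^ (-2 : ℤ) := by
    have hz : Tendsto (fun x => (|C₁| + Fintype.card D * (2 * C / c) ^ 2) * h x ^ (-2 : ℤ)) L
        (𝓝 0) := by
      have := ((tendsto_zpow_atTop_zero (𝕜 := ℝ) (n := -2) (by norm_num)).comp H.scale).const_mul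
        (|C₁| + Fintype.card D * (2 * C / c) ^ 2)
      simpa using this
    filter_upwards [hC₁, hC₂, hZ, hoff, hpos, hsign, H.transpose_mul_eq,
      hz.eventually (ge_mem_nhds (show (0 : ℝ) < 1 / 2 by norm_num)),
      hh2.eventually_ge_atTop (4 * C₂ / c), H.scale.eventually_ge_atTop 1]
      with x e1 e2 e3 e4 e5 e6 e7 e8 e9 e10 a
    have h0 : 0 < h x := by positivity
    have hle1 : h x ^ (-2 : ℤ) ≤ 1 := zpow_le_one_of_nonpos₀ e10 (by norm_num)
    have hpos2 : 0 < h x ^ (-2 : ℤ) := by positivity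
    have hsq : |R x a a ^ 2 - 1| ≤
        (|C₁| + Fintype.card D * (2 * C / c) ^ 2) * h x ^ (-2 : ℤ) := by
      have h1 := (abs_apply_le_fro _ a a).trans e1
      rw [Matrix.sub_apply, Matrix.one_apply_eq, Matrix.mul_apply] at h1
      simp only [Matrix.transpose_apply] at h1
      rw [← Finset.add_sum_erase _ _ (Finset.mem_univ a)] at h1
      have h2 : |∑ i ∈ Finset.univ.erase a, R x i a * R x i a| ≤
          ∑ _i : D, (2 * C / c) ^ 2 * h x ^ (-2 : ℤ) := by
        refine (Finset.abs_sum_le_sum_abs _ _).trans ?_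
        refine (Finset.sum_le_sum fun i hi => ?_).trans (Finset.sum_le_sum_of_subset_of_nonneg
          (Finset.erase_subset _ _) fun _ _ _ => by positivity)
        have h3 := e4 i a (Finset.ne_of_mem_erase hi)
        rw [abs_mul]
        calc |R x i a| * |R x i a|
            ≤ (2 * C / c * h x ^ (-2 : ℤ)) * (2 * C / c * h x ^ (-2 : ℤ)) :=
              mul_self_le_mul_self (abs_nonneg _) h3
          _ = ((2 * C / c) ^ 2 * h x ^ (-2 : ℤ)) * h x ^ (-2 : ℤ) := by ring
          _ ≤ ((2 * C / c) ^ 2 * h x ^ (-2 : ℤ)) * 1 :=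
              mul_le_mul_of_nonneg_left hle1 (by positivity)
          _ = _ := mul_one _
      rw [Finset.sum_const, Finset.card_univ, nsmul_eq_mul] at h2
      have h4 : C₁ * h x ^ (-2 : ℤ) ≤ |C₁| * h x ^ (-2 : ℤ) :=
        mul_le_mul_of_nonneg_right (le_abs_self _) hpos2.le
      have h5 := abs_sub (R x a a * R x a a + ∑ i ∈ Finset.univ.erase a, R x i a * R x i a - 1)
        (∑ i ∈ Finset.univ.erase a, R x i a * R x i a)
      have h6 : R x a a * R x a a + ∑ i ∈ Finset.univ.erase a, R x i a * R x i a - 1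
          - ∑ i ∈ Finset.univ.erase a, R x i a * R x i a = R x a a ^ 2 - 1 := by ring
      rw [h6] at h5
      linarith
    -- The sign convention says that R_aa G_aa is at least minus a bounded term, and G_aa is of
    -- order h². Together with R_aa² ≥ 1/2 this rules out the value near -1.
    have hge : -(1 / 4) ≤ R x a a := by
      have h1 := e6 a
      rw [e7, Matrix.add_apply, Matrix.mul_apply,
        Finset.sum_eq_single a (fun i _ hi => by rw [e3 hi, mul_zero]) (by simp)] at h1
      have h2 := (le_abs_self _).trans ((abs_apply_le_fro ((Z x).transpose * Δ x) a a).trans e2)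
      rw [zpow_zero, mul_one] at h2
      rw [Matrix.transpose_apply, Matrix.transpose_apply] at h1
      have h3 := e5 a
      rw [div_le_iff₀ hc] at e9
      have hq : 0 < ((Z x).transpose * Z x) a a := lt_of_lt_of_le (by positivity) h3
      by_contra! hlt
      linarith [mul_lt_mul_of_pos_right hlt hq]
    have h7 := abs_le.1 (hsq.trans e8)
    have hpos' : 0 ≤ R x a a := by nlinarith [h7.1]
    refine le_trans ?_ hsq
    rw [show R x a a ^ 2 - 1 = (R x a a - 1) * (R x a a + 1) by ring, abs_mul]
    exact le_mul_of_one_le_right (abs_nonneg _) ((le_abs_self _).trans' (by linarith))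
  refine BigO.of_entries fun a b => ?_
  by_cases hab : a = b
  · subst hab
    exact ⟨_, hdiag.mono fun x hx => by simpa using hx a⟩
  · exact ⟨_, hoff.mono fun x hx => by simpa [Matrix.one_apply_ne hab] using hx a b hab⟩

theorem bigO_sub (H : IsNearRotation L h Z R Δ Y) (hR : BigO L h (-2) fun x => R x - 1) :
    BigO L h 0 fun x => Y x - Z x := by
  refine (((H.factor.mul H.scale hR).mono H.scale (by norm_num)).add H.error).congr ?_
  filter_upwards [H.eq] with x hx
  rw [hx, Matrix.mul_sub, Matrix.mul_one]
  abel

theorem bigO_gram_sub_gram (H : IsNearRotation L h Z R Δ Y)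
    (hR : BigO L h (-2) fun x => R x - 1) :
    BigO L h 0 fun x => (Y x).transpose * Y x - (Z x).transpose * Z x := by
  have h1 : BigO L h 0 fun x => (R x - 1).transpose * ((Z x).transpose * Z x) * R x :=
    (hR.transpose.mul H.scale H.bigO_gram).mul H.scale H.coeff
  have h2 : BigO L h 0 fun x => (Z x).transpose * Z x * (R x - 1) :=
    H.bigO_gram.mul H.scale hR
  refine ((H.bigO_gram_sub.add h1).add h2).congr (Eventually.of_forall fun x => ?_)
  rw [Matrix.transpose_sub, Matrix.transpose_one]
  noncomm_ring

/-- The decisive estimate for the bias: norms would give order h, and after division by Yᵀ Y ~ h² a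
bias as large as the sampling error h⁻¹. The cancellation leaves h⁻². -/
theorem bigO_transpose_mul_sub (H : IsNearRotation L h Z R Δ Y)
    (hR : BigO L h (-2) fun x => R x - 1) :
    BigO L h 0 fun x => (Y x).transpose * (Z x - Y x) := by
  have h1 : BigO L h 0 fun x => (R x - 1).transpose * ((Z x).transpose * Z x) :=
    hR.transpose.mul H.scale H.bigO_gram
  refine ((h1.add H.cross.transpose).sub (H.bigO_gram_sub_gram hR)).congr ?_
  filter_upwards [H.transpose_mul_eq] with x hx
  rw [Matrix.mul_sub, hx, Matrix.transpose_sub, Matrix.transpose_one, Matrix.sub_mul, one_mul]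
  abel

end IsNearRotation

end Rotation

/-! ### Min-max bound for singular values -/

section SingularValues

open Module

/-- Courant–Fischer: a subspace of dimension greater than a contains a nonzero vector orthogonal to
the first a eigenvectors of T* T, and on such a vector ‖T v‖ is at most σ_a ‖v‖ (counting from
zero). -/
theorem le_singularValues {E F : Type*} [NormedAddCommGroup E] [InnerProductSpace ℝ E]
    [FiniteDimensional ℝ E] [NormedAddCommGroup F] [InnerProductSpace ℝ F] [FiniteDimensional ℝ F]
    (T : E →ₗ[ℝ] F) (S : Submodule ℝ E) {t : ℝ} (hS : ∀ v ∈ S, t * ‖v‖ ≤ ‖T v‖) {a : ℕ}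
    (ha : a < finrank ℝ S) : t ≤ T.singularValues a := by
  have han : a < finrank ℝ E := ha.trans_le S.finrank_le
  set hT := T.isSymmetric_adjoint_comp_self
  set b := hT.eigenvectorBasis rfl with hb
  let φ : S →ₗ[ℝ] (Fin a → ℝ) :=
    { toFun := fun v i => inner ℝ (b ⟨i, i.2.trans han⟩) (v : E)
      map_add' := fun v w => by ext i; simp [inner_add_right]
      map_smul' := fun c v => by ext i; simp [inner_smul_right] }
  have hker : LinearMap.ker φ ≠ ⊥ := LinearMap.ker_ne_bot_of_finrank_lt (by simpa using ha)
  obtain ⟨v, hv, hv0⟩ := Submodule.exists_mem_ne_zero_of_ne_bot hker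
  have hlow (i : Fin (finrank ℝ E)) (hi : (i : ℕ) < a) : inner ℝ (b i) (v : E) = 0 :=
    congrFun (LinearMap.mem_ker.1 hv) ⟨i, hi⟩
  have hnorm : ‖T (v : E)‖ ^ 2 ≤ T.singularValues a ^ 2 * ‖(v : E)‖ ^ 2 := by
    have h1 : ‖T (v : E)‖ ^ 2 = inner ℝ ((T.adjoint ∘ₗ T) (v : E)) (v : E) := by
      rw [LinearMap.comp_apply, LinearMap.adjoint_inner_left, real_inner_self_eq_norm_sq]
    have h2 : inner ℝ ((T.adjoint ∘ₗ T) (v : E)) (v : E)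
        = ∑ i, hT.eigenvalues rfl i * (inner ℝ (b i) (v : E)) ^ 2 := by
      rw [← b.sum_inner_mul_inner]
      refine Finset.sum_congr rfl fun i _ => ?_
      rw [hT (v : E) (b i), hT.apply_eigenvectorBasis, real_inner_comm]
      simp [inner_smul_right, real_inner_comm, hb]
      ring
    rw [h1, h2, ← b.sum_sq_inner_right, Finset.mul_sum]
    refine Finset.sum_le_sum fun i _ => ?_
    rcases lt_or_ge (i : ℕ) a with hi | hi
    · simp [hlow i hi]
    · refine mul_le_mul_of_nonneg_right ?_ (sq_nonneg _)
      rw [T.sq_singularValues_of_lt rfl han]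
      exact hT.eigenvalues_antitone rfl hi
  have hvpos : 0 < ‖(v : E)‖ := norm_pos_iff.2 fun h => hv0 (Subtype.ext h)
  have h3 : ‖T (v : E)‖ ≤ T.singularValues a * ‖(v : E)‖ := by
    rw [← mul_pow] at hnorm
    exact (pow_le_pow_iff_left₀ (norm_nonneg _)
      (mul_nonneg (T.singularValues_nonneg a) hvpos.le) two_ne_zero).1 hnorm
  exact le_of_mul_le_mul_right ((hS v v.2).trans h3) hvpos

end SingularValues

/-! ### Spectral embedding of a perturbed low-rank matrix -/

section Embedding

open Matrix

theorem norm_toEuclideanLin_eq {m n : Type*} [Fintype m] [Fintype n] [DecidableEq n]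
    (B : Matrix m n ℝ) (v : EuclideanSpace ℝ n) :
    ‖B.toEuclideanLin v‖ = fro (B * replicateCol Unit v.ofLp) := by
  rw [EuclideanSpace.norm_eq, fro]
  congr 1
  refine Finset.sum_congr rfl fun i _ => ?_
  simp [Matrix.mul_apply, toLpLin_apply, mulVec, dotProduct]

theorem norm_eq_fro_replicateCol {n : Type*} [Fintype n] (v : EuclideanSpace ℝ n) :
    ‖v‖ = fro (replicateCol Unit v.ofLp) := by
  simp [EuclideanSpace.norm_eq, fro]

variable {n : ℕ} {D : Type} [Fintype D] [DecidableEq D]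

/-- On V = Z U the relation Xᵀ Z = Zᵀ Z allows V to be recovered as Z (Zᵀ Z)⁻¹ Xᵀ V, so ‖V‖ is
controlled by ‖Xᵀ V‖; and ‖Xᵀ V‖² = tr(Vᵀ X Xᵀ V) ≤ ‖V‖ ‖X Xᵀ V‖. -/
theorem mul_fro_le_of_low_rank {X Z : Matrix (Fin n) D ℝ} {t : ℝ} (ht : 0 ≤ t)
    (hXZ : Xᵀ * Z = Zᵀ * Z) (hZ : (Zᵀ * Z)⁻¹ * (Zᵀ * Z) = 1)
    (hg : fro (Z * (Zᵀ * Z)⁻¹) ^ 2 * t ≤ 1) {l : Type*} [Fintype l] (U : Matrix D l ℝ) :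
    t * fro (Z * U) ≤ fro (X * Xᵀ * (Z * U)) := by
  set V := Z * U with hV
  rcases (fro_nonneg V).eq_or_lt with h0 | h0
  · rw [← h0, mul_zero]; exact fro_nonneg _
  have h1 : fro V ≤ fro (Z * (Zᵀ * Z)⁻¹) * fro (Xᵀ * V) := by
    refine le_trans (le_of_eq ?_) (fro_mul_le _ _)
    rw [hV, ← Matrix.mul_assoc Xᵀ, hXZ, ← Matrix.mul_assoc, Matrix.mul_assoc Z, hZ, Matrix.mul_one]
  have h2 : fro (Xᵀ * V) ^ 2 ≤ fro V * fro (X * Xᵀ * V) := by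
    have : fro (Xᵀ * V) ^ 2 = (Vᵀ * (X * Xᵀ * V)).trace := by
      rw [fro_sq_eq_trace, transpose_mul, transpose_transpose]
      simp only [Matrix.mul_assoc]
    rw [this, ← fro_transpose V]
    exact (le_abs_self _).trans (abs_trace_mul_le _ _)
  refine le_of_mul_le_mul_left ?_ h0
  have h3 : fro V ^ 2 ≤ fro (Z * (Zᵀ * Z)⁻¹) ^ 2 * fro (Xᵀ * V) ^ 2 := by
    rw [← mul_pow]; exact pow_le_pow_left₀ (fro_nonneg _) h1 2
  calc fro V * (t * fro V) = t * fro V ^ 2 := by ring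
    _ ≤ t * (fro (Z * (Zᵀ * Z)⁻¹) ^ 2 * fro (Xᵀ * V) ^ 2) := mul_le_mul_of_nonneg_left h3 ht
    _ = (fro (Z * (Zᵀ * Z)⁻¹) ^ 2 * t) * fro (Xᵀ * V) ^ 2 := by ring
    _ ≤ 1 * fro (Xᵀ * V) ^ 2 := mul_le_mul_of_nonneg_right hg (sq_nonneg _)
    _ ≤ fro V * fro (X * Xᵀ * V) := by rw [one_mul]; exact h2

/-- Weyl-type bound: the leading singular values of `X Xᵀ + E` are bounded below. -/
theorem le_singularValues_of_low_rank {X Z : Matrix (Fin n) D ℝ} {E B : Matrix (Fin n) (Fin n) ℝ}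
    {t κ : ℝ} (hB : B = X * Xᵀ + E) (ht : 0 ≤ t) (hXZ : Xᵀ * Z = Zᵀ * Z)
    (hZ : (Zᵀ * Z)⁻¹ * (Zᵀ * Z) = 1) (hg : fro (Z * (Zᵀ * Z)⁻¹) ^ 2 * t ≤ 1)
    (hE : ∀ M : Matrix (Fin n) Unit ℝ, fro (E * M) ≤ κ * fro M) {a : ℕ}
    (ha : a < Fintype.card D) : t - κ ≤ (toEuclideanLin B).singularValues a := by
  have hinj : Function.Injective (toEuclideanLin Z) := by
    have h1 : (toEuclideanLin ((Zᵀ * Z)⁻¹ * Zᵀ)) ∘ₗ toEuclideanLin Z = LinearMap.id := by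
      rw [← toLpLin_mul_same, Matrix.mul_assoc, hZ, toLpLin_one]
    exact Function.LeftInverse.injective (g := toEuclideanLin ((Zᵀ * Z)⁻¹ * Zᵀ))
      fun v => congrArg (fun f => f v) h1
  -- The test space is the column space of Z, where X Xᵀ expands by t and E contributes at most κ.
  refine le_singularValues _ (LinearMap.range (toEuclideanLin Z)) (fun v hv => ?_) ?_
  · obtain ⟨u, rfl⟩ := hv
    rw [norm_toEuclideanLin_eq Z, norm_toEuclideanLin_eq]
    have : replicateCol Unit (toEuclideanLin Z u).ofLp = Z * replicateCol Unit u.ofLp := by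
      ext i k
      simp [Matrix.mul_apply, toLpLin_apply, mulVec, dotProduct]
    rw [this]
    set V := Z * replicateCol Unit u.ofLp with hV
    have h1 := mul_fro_le_of_low_rank ht hXZ hZ hg (replicateCol Unit u.ofLp)
    have h2 := hE V
    have h3 : fro (X * Xᵀ * V) ≤ fro (B * V) + fro (E * V) := by
      have := fro_sub_le (B * V) (E * V)
      rwa [← Matrix.sub_mul, hB, add_sub_cancel_right, ← hB] at this
    rw [sub_mul]
    linarith
  · rw [LinearMap.finrank_range_of_inj hinj]
    simpa using ha

/-- The spectral embedding of a small perturbation of `X Xᵀ` solves the eigenvalue equation. -/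
theorem IsASE.eigen {d : ℕ} {X Z : Matrix (Fin n) D ℝ} {E B : Matrix (Fin n) (Fin n) ℝ}
    {Xh : Matrix (Fin n) (Fin d) ℝ} {t κ : ℝ} (hA : IsASE d B Xh) (hd : d = Fintype.card D)
    (hB : B = X * Xᵀ + E) (hBs : Bᵀ = B) (ht : 0 < t) (hκ : 4 * κ ≤ t)
    (hXZ : Xᵀ * Z = Zᵀ * Z) (hZ : (Zᵀ * Z)⁻¹ * (Zᵀ * Z) = 1)
    (hg : fro (Z * (Zᵀ * Z)⁻¹) ^ 2 * t ≤ 1)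
    (hE : ∀ M : Matrix (Fin n) Unit ℝ, fro (E * M) ≤ κ * fro M)
    (hE' : ∀ M : Matrix (Fin n) (Fin d) ℝ, fro (E * M) ≤ κ * fro M) :
    ∃ s : Fin d → ℝ, (∀ a, t / 2 ≤ s a) ∧ B * Xh = Xh * diagonal s ∧
      Xhᵀ * Xh = diagonal s := by
  obtain ⟨U, s, hs, hU, hBU, rfl⟩ := hA
  have hst (a : Fin d) : t / 2 < s a := by
    have := le_singularValues_of_low_rank hB ht.le hXZ hZ hg hE (a := a) (hd ▸ a.2)
    rw [hs a]
    linarith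
  have hs0 (a : Fin d) : 0 < s a := by linarith [hst a]
  have hcomm : diagonal (fun a => √(s a)) * diagonal s
      = diagonal s * diagonal (fun a => √(s a)) := by
    simp only [diagonal_mul_diagonal, mul_comm]
  -- Singular vectors give only B² U = U S². The defect W satisfies B W = -W S, so its nonzero
  -- columns would be eigenvectors with eigenvalues at most -t/2. But X Xᵀ ≥ 0 and the noise is at
  -- most κ ≤ t/4, hence W = 0.
  set W := B * U - U * diagonal s with hW
  have hBW : B * W = -(W * diagonal s) := by
    rw [hBs] at hBU
    have : (diagonal s : Matrix (Fin d) (Fin d) ℝ) * diagonal s = diagonal fun a => s a ^ 2 := by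
      simp [diagonal_mul_diagonal, pow_two]
    rw [hW, Matrix.mul_sub, Matrix.sub_mul, ← Matrix.mul_assoc, hBU, Matrix.mul_assoc U, this,
      Matrix.mul_assoc B U]
    abel
  have hW0 : W = 0 := by
    have h1 : (Wᵀ * (B * W)).trace = -∑ a, s a * ∑ i, W i a ^ 2 := by
      rw [hBW, Matrix.mul_neg, trace_neg, ← Matrix.mul_assoc, trace]
      congr 1
      refine Finset.sum_congr rfl fun a _ => ?_
      rw [diag_apply, mul_diagonal, Matrix.mul_apply, mul_comm]
      simp [pow_two]
    have h2 : t / 2 * fro W ^ 2 ≤ ∑ a, s a * ∑ i, W i a ^ 2 := by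
      rw [fro_sq, Finset.sum_comm, Finset.mul_sum]
      exact Finset.sum_le_sum fun a _ =>
        mul_le_mul_of_nonneg_right (hst a).le (Finset.sum_nonneg fun i _ => sq_nonneg _)
    have h3 : (Wᵀ * (B * W)).trace = fro (Xᵀ * W) ^ 2 + (Wᵀ * (E * W)).trace := by
      rw [fro_sq_eq_trace, transpose_mul, transpose_transpose, hB]
      simp only [Matrix.add_mul, Matrix.mul_add, trace_add, Matrix.mul_assoc]
    have h4 : |(Wᵀ * (E * W)).trace| ≤ κ * fro W ^ 2 := by
      refine (abs_trace_mul_le _ _).trans ?_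
      rw [fro_transpose]
      nlinarith [hE' W, fro_nonneg W, mul_le_mul_of_nonneg_left (hE' W) (fro_nonneg W)]
    have h5 := (abs_le.1 h4).1
    have h6 : t / 2 * fro W ^ 2 ≤ t / 4 * fro W ^ 2 := by
      nlinarith [sq_nonneg (fro (Xᵀ * W)), sq_nonneg (fro W)]
    have h7 : fro W ^ 2 ≤ 0 := by nlinarith
    exact fro_eq_zero.1 (pow_eq_zero_iff two_ne_zero |>.1 (le_antisymm h7 (sq_nonneg _)))
  refine ⟨s, fun a => (hst a).le, ?_, ?_⟩
  · rw [← Matrix.mul_assoc, sub_eq_zero.1 (hW.symm.trans hW0), Matrix.mul_assoc, Matrix.mul_assoc,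
      hcomm]
  · rw [transpose_mul, diagonal_transpose, Matrix.mul_assoc, ← Matrix.mul_assoc Uᵀ, hU,
      Matrix.one_mul, diagonal_mul_diagonal]
    congr 1
    ext a
    exact Real.mul_self_sqrt (hs0 a).le

theorem IsOrthogonal.fro_sq {ι κ : Type*} [Fintype ι] [Fintype κ] [DecidableEq ι] [DecidableEq κ]
    {W : Matrix ι κ ℝ} (hW : IsOrthogonal W) : fro W ^ 2 = Fintype.card κ := by
  rw [fro_sq_eq_trace, hW.1, trace_one]

/-- A rotation of the spectral embedding solves the fixed-point equation of the perturbation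
problem, with a small inverse Gram matrix. -/
theorem exists_inverse_gram_of_eigen {d : ℕ} {B : Matrix (Fin n) (Fin n) ℝ}
    {Xh : Matrix (Fin n) (Fin d) ℝ} {s : Fin d → ℝ} {t : ℝ} (ht : 0 < t) (hs : ∀ a, t / 2 ≤ s a)
    (hB : B * Xh = Xh * diagonal s) (hX : Xhᵀ * Xh = diagonal s) {W : Matrix (Fin d) D ℝ}
    (hW : IsOrthogonal W) :
    ∃ T : Matrix D D ℝ, B * (Xh * W * T) = Xh * W ∧ (Xh * W)ᵀ * (Xh * W) * T = 1 ∧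
      fro T ≤ 2 * Fintype.card D * d / t := by
  have hs0 (a : Fin d) : s a ≠ 0 := by linarith [hs a]
  have hinv : (diagonal s : Matrix (Fin d) (Fin d) ℝ) * diagonal (fun a => (s a)⁻¹) = 1 := by
    rw [diagonal_mul_diagonal, ← diagonal_one]
    congr 1
    ext a
    exact mul_inv_cancel₀ (hs0 a)
  refine ⟨Wᵀ * diagonal (fun a => (s a)⁻¹) * W, ?_, ?_, ?_⟩
  · calc B * (Xh * W * (Wᵀ * diagonal (fun a => (s a)⁻¹) * W))
        = B * Xh * (W * Wᵀ) * diagonal (fun a => (s a)⁻¹) * W := by simp only [Matrix.mul_assoc]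
      _ = Xh * (diagonal s * diagonal (fun a => (s a)⁻¹)) * W := by
        rw [hW.2, hB, Matrix.mul_one]; simp only [Matrix.mul_assoc]
      _ = Xh * W := by rw [hinv, Matrix.mul_one]
  · calc (Xh * W)ᵀ * (Xh * W) * (Wᵀ * diagonal (fun a => (s a)⁻¹) * W)
        = Wᵀ * (Xhᵀ * Xh) * (W * Wᵀ) * diagonal (fun a => (s a)⁻¹) * W := by
          simp only [transpose_mul, Matrix.mul_assoc]
      _ = Wᵀ * (diagonal s * diagonal (fun a => (s a)⁻¹)) * W := by
        rw [hW.2, hX, Matrix.mul_one]; simp only [Matrix.mul_assoc]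
      _ = 1 := by rw [hinv, Matrix.mul_one, hW.1]
  · have h1 : fro (diagonal (fun a => (s a)⁻¹) : Matrix (Fin d) (Fin d) ℝ) ≤ d * (2 / t) := by
      refine (fro_le_sum _).trans ?_
      have h2 (a : Fin d) : ∑ b, |(diagonal (fun a => (s a)⁻¹) : Matrix (Fin d) (Fin d) ℝ) a b|
          ≤ 2 / t := by
        rw [Finset.sum_eq_single a (fun b _ hb => by rw [diagonal_apply_ne _ hb.symm, abs_zero])
          (by simp), diagonal_apply_eq, abs_of_pos (inv_pos.2 (by linarith [hs a])),
          inv_le_comm₀ (by linarith [hs a]) (by positivity), inv_div]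
        exact hs a
      refine (Finset.sum_le_sum fun a _ => h2 a).trans ?_
      simp
    have h3 := (fro_mul_le (Wᵀ * diagonal (fun a => (s a)⁻¹)) W).trans
      (mul_le_mul_of_nonneg_right (fro_mul_le _ _) (fro_nonneg W))
    rw [fro_transpose] at h3
    calc _ ≤ fro W ^ 2 * fro (diagonal (fun a => (s a)⁻¹) : Matrix (Fin d) (Fin d) ℝ) := by
          refine h3.trans (le_of_eq ?_); ring
      _ ≤ Fintype.card D * (d * (2 / t)) := by
          rw [hW.fro_sq]; exact mul_le_mul_of_nonneg_left h1 (by positivity)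
      _ = _ := by ring

end Embedding

/-! ### Centering and the factorization of the link probabilities -/

section Centering

open Matrix

variable {n : ℕ} {D : Type} [Fintype D] [DecidableEq D]

theorem centering_transpose (n : ℕ) : (centering n)ᵀ = centering n := by
  ext i j
  simp [centering, one_apply, eq_comm]

theorem ones_mul_transpose : (of fun _ _ => 1 : Matrix (Fin n) Unit ℝ) *
    (of fun _ _ => 1 : Matrix (Fin n) Unit ℝ)ᵀ = of fun _ _ => 1 := by
  ext i j
  simp [Matrix.mul_apply]

theorem centering_mul_ones (hn : n ≠ 0) :
    centering n * (of fun _ _ => 1 : Matrix (Fin n) Unit ℝ) = 0 := by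
  ext i j
  have : (n : ℝ) ≠ 0 := by exact_mod_cast hn
  rw [centering, Matrix.sub_mul, Matrix.one_mul]
  simp [Matrix.mul_apply, this]

theorem centering_mul_apply {l : Type*} (M : Matrix (Fin n) l ℝ) (i : Fin n) (a : l) :
    (centering n * M) i a = M i a - (n : ℝ)⁻¹ * ∑ k, M k a := by
  rw [centering, Matrix.sub_mul, Matrix.one_mul, Matrix.sub_apply, Matrix.mul_apply,
    Finset.mul_sum]
  simp

theorem centering_mul_of_sum_eq_zero {l : Type*} {M : Matrix (Fin n) l ℝ}
    (hM : ∀ a, ∑ i, M i a = 0) : centering n * M = M := by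
  ext i a
  rw [centering_mul_apply, hM, mul_zero, sub_zero]

theorem fro_centering_mul_le {l : Type*} [Fintype l] (M : Matrix (Fin n) l ℝ) :
    fro (centering n * M) ≤ 2 * fro M := by
  have h1 : fro ((n : ℝ)⁻¹ • (of fun _ _ => (1 : ℝ)) : Matrix (Fin n) (Fin n) ℝ) ≤ 1 := by
    rw [fro]
    rcases eq_or_ne n 0 with rfl | hn
    · simp
    · have : (n : ℝ) ≠ 0 := by exact_mod_cast hn
      refine Real.sqrt_le_one.2 ?_
      simp only [Matrix.smul_apply, of_apply, smul_eq_mul, mul_one, Finset.sum_const, Finset.card_univ,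
        Fintype.card_fin, nsmul_eq_mul]
      field_simp
      exact le_rfl
  rw [centering, Matrix.sub_mul, Matrix.one_mul]
  refine (fro_sub_le _ _).trans ?_
  have := (fro_mul_le ((n : ℝ)⁻¹ • (of fun _ _ => (1 : ℝ)) : Matrix (Fin n) (Fin n) ℝ) M).trans
    (mul_le_mul_of_nonneg_right h1 (fro_nonneg M))
  linarith

/-- A symmetric matrix whose doubly centered version is a Gram matrix `Z Zᵀ` of the same rank is
itself a Gram matrix `X Xᵀ`, with `X` a translate of `Z`. -/
theorem exists_factor_of_centering (hn : n ≠ 0) {P : Matrix (Fin n) (Fin n) ℝ} (hP : Pᵀ = P)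
    {Z : Matrix (Fin n) D ℝ} (hZ : (Zᵀ * Z)⁻¹ * (Zᵀ * Z) = 1) (hJZ : centering n * Z = Z)
    (hJPJ : centering n * P * centering n = Z * Zᵀ) (hrank : P.rank ≤ Fintype.card D) :
    ∃ X : Matrix (Fin n) D ℝ, P = X * Xᵀ ∧ centering n * X = Z := by
  set J := centering n with hJ
  have hJt : Jᵀ = J := centering_transpose n
  set o : Matrix (Fin n) Unit ℝ := of fun _ _ => 1 with ho
  have hJo : J * o = 0 := centering_mul_ones hn
  have hrZ : Fintype.card D ≤ (Z * Zᵀ).rank := by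
    have h1 : (1 : Matrix D D ℝ).rank ≤ (Z * Zᵀ).rank := by
      have : (1 : Matrix D D ℝ) = (Zᵀ * Z)⁻¹ * Zᵀ * (Z * Zᵀ) * (Z * (Zᵀ * Z)⁻¹) := by
        calc (1 : Matrix D D ℝ)
            = ((Zᵀ * Z)⁻¹ * (Zᵀ * Z)) * ((Zᵀ * Z) * (Zᵀ * Z)⁻¹) := by
              rw [hZ, mul_eq_one_comm.1 hZ, Matrix.one_mul]
          _ = _ := by simp only [Matrix.mul_assoc]
      rw [this]
      exact (rank_mul_le_left _ _).trans (rank_mul_le_right _ _)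
    rwa [rank_one] at h1
  -- The rank bound on P enters here: P and P J have the same range, so P 1 = P J v for some v, and
  -- all blocks of P can be expressed by Z and v.
  have hrPJ : P.rank ≤ (P * J).rank := by
    refine (hrank.trans hrZ).trans ?_
    rw [← hJPJ, Matrix.mul_assoc]
    exact rank_mul_le_right _ _
  have hrange : LinearMap.range (P * J).mulVecLin = LinearMap.range P.mulVecLin := by
    refine Submodule.eq_of_le_of_finrank_le ?_ hrPJ
    rw [mulVecLin_mul]
    exact LinearMap.range_comp_le_range _ _
  obtain ⟨v₀, hv₀⟩ : ∃ v, (P * J).mulVecLin v = P.mulVecLin fun _ => 1 := by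
    rw [← LinearMap.mem_range, hrange]
    exact LinearMap.mem_range_self _ _
  set v : Matrix (Fin n) Unit ℝ := replicateCol Unit v₀ with hv
  have hPo : P * o = P * J * v := by
    ext i k
    have := congrFun hv₀ i
    rw [mulVecLin_apply, mulVecLin_apply] at this
    rw [Matrix.mul_apply, Matrix.mul_apply (M := P * J)]
    exact this.symm
  have hJPo : J * P * o = Z * Zᵀ * v := by
    rw [Matrix.mul_assoc, hPo, ← Matrix.mul_assoc, ← Matrix.mul_assoc, hJPJ]
  have hoPJ : oᵀ * P * J = (Z * Zᵀ * v)ᵀ := by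
    rw [← hJPo, transpose_mul, transpose_mul, hP, hJt, Matrix.mul_assoc]
  have hoPo : oᵀ * P * o = (Z * Zᵀ * v)ᵀ * v := by
    rw [Matrix.mul_assoc, hPo, ← hoPJ]
    simp only [Matrix.mul_assoc]
  have hone : (1 : Matrix (Fin n) (Fin n) ℝ) = J + (n : ℝ)⁻¹ • (o * oᵀ) := by
    rw [ones_mul_transpose, hJ, centering, sub_add_cancel]
  -- Each row of Z is shifted by Zᵀ v / n. Splitting 1 = J + n⁻¹ 1 1ᵀ on both sides of P leaves the
  -- blocks Z Zᵀ, Z Zᵀ v, its transpose and vᵀ Z Zᵀ v, which are those of this Gram matrix.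
  refine ⟨Z + (n : ℝ)⁻¹ • (o * (Zᵀ * v)ᵀ), ?_, ?_⟩
  · calc P = (J + (n : ℝ)⁻¹ • (o * oᵀ)) * P * (J + (n : ℝ)⁻¹ • (o * oᵀ)) := by
          rw [← hone, Matrix.one_mul, Matrix.mul_one]
      _ = J * P * J + (n : ℝ)⁻¹ • ((J * P * o) * oᵀ) + (n : ℝ)⁻¹ • (o * (oᵀ * P * J))
          + ((n : ℝ)⁻¹ * (n : ℝ)⁻¹) • (o * (oᵀ * P * o) * oᵀ) := by
          simp only [Matrix.add_mul, Matrix.mul_add, Matrix.smul_mul, Matrix.mul_smul, smul_smul,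
            Matrix.mul_assoc, smul_add]
          abel
      _ = _ := by
          rw [hJPJ, hJPo, hoPJ, hoPo]
          simp only [transpose_add, transpose_smul, transpose_mul, transpose_transpose,
            Matrix.add_mul, Matrix.mul_add, Matrix.smul_mul, Matrix.mul_smul, smul_smul,
            Matrix.mul_assoc, smul_add]
          abel
  · rw [Matrix.mul_add, hJZ, Matrix.mul_smul, ← Matrix.mul_assoc, hJo, Matrix.zero_mul, smul_zero,
      add_zero]

end Centering

/-! ### Moments of a symmetric matrix with independent centered entries -/

section NoiseMatrix

variable {Ω : Type*} [MeasurableSpace Ω] {Pr : Measure Ω} {n : ℕ}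

/-- A random symmetric hollow matrix whose entries above the diagonal are independent, centered
and bounded by one. -/
structure IsNoiseMatrix (Pr : Measure Ω) (F : Ω → Matrix (Fin n) (Fin n) ℝ) : Prop where
  symm : ∀ ω i j, F ω i j = F ω j i
  hollow : ∀ ω i, F ω i i = 0
  measurable : ∀ i j, Measurable fun ω => F ω i j
  bound : ∀ ω i j, |F ω i j| ≤ 1
  mean : ∀ i j, i < j → ∫ ω, F ω i j ∂Pr = 0
  indep : iIndepFun (fun (e : {e : Fin n × Fin n // e.1 < e.2}) (ω : Ω) => F ω e.1.1 e.1.2) Pr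

namespace IsNoiseMatrix

variable {F : Ω → Matrix (Fin n) (Fin n) ℝ}

theorem abs_bilinear_le (H : IsNoiseMatrix Pr F) (u v : Fin n → ℝ) (ω : Ω) :
    |∑ i, ∑ j, u i * F ω i j * v j| ≤ ∑ i, ∑ j, |u i| * |v j| := by
  refine (Finset.abs_sum_le_sum_abs _ _).trans (Finset.sum_le_sum fun i _ => ?_)
  refine (Finset.abs_sum_le_sum_abs _ _).trans (Finset.sum_le_sum fun j _ => ?_)
  rw [abs_mul, abs_mul]
  have := mul_le_mul_of_nonneg_left (H.bound ω i j) (abs_nonneg (u i))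
  rw [mul_one] at this
  exact mul_le_mul_of_nonneg_right this (abs_nonneg _)

theorem measurable_bilinear (H : IsNoiseMatrix Pr F) (u v : Fin n → ℝ) :
    Measurable fun ω => ∑ i, ∑ j, u i * F ω i j * v j :=
  Finset.measurable_fun_sum _ fun i _ => Finset.measurable_fun_sum _ fun j _ =>
    ((H.measurable i j).const_mul _).mul_const _

theorem abs_path_le (H : IsNoiseMatrix Pr F) (i j k j' : Fin n) (ω : Ω) :
    |F ω j k * (F ω i j' * F ω j' k)| ≤ 1 := by
  rw [abs_mul, abs_mul]
  exact mul_le_one₀ (H.bound ω _ _) (by positivity)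
    (mul_le_one₀ (H.bound ω _ _) (abs_nonneg _) (H.bound ω _ _))

/-- The entry in position `(k, l)` as a function of the entries off the pair `e`. -/
theorem exists_entry_eq (H : IsNoiseMatrix Pr F) {e : {e : Fin n × Fin n // e.1 < e.2}}
    {k l : Fin n} (h1 : ¬(k = e.1.1 ∧ l = e.1.2)) (h2 : ¬(k = e.1.2 ∧ l = e.1.1)) :
    ∃ φ : (↥(Finset.univ.erase e) → ℝ) → ℝ,
      Measurable φ ∧ ∀ ω, F ω k l = φ (fun e' => F ω e'.1.1.1 e'.1.1.2) := by
  rcases lt_trichotomy k l with h | h | h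
  · have hmem : (⟨(k, l), h⟩ : {e : Fin n × Fin n // e.1 < e.2}) ∈ Finset.univ.erase e := by
      simp only [Finset.mem_erase, Finset.mem_univ, and_true]
      rintro rfl
      exact h1 ⟨rfl, rfl⟩
    exact ⟨fun x => x ⟨_, hmem⟩, measurable_pi_apply (⟨_, hmem⟩ : ↥(Finset.univ.erase e)), fun ω => rfl⟩
  · subst h
    exact ⟨fun _ => 0, measurable_const, fun ω => H.hollow ω k⟩
  · have hmem : (⟨(l, k), h⟩ : {e : Fin n × Fin n // e.1 < e.2}) ∈ Finset.univ.erase e := by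
      simp only [Finset.mem_erase, Finset.mem_univ, and_true]
      rintro rfl
      exact h2 ⟨rfl, rfl⟩
    exact ⟨fun x => x ⟨_, hmem⟩, measurable_pi_apply (⟨_, hmem⟩ : ↥(Finset.univ.erase e)), fun ω => H.symm ω k l⟩

/-- An entry is orthogonal to every function of the entries in other positions. -/
theorem integral_mul_eq_zero (H : IsNoiseMatrix Pr F)
    (e : {e : Fin n × Fin n // e.1 < e.2})
    {φ : (↥(Finset.univ.erase e) → ℝ) → ℝ}
    (hφ : Measurable φ) :
    ∫ ω, F ω e.1.1 e.1.2 * φ (fun e' => F ω e'.1.1.1 e'.1.1.2) ∂Pr = 0 := by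
  have h1 := H.indep.indepFun_finset {e} (Finset.univ.erase e) (by simp)
    fun e => H.measurable e.1.1 e.1.2
  have hm : Measurable fun x : ↥({e} : Finset {e : Fin n × Fin n // e.1 < e.2}) → ℝ =>
      x ⟨e, Finset.mem_singleton_self e⟩ := measurable_pi_apply _
  have h2 := h1.comp hm hφ
  have h3 := h2.integral_fun_mul_eq_mul_integral
    (H.measurable e.1.1 e.1.2).aestronglyMeasurable
    (hφ.comp (measurable_pi_lambda _ fun e' =>
      H.measurable e'.1.1.1 e'.1.1.2)).aestronglyMeasurable
  refine Eq.trans h3 ?_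
  have := H.mean e.1.1 e.1.2 e.2
  simp only [Function.comp_def] at this ⊢
  rw [this, zero_mul]

theorem integral_entry_mul_eq_zero (H : IsNoiseMatrix Pr F) {i j k l : Fin n}
    (h1 : ¬(k = i ∧ l = j)) (h2 : ¬(k = j ∧ l = i)) : ∫ ω, F ω i j * F ω k l ∂Pr = 0 := by
  wlog hij : i < j generalizing i j
  · rcases eq_or_ne i j with rfl | hne
    · simp [H.hollow]
    · simp_rw [H.symm _ i j]
      exact this h2 h1 (lt_of_le_of_ne (not_lt.1 hij) hne.symm)
  obtain ⟨φ, hφ, hk⟩ := H.exists_entry_eq (e := ⟨(i, j), hij⟩) h1 h2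
  simp_rw [hk]
  exact H.integral_mul_eq_zero ⟨(i, j), hij⟩ hφ

/-- The unordered pair {i, j} occurs only once among the four edges, unless a vanishing diagonal
entry is present. The centered entry at this pair is then independent of the other three. -/
theorem integral_path_mul_path_eq_zero (H : IsNoiseMatrix Pr F) {i k j j' : Fin n} (hik : i ≠ k)
    (hj : j ≠ j') : ∫ ω, F ω i j * (F ω j k * (F ω i j' * F ω j' k)) ∂Pr = 0 := by
  rcases eq_or_ne i j with rfl | hij
  · simp [H.hollow]
  rcases eq_or_ne j' i with rfl | hji
  · simp [H.hollow]
  have key (e : {e : Fin n × Fin n // e.1 < e.2})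
      (he : e.1 = (i, j) ∨ e.1 = (j, i)) :
      ∫ ω, F ω e.1.1 e.1.2 * (F ω j k * (F ω i j' * F ω j' k)) ∂Pr = 0 := by
    obtain ⟨φ₁, hφ₁, h₁⟩ := H.exists_entry_eq (e := e) (k := j) (l := k)
      (by rcases he with h | h <;> rw [h] <;> grind) (by rcases he with h | h <;> rw [h] <;> grind)
    obtain ⟨φ₂, hφ₂, h₂⟩ := H.exists_entry_eq (e := e) (k := i) (l := j')
      (by rcases he with h | h <;> rw [h] <;> grind) (by rcases he with h | h <;> rw [h] <;> grind)
    obtain ⟨φ₃, hφ₃, h₃⟩ := H.exists_entry_eq (e := e) (k := j') (l := k)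
      (by rcases he with h | h <;> rw [h] <;> grind) (by rcases he with h | h <;> rw [h] <;> grind)
    simp_rw [h₁, h₂, h₃]
    exact H.integral_mul_eq_zero e (φ := fun x => φ₁ x * (φ₂ x * φ₃ x))
      (hφ₁.mul (hφ₂.mul hφ₃))
  rcases lt_or_gt_of_ne hij with h | h
  · exact key ⟨(i, j), h⟩ (Or.inl rfl)
  · simp_rw [H.symm _ i j]
    exact key ⟨(j, i), h⟩ (Or.inr rfl)

variable [IsProbabilityMeasure Pr]

theorem integrable_of_bound (H : IsNoiseMatrix Pr F) (i j : Fin n) {g : Ω → ℝ} (hg : Measurable g)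
    (hb : ∀ ω, |g ω| ≤ 1) : Integrable (fun ω => F ω i j * g ω) Pr :=
  Integrable.of_bound ((H.measurable i j).mul hg).aestronglyMeasurable 1
    (ae_of_all _ fun ω => by
      rw [Real.norm_eq_abs, abs_mul]
      exact mul_le_one₀ (H.bound ω i j) (abs_nonneg _) (hb ω))

theorem abs_integral_entry_mul_le (H : IsNoiseMatrix Pr F) (i j k l : Fin n) :
    |∫ ω, F ω i j * F ω k l ∂Pr| ≤
      (if k = i ∧ l = j then 1 else 0) + (if k = j ∧ l = i then 1 else 0) := by
  by_cases h : (k = i ∧ l = j) ∨ (k = j ∧ l = i)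
  · have h1 : |∫ ω, F ω i j * F ω k l ∂Pr| ≤ 1 := by
      have := norm_integral_le_of_norm_le_const (μ := Pr) (f := fun ω => F ω i j * F ω k l) (C := 1)
        (ae_of_all _ fun ω => by
          rw [Real.norm_eq_abs, abs_mul]
          exact mul_le_one₀ (H.bound ω i j) (abs_nonneg _) (H.bound ω k l))
      simpa using this
    refine h1.trans ?_
    rcases h with h | h <;> rw [if_pos h] <;> split_ifs <;> norm_num
  · rw [not_or] at h
    rw [H.integral_entry_mul_eq_zero h.1 h.2, abs_zero]
    positivity

/-- Entries at different unordered pairs are uncorrelated, so an entry meets only itself and its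
mirror image; this is the factor 2. -/
theorem integral_bilinear_sq_le (H : IsNoiseMatrix Pr F) (u v : Fin n → ℝ) :
    ∫ ω, (∑ i, ∑ j, u i * F ω i j * v j) ^ 2 ∂Pr ≤ 2 * ((∑ i, u i ^ 2) * ∑ j, v j ^ 2) := by
  have hint (i j k l : Fin n) : Integrable (fun ω => F ω i j * F ω k l) Pr :=
    H.integrable_of_bound i j (H.measurable k l) fun ω => H.bound ω k l
  have h1 : ∫ ω, (∑ i, ∑ j, u i * F ω i j * v j) ^ 2 ∂Pr =
      ∑ i, ∑ j, ∑ k, ∑ l, (u i * v j) * (u k * v l) * ∫ ω, F ω i j * F ω k l ∂Pr := by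
    have (ω : Ω) : (∑ i, ∑ j, u i * F ω i j * v j) ^ 2 =
        ∑ i, ∑ j, ∑ k, ∑ l, (u i * v j) * (u k * v l) * (F ω i j * F ω k l) := by
      simp only [pow_two, Finset.sum_mul, Finset.mul_sum]
      exact Finset.sum_congr rfl fun i _ => Finset.sum_congr rfl fun j _ =>
        Finset.sum_congr rfl fun k _ => Finset.sum_congr rfl fun l _ => by ring
    simp_rw [this]
    rw [integral_finsetSum _ fun i _ => integrable_finsetSum _ fun j _ =>
      integrable_finsetSum _ fun k _ => integrable_finsetSum _ fun l _ =>
        (hint i j k l).const_mul _]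
    refine Finset.sum_congr rfl fun i _ => ?_
    rw [integral_finsetSum _ fun j _ => integrable_finsetSum _ fun k _ =>
      integrable_finsetSum _ fun l _ => (hint i j k l).const_mul _]
    refine Finset.sum_congr rfl fun j _ => ?_
    rw [integral_finsetSum _ fun k _ => integrable_finsetSum _ fun l _ =>
      (hint i j k l).const_mul _]
    refine Finset.sum_congr rfl fun k _ => ?_
    rw [integral_finsetSum _ fun l _ => (hint i j k l).const_mul _]
    exact Finset.sum_congr rfl fun l _ => integral_const_mul _ _
  have h2 (i j : Fin n) : ∑ k, ∑ l, (u i * v j) * (u k * v l) * ∫ ω, F ω i j * F ω k l ∂Pr ≤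
      (u i * v j) ^ 2 + (u i ^ 2 * v j ^ 2 + u j ^ 2 * v i ^ 2) / 2 := by
    have h3 : ∑ k, ∑ l, (u i * v j) * (u k * v l) * ∫ ω, F ω i j * F ω k l ∂Pr ≤
        ∑ k, ∑ l, |(u i * v j) * (u k * v l)| *
          ((if k = i ∧ l = j then 1 else 0) + (if k = j ∧ l = i then 1 else 0)) := by
      refine Finset.sum_le_sum fun k _ => Finset.sum_le_sum fun l _ => ?_
      refine (le_abs_self _).trans ?_
      rw [abs_mul]
      exact mul_le_mul_of_nonneg_left (H.abs_integral_entry_mul_le i j k l) (abs_nonneg _)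
    refine h3.trans (le_of_eq_of_le (b := |(u i * v j) * (u i * v j)| +
      |(u i * v j) * (u j * v i)|) ?_ ?_)
    · simp only [mul_add, Finset.sum_add_distrib, ite_and, mul_ite, mul_one, mul_zero,
        Finset.sum_ite_irrel, Finset.sum_const_zero, Finset.sum_ite_eq', Finset.mem_univ, if_true]
    · rw [abs_mul_self, ← pow_two]
      gcongr
      rw [abs_le]
      constructor <;> nlinarith [sq_nonneg (u i * v j + u j * v i), sq_nonneg (u i * v j - u j * v i)]
  rw [h1]
  refine (Finset.sum_le_sum fun i _ => Finset.sum_le_sum fun j _ => h2 i j).trans (le_of_eq ?_)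
  have h4 : ∑ i, ∑ j, u j ^ 2 * v i ^ 2 = (∑ i, u i ^ 2) * ∑ j, v j ^ 2 := by
    rw [Finset.sum_comm, Finset.sum_mul_sum]
  have h5 : ∑ i, ∑ j, u i ^ 2 * v j ^ 2 = (∑ i, u i ^ 2) * ∑ j, v j ^ 2 := by
    rw [Finset.sum_mul_sum]
  simp only [mul_pow, add_div, Finset.sum_add_distrib, ← Finset.sum_div, h4, h5]
  ring

theorem integrable_of_bounded {g : Ω → ℝ} (hg : Measurable g) {C : ℝ} (hC : ∀ ω, |g ω| ≤ C) :
    Integrable g Pr :=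
  Integrable.of_bound hg.aestronglyMeasurable C (ae_of_all _ hC)

theorem integrable_bilinear_sq (H : IsNoiseMatrix Pr F) (u v : Fin n → ℝ) :
    Integrable (fun ω => (∑ i, ∑ j, u i * F ω i j * v j) ^ 2) Pr := by
  refine integrable_of_bounded (C := (∑ i, ∑ j, |u i| * |v j|) ^ 2)
    ((H.measurable_bilinear u v).pow_const 2) fun ω => ?_
  rw [abs_pow]
  exact pow_le_pow_left₀ (abs_nonneg _) (H.abs_bilinear_le u v ω) 2

theorem fro_bilinear_sq {l m : Type*} [Fintype l] [Fintype m] (U : Matrix (Fin n) l ℝ)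
    (M : Matrix (Fin n) (Fin n) ℝ) (V : Matrix (Fin n) m ℝ) :
    fro (U.transpose * M * V) ^ 2 =
      ∑ a, ∑ b, (∑ i, ∑ j, U i a * M i j * V j b) ^ 2 := by
  rw [fro_sq]
  refine Finset.sum_congr rfl fun a _ => Finset.sum_congr rfl fun b _ => ?_
  congr 1
  simp only [Matrix.mul_apply, Finset.sum_mul, Matrix.transpose_apply]
  exact Finset.sum_comm

theorem integrable_fro_bilinear_sq (H : IsNoiseMatrix Pr F) {l m : Type*} [Fintype l] [Fintype m]
    (U : Matrix (Fin n) l ℝ) (V : Matrix (Fin n) m ℝ) :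
    Integrable (fun ω => fro (U.transpose * F ω * V) ^ 2) Pr := by
  simp_rw [fro_bilinear_sq]
  exact integrable_finsetSum _ fun a _ => integrable_finsetSum _ fun b _ =>
    H.integrable_bilinear_sq _ _

theorem integral_fro_bilinear_sq_le (H : IsNoiseMatrix Pr F) {l m : Type*} [Fintype l] [Fintype m]
    (U : Matrix (Fin n) l ℝ) (V : Matrix (Fin n) m ℝ) :
    ∫ ω, fro (U.transpose * F ω * V) ^ 2 ∂Pr ≤ 2 * (fro U ^ 2 * fro V ^ 2) := by
  simp_rw [fro_bilinear_sq]
  rw [integral_finsetSum _ fun a _ => integrable_finsetSum _ fun b _ =>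
    H.integrable_bilinear_sq _ _]
  have h1 (a : l) : ∫ ω, ∑ b, (∑ i, ∑ j, U i a * F ω i j * V j b) ^ 2 ∂Pr ≤
      ∑ b, 2 * ((∑ i, U i a ^ 2) * ∑ j, V j b ^ 2) := by
    rw [integral_finsetSum _ fun b _ => H.integrable_bilinear_sq _ _]
    exact Finset.sum_le_sum fun b _ => H.integral_bilinear_sq_le (fun i => U i a) fun j => V j b
  refine (Finset.sum_le_sum fun a _ => h1 a).trans (le_of_eq ?_)
  rw [fro_sq, fro_sq, Finset.sum_comm, Finset.sum_comm (f := fun i j => V i j ^ 2),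
    Finset.sum_comm (f := fun i j => U i j ^ 2), Finset.sum_mul_sum, Finset.sum_comm]
  simp only [Finset.mul_sum]

theorem fro_mul_self_sq (M : Matrix (Fin n) (Fin n) ℝ) :
    fro (M * M) ^ 2 = ∑ i, ∑ k, ∑ j, ∑ j', M i j * (M j k * (M i j' * M j' k)) := by
  rw [fro_sq]
  refine Finset.sum_congr rfl fun i _ => Finset.sum_congr rfl fun k _ => ?_
  rw [Matrix.mul_apply, pow_two, Finset.sum_mul_sum]
  exact Finset.sum_congr rfl fun j _ => Finset.sum_congr rfl fun j' _ => by ring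

theorem integrable_path (H : IsNoiseMatrix Pr F) (i j k j' : Fin n) :
    Integrable (fun ω => F ω i j * (F ω j k * (F ω i j' * F ω j' k))) Pr :=
  H.integrable_of_bound i j ((H.measurable _ _).mul ((H.measurable _ _).mul (H.measurable _ _)))
    (H.abs_path_le i j k j')

theorem integrable_fro_mul_self_sq (H : IsNoiseMatrix Pr F) :
    Integrable (fun ω => fro (F ω * F ω) ^ 2) Pr := by
  simp_rw [fro_mul_self_sq]
  exact integrable_finsetSum _ fun i _ => integrable_finsetSum _ fun k _ =>
    integrable_finsetSum _ fun j _ => integrable_finsetSum _ fun j' _ => H.integrable_path i j k j'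

/-- The fourth spectral moment `E tr F⁴` is of order `n³`. -/
theorem integral_fro_mul_self_sq_le (H : IsNoiseMatrix Pr F) :
    ∫ ω, fro (F ω * F ω) ^ 2 ∂Pr ≤ 2 * (n : ℝ) ^ 3 := by
  simp_rw [fro_mul_self_sq]
  -- A closed path i, j, k, j' contributes only if i = k or j = j', and either coincidence leaves n³
  -- choices.
  have hle (i j k j' : Fin n) : ∫ ω, F ω i j * (F ω j k * (F ω i j' * F ω j' k)) ∂Pr ≤
      (if i = k then 1 else 0) + (if j = j' then 1 else 0) := by
    by_cases h : i ≠ k ∧ j ≠ j'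
    · rw [H.integral_path_mul_path_eq_zero h.1 h.2, if_neg h.1, if_neg h.2, add_zero]
    · have h1 : ∫ ω, F ω i j * (F ω j k * (F ω i j' * F ω j' k)) ∂Pr ≤ 1 := by
        have := norm_integral_le_of_norm_le_const (μ := Pr)
          (f := fun ω => F ω i j * (F ω j k * (F ω i j' * F ω j' k))) (C := 1)
          (ae_of_all _ fun ω => by
            rw [Real.norm_eq_abs, abs_mul]
            exact mul_le_one₀ (H.bound ω i j) (abs_nonneg _) (H.abs_path_le i j k j' ω))
        exact (le_abs_self _).trans (by simpa using this)
      refine h1.trans ?_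
      rw [not_and_or, not_not, not_not] at h
      rcases h with h | h <;> rw [if_pos h] <;> split_ifs <;> norm_num
  rw [integral_finsetSum _ fun i _ => integrable_finsetSum _ fun k _ =>
    integrable_finsetSum _ fun j _ => integrable_finsetSum _ fun j' _ => H.integrable_path i j k j']
  have h1 : ∀ i, ∫ ω, ∑ k, ∑ j, ∑ j', F ω i j * (F ω j k * (F ω i j' * F ω j' k)) ∂Pr ≤
      ∑ k : Fin n, ∑ j : Fin n, ∑ j' : Fin n, ((if i = k then (1 : ℝ) else 0) + (if j = j' then 1 else 0)) := by
    intro i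
    rw [integral_finsetSum _ fun k _ => integrable_finsetSum _ fun j _ =>
      integrable_finsetSum _ fun j' _ => H.integrable_path i j k j']
    refine Finset.sum_le_sum fun k _ => ?_
    rw [integral_finsetSum _ fun j _ =>
      integrable_finsetSum _ fun j' _ => H.integrable_path i j k j']
    refine Finset.sum_le_sum fun j _ => ?_
    rw [integral_finsetSum _ fun j' _ => H.integrable_path i j k j']
    exact Finset.sum_le_sum fun j' _ => hle i j k j'
  refine (Finset.sum_le_sum fun i _ => h1 i).trans (le_of_eq ?_)
  simp only [Finset.sum_add_distrib, Finset.sum_const, Finset.card_univ, Fintype.card_fin,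
    nsmul_eq_mul, Finset.sum_ite_eq, Finset.mem_univ, if_true, mul_one, ← Finset.mul_sum]
  ring

end IsNoiseMatrix

end NoiseMatrix

/-! ### Typical networks -/

section Network

/-- The off-diagonal part of a matrix. -/
def offDiag {n : ℕ} (M : Matrix (Fin n) (Fin n) ℝ) : Matrix (Fin n) (Fin n) ℝ :=
  Matrix.of fun i j => if i = j then 0 else M i j

variable {Ω : Type*} [MeasurableSpace Ω] {Pr : Measure Ω} [IsProbabilityMeasure Pr]
  {k1 k2 k3 : ℕ} {M : Params k1 k2 k3} {A : (n : ℕ) → Ω → Matrix (Fin n) (Fin n) ℝ}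

theorem IsNetwork.isNoiseMatrix (hA : IsNetwork Pr M A) (h2 : AssumptionII A) (n : ℕ) :
    IsNoiseMatrix Pr fun ω => offDiag (A n ω - M.P n) where
  symm ω i j := by
    have hP : M.P n i j = M.P n j i := by
      simp only [Params.P, Matrix.add_apply, Matrix.of_apply, Matrix.mul_apply,
        Matrix.transpose_apply]
      rw [add_comm (M.α n i)]
      simp only [mul_comm]
    have hS : A n ω i j = A n ω j i := ((h2 n ω).1.apply j i)
    simp only [offDiag, Matrix.of_apply, Matrix.sub_apply, hP, hS, eq_comm]
  hollow ω i := by simp [offDiag]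
  measurable i j := by
    simp only [offDiag, Matrix.of_apply, Matrix.sub_apply]
    split_ifs
    · exact measurable_const
    · exact (hA.measurable n i j).sub_const _
  bound ω i j := by
    simp only [offDiag, Matrix.of_apply, Matrix.sub_apply]
    obtain ⟨h0, h1⟩ := hA.prob_mem n i j
    split_ifs
    · simp
    · rcases (h2 n ω).2.2 i j with h | h <;> rw [h, abs_le] <;> constructor <;> linarith
  mean i j hij := by
    have hmeas : MeasurableSet {ω | A n ω i j = 1} :=
      hA.measurable n i j (measurableSet_singleton 1)
    have hind : (fun ω => A n ω i j) = Set.indicator {ω | A n ω i j = 1} fun _ => (1 : ℝ) := by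
      ext ω
      rw [Set.indicator_apply]
      rcases (h2 n ω).2.2 i j with h | h <;> simp [h]
    have hint : ∫ ω, A n ω i j ∂Pr = M.P n i j := by
      rw [hind, integral_indicator_const _ hmeas, smul_eq_mul, mul_one, measureReal_def,
        hA.law n i j hij, ENNReal.toReal_ofReal (hA.prob_mem n i j).1]
    have hI : Integrable (fun ω => A n ω i j) Pr := by
      rw [hind]
      exact (integrable_const _).indicator hmeas
    simp only [offDiag, Matrix.of_apply, Matrix.sub_apply, if_neg hij.ne]
    rw [integral_sub hI (integrable_const _), hint]
    simp
  indep := by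
    have := (hA.indep n).comp (fun e x => x - M.P n e.1.1 e.1.2)
      fun e => measurable_id.sub_const _
    convert this using 3 with e
    simp only [offDiag, Matrix.of_apply, Matrix.sub_apply, if_neg e.2.ne]
    rfl

/-- The event on which the noise of the network `B` averages out against `X` and `Z`, up to the
factor `K`, and is negligible in spectral norm. -/
structure IsTypical {n : ℕ} {D l : Type} [Fintype D] [Fintype l] (P : Matrix (Fin n) (Fin n) ℝ)
    (X : Matrix (Fin n) D ℝ) (Z : Matrix (Fin n) l ℝ) (K : ℝ) (B : Matrix (Fin n) (Fin n) ℝ) :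
    Prop where
  signal : fro (X.transpose * offDiag (B - P)) ≤ K * n
  signal_quadratic : fro (X.transpose * offDiag (B - P) * X) ≤ K * n
  factor : fro (Z.transpose * offDiag (B - P)) ≤ K * n
  factor_quadratic : fro (Z.transpose * offDiag (B - P) * X) ≤ K * n
  spectral : fro (offDiag (B - P) * offDiag (B - P)) ^ 2 ≤ √n ^ 7

/-- Chebyshev's inequality. The identity matrix is admissible as V, since its squared norm is n, so
the bound covers Uᵀ F as well as Uᵀ F V. -/
theorem measureReal_lt_fro_le {n : ℕ} {F : Ω → Matrix (Fin n) (Fin n) ℝ} (H : IsNoiseMatrix Pr F)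
    {l m : Type*} [Fintype l] [Fintype m] (U : Matrix (Fin n) l ℝ) (V : Matrix (Fin n) m ℝ)
    {K c : ℝ} (hK : 0 < K) (hn : n ≠ 0) (hU : fro U ^ 2 ≤ c * n) (hV : fro V ^ 2 ≤ c * n) :
    Pr.real {ω | K * n < fro (U.transpose * F ω * V)} ≤ 2 * c ^ 2 / K ^ 2 := by
  have hn' : (0 : ℝ) < n := by exact_mod_cast Nat.pos_of_ne_zero hn
  have h1 := mul_meas_ge_le_integral_of_nonneg (μ := Pr)
    (f := fun ω => fro (U.transpose * F ω * V) ^ 2) (ae_of_all _ fun ω => sq_nonneg _)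
    (H.integrable_fro_bilinear_sq U V) ((K * n) ^ 2)
  have h2 : Pr.real {ω | K * n < fro (U.transpose * F ω * V)} ≤
      Pr.real {ω | (K * n) ^ 2 ≤ fro (U.transpose * F ω * V) ^ 2} :=
    measureReal_mono fun ω hω => pow_le_pow_left₀ (mul_pos hK hn').le (le_of_lt hω) 2
  have h3 : 2 * (fro U ^ 2 * fro V ^ 2) ≤ 2 * ((c * n) * (c * n)) := by
    have := (sq_nonneg (fro U)).trans hU
    gcongr
  have h4 := (mul_le_mul_of_nonneg_left h2 (by positivity : 0 ≤ (K * n) ^ 2)).trans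
    ((h1.trans (H.integral_fro_bilinear_sq_le U V)).trans h3)
  rw [le_div_iff₀ (by positivity)]
  refine le_of_mul_le_mul_right ?_ (by positivity : (0 : ℝ) < n ^ 2)
  linarith

/-- Markov's inequality at the threshold n^(7/2), strictly between the mean O(n³) of tr F⁴ and the
value n⁴ at which the operator norm could reach n. -/
theorem measureReal_lt_fro_mul_self_le {n : ℕ} {F : Ω → Matrix (Fin n) (Fin n) ℝ}
    (H : IsNoiseMatrix Pr F) (hn : n ≠ 0) :
    Pr.real {ω | √n ^ 7 < fro (F ω * F ω) ^ 2} ≤ 2 / √n := by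
  have hs : 0 < √(n : ℝ) := Real.sqrt_pos.2 (by exact_mod_cast Nat.pos_of_ne_zero hn)
  have h1 := mul_meas_ge_le_integral_of_nonneg (μ := Pr)
    (f := fun ω => fro (F ω * F ω) ^ 2) (ae_of_all _ fun ω => sq_nonneg _)
    H.integrable_fro_mul_self_sq (√n ^ 7)
  have h2 : Pr.real {ω | √n ^ 7 < fro (F ω * F ω) ^ 2} ≤
      Pr.real {ω | √n ^ 7 ≤ fro (F ω * F ω) ^ 2} :=
    measureReal_mono fun ω hω => Set.mem_ofPred.2 (Set.mem_ofPred.1 hω).le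
  have h3 : (n : ℝ) ^ 3 = √n ^ 6 := by
    conv_lhs => rw [← Real.sq_sqrt (Nat.cast_nonneg (α := ℝ) n)]
    ring
  have h4 := (mul_le_mul_of_nonneg_left h2 (by positivity : 0 ≤ √(n : ℝ) ^ 7)).trans
    (h1.trans H.integral_fro_mul_self_sq_le)
  rw [h3] at h4
  rw [le_div_iff₀ hs]
  refine le_of_mul_le_mul_right ?_ (by positivity : (0 : ℝ) < √n ^ 6)
  linarith

/-- The network is typical with high probability. -/
theorem IsNetwork.eventually_isTypical (hA : IsNetwork Pr M A) (h2 : AssumptionII A)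
    {D l : Type} [Fintype D] [Fintype l] {X : ∀ n, Matrix (Fin n) D ℝ}
    {Z : ∀ n, Matrix (Fin n) l ℝ} {c : ℝ} (hc : 1 ≤ c) (hX : ∀ᶠ n : ℕ in atTop, fro (X n) ^ 2 ≤ c * n)
    (hZ : ∀ᶠ n : ℕ in atTop, fro (Z n) ^ 2 ≤ c * n) {η : ℝ} (hη : 0 < η) :
    ∃ K : ℝ, ∀ᶠ n in atTop,
      Pr.real {ω | ¬ IsTypical (M.P n) (X n) (Z n) K (A n ω)} ≤ η := by
  -- Each of the five exceptional events is allotted probability η / 8.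
  obtain ⟨K, hK, hKη⟩ : ∃ K : ℝ, 0 < K ∧ 2 * c ^ 2 / K ^ 2 ≤ η / 8 := by
    refine ⟨√(16 * c ^ 2 / η), by positivity, ?_⟩
    rw [Real.sq_sqrt (by positivity)]
    field_simp
    norm_num
  have hlim : Tendsto (fun n : ℕ => 2 / √(n : ℝ)) atTop (𝓝 0) :=
    tendsto_const_nhds.div_atTop (Real.tendsto_sqrt_atTop.comp tendsto_natCast_atTop_atTop)
  refine ⟨K, ?_⟩
  filter_upwards [hX, hZ, eventually_ne_atTop 0,
    hlim.eventually (ge_mem_nhds (show (0 : ℝ) < η / 8 by positivity))] with n e1 e2 hn e4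
  have H := hA.isNoiseMatrix h2 n
  have hone : fro (1 : Matrix (Fin n) (Fin n) ℝ) ^ 2 ≤ c * n := by
    rw [fro_sq_eq_trace, Matrix.transpose_one, one_mul, Matrix.trace_one, Fintype.card_fin]
    exact le_mul_of_one_le_left (Nat.cast_nonneg n) hc
  have b1 := (measureReal_lt_fro_le H (X n) 1 hK hn e1 hone).trans hKη
  have b2 := (measureReal_lt_fro_le H (X n) (X n) hK hn e1 e1).trans hKη
  have b3 := (measureReal_lt_fro_le H (Z n) 1 hK hn e2 hone).trans hKη
  have b4 := (measureReal_lt_fro_le H (Z n) (X n) hK hn e2 e1).trans hKη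
  have b5 := (measureReal_lt_fro_mul_self_le H hn).trans e4
  simp only [Matrix.mul_one] at b1 b3
  set S1 := {ω | K * n < fro ((X n).transpose * offDiag (A n ω - M.P n))}
  set S2 := {ω | K * n < fro ((X n).transpose * offDiag (A n ω - M.P n) * X n)}
  set S3 := {ω | K * n < fro ((Z n).transpose * offDiag (A n ω - M.P n))}
  set S4 := {ω | K * n < fro ((Z n).transpose * offDiag (A n ω - M.P n) * X n)}
  set S5 := {ω | √n ^ 7 < fro (offDiag (A n ω - M.P n) * offDiag (A n ω - M.P n)) ^ 2}
  have hsub : {ω | ¬ IsTypical (M.P n) (X n) (Z n) K (A n ω)} ⊆ S1 ∪ (S2 ∪ (S3 ∪ (S4 ∪ S5))) := by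
    intro ω hω
    by_contra hcon
    simp only [Set.mem_union, not_or] at hcon
    exact hω ⟨not_lt.1 hcon.1, not_lt.1 hcon.2.1, not_lt.1 hcon.2.2.1, not_lt.1 hcon.2.2.2.1,
      not_lt.1 hcon.2.2.2.2⟩
  have h := measureReal_mono (μ := Pr) hsub
  have u1 := measureReal_union_le (μ := Pr) S1 (S2 ∪ (S3 ∪ (S4 ∪ S5)))
  have u2 := measureReal_union_le (μ := Pr) S2 (S3 ∪ (S4 ∪ S5))
  have u3 := measureReal_union_le (μ := Pr) S3 (S4 ∪ S5)
  have u4 := measureReal_union_le (μ := Pr) S4 S5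
  linarith

end Network

/-! ### Inverses of normalized Gram matrices -/

section InverseLimit

variable {ι : Type*} {L : Filter ι} {h : ι → ℝ} {D : Type} [Fintype D] [DecidableEq D]
  {S : ι → Matrix D D ℝ} {S₀ : Matrix D D ℝ}

theorem tendsto_matrix_inv (hS : Tendsto S L (𝓝 S₀)) (h0 : S₀.det ≠ 0) :
    Tendsto (fun x => (S x)⁻¹) L (𝓝 S₀⁻¹) := by
  have hdet : Tendsto (fun x => (S x).det) L (𝓝 S₀.det) :=
    ((continuous_id.matrix_det).tendsto S₀).comp hS
  have hadj : Tendsto (fun x => (S x).adjugate) L (𝓝 S₀.adjugate) :=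
    ((continuous_id.matrix_adjugate).tendsto S₀).comp hS
  simp only [Matrix.inv_def, Ring.inverse_eq_inv']
  exact (hdet.inv₀ h0).smul hadj

theorem eventually_inv_mul
    (hS : Tendsto (fun x => (h x ^ 2)⁻¹ • S x) L (𝓝 S₀)) (h0 : S₀.det ≠ 0) :
    ∀ᶠ x in L, (S x)⁻¹ * S x = 1 := by
  have hdet : Tendsto (fun x => ((h x ^ 2)⁻¹ • S x).det) L (𝓝 S₀.det) :=
    ((continuous_id.matrix_det).tendsto S₀).comp hS
  filter_upwards [hdet.eventually_ne h0] with x h1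
  refine Matrix.nonsing_inv_mul _ (isUnit_iff_ne_zero.2 fun h3 => h1 ?_)
  rw [Matrix.det_smul, h3, mul_zero]

theorem tendsto_smul_inv (hh : Tendsto h L atTop)
    (hS : Tendsto (fun x => (h x ^ 2)⁻¹ • S x) L (𝓝 S₀)) (h0 : S₀.det ≠ 0) :
    Tendsto (fun x => h x ^ 2 • (S x)⁻¹) L (𝓝 S₀⁻¹) := by
  refine (tendsto_matrix_inv hS h0).congr' ?_
  filter_upwards [eventually_inv_mul hS h0, hh.eventually_ge_atTop 1] with x h1 h2
  have h3 : h x ^ 2 ≠ 0 := by positivity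
  refine Matrix.inv_eq_left_inv ?_
  rw [Matrix.smul_mul, Matrix.mul_smul, smul_smul, mul_inv_cancel₀ h3, one_smul, h1]

theorem BigO.of_tendsto {m n : Type} [Fintype m] [Fintype n] {k : ℤ} {N : ι → Matrix m n ℝ}
    {N₀ : Matrix m n ℝ} (hh : Tendsto h L atTop)
    (hN : Tendsto (fun x => h x ^ (-k) • N x) L (𝓝 N₀)) : BigO L h k N := by
  refine BigO.of_entries fun a b => ⟨|N₀ a b| + 1, ?_⟩
  have h1 : Tendsto (fun x => |(h x ^ (-k) • N x) a b|) L (𝓝 |N₀ a b|) :=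
    (((continuous_id.matrix_elem a b).tendsto N₀).comp hN).abs
  filter_upwards [h1.eventually (gt_mem_nhds (lt_add_one _)), hh.eventually_ge_atTop 1]
    with x hx h2
  have h3 : 0 < h x := by positivity
  rw [Matrix.smul_apply, smul_eq_mul, abs_mul, abs_of_pos (by positivity), zpow_neg,
    inv_mul_lt_iff₀ (by positivity)] at hx
  linarith

theorem bigO_inv_of_tendsto (hh : Tendsto h L atTop)
    (hS : Tendsto (fun x => (h x ^ 2)⁻¹ • S x) L (𝓝 S₀)) (h0 : S₀.det ≠ 0) :
    BigO L h (-2) fun x => (S x)⁻¹ :=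
  BigO.of_tendsto hh (by simpa using tendsto_smul_inv hh hS h0)

theorem tendsto_add_bigO {S' : ι → Matrix D D ℝ} (hh : Tendsto h L atTop)
    (hS : Tendsto (fun x => (h x ^ 2)⁻¹ • S x) L (𝓝 S₀))
    (hd : BigO L h 0 fun x => S' x - S x) :
    Tendsto (fun x => (h x ^ 2)⁻¹ • S' x) L (𝓝 S₀) := by
  obtain ⟨C, hC⟩ := hd
  have hz : Tendsto (fun x => C * (h x ^ 2)⁻¹) L (𝓝 0) := by
    have := ((tendsto_pow_atTop (α := ℝ) two_ne_zero).comp hh).inv_tendsto_atTop.const_mul C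
    simpa using this
  refine tendsto_pi_nhds.2 fun a => tendsto_pi_nhds.2 fun b => ?_
  have h1 : Tendsto (fun x => ((h x ^ 2)⁻¹ • S x) a b) L (𝓝 (S₀ a b)) :=
    ((continuous_id.matrix_elem a b).tendsto S₀).comp hS
  have h2 : Tendsto (fun x => ((h x ^ 2)⁻¹ • (S' x - S x)) a b) L (𝓝 0) := by
    refine squeeze_zero_norm' ?_ hz
    filter_upwards [hC] with x hx
    rw [Matrix.smul_apply, smul_eq_mul, norm_mul, Real.norm_of_nonneg (by positivity), mul_comm]
    refine mul_le_mul_of_nonneg_right ?_ (by positivity)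
    simpa using (abs_apply_le_fro (S' x - S x) a b).trans hx
  have h3 := h1.add h2
  rw [add_zero] at h3
  refine h3.congr fun x => ?_
  simp only [Matrix.smul_apply, Matrix.sub_apply, smul_eq_mul]
  ring

end InverseLimit

/-! ### Regression on a near rotation -/

section Regression

variable {ι : Type*} {L : Filter ι} {h : ι → ℝ} {n : ι → Type} [∀ x, Fintype (n x)]
  {D l : Type} [Fintype D] [DecidableEq D] [Fintype l]
  {Z : ∀ x, Matrix (n x) D ℝ} {R : ι → Matrix D D ℝ} {Δ Y : ∀ x, Matrix (n x) D ℝ}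
  {S₀ : Matrix D D ℝ}

namespace IsNearRotation

theorem tendsto_gram (H : IsNearRotation L h Z R Δ Y) (hR : BigO L h (-2) fun x => R x - 1)
    (hZ : Tendsto (fun x => (h x ^ 2)⁻¹ • ((Z x).transpose * Z x)) L (𝓝 S₀)) :
    Tendsto (fun x => (h x ^ 2)⁻¹ • ((Y x).transpose * Y x)) L (𝓝 S₀) :=
  tendsto_add_bigO H.scale hZ (H.bigO_gram_sub_gram hR)

/-- Regression on `Y` agrees with regression on `Z` up to a relative error of order `h⁻¹`. -/
theorem bigO_regression_sub (H : IsNearRotation L h Z R Δ Y)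
    (hR : BigO L h (-2) fun x => R x - 1)
    (hZ : Tendsto (fun x => (h x ^ 2)⁻¹ • ((Z x).transpose * Z x)) L (𝓝 S₀)) (h0 : S₀.det ≠ 0) :
    BigO L h (-2) fun x => ((Y x).transpose * Y x)⁻¹ * (Y x).transpose -
      ((Z x).transpose * Z x)⁻¹ * (Z x).transpose := by
  have hY := H.tendsto_gram hR hZ
  have hi := bigO_inv_of_tendsto H.scale hY h0
  have h1 : BigO L h (-2) fun x => ((Y x).transpose * Y x)⁻¹ * (Y x - Z x).transpose :=
    hi.mul H.scale (H.bigO_sub hR).transpose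
  have h2 : BigO L h (-2) fun x => ((Y x).transpose * Y x)⁻¹ *
      ((Y x).transpose * Y x - (Z x).transpose * Z x) * ((Z x).transpose * Z x)⁻¹ *
        (Z x).transpose :=
    (((hi.mul H.scale (H.bigO_gram_sub_gram hR)).mul H.scale H.inv).mul H.scale
      H.factor.transpose).mono H.scale (by norm_num)
  refine (h1.sub h2).congr ?_
  filter_upwards [eventually_inv_mul hY h0, H.inv_mul] with x e1 e2
  set G := (Z x).transpose * Z x
  set G' := (Y x).transpose * Y x
  -- The resolvent identity turns the bounded difference of the Gram matrices into an error of order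
  -- h⁻⁴ in the inverses, hence h⁻³ after multiplication by Zᵀ.
  have e3 : G'⁻¹ * (G' - G) * G⁻¹ = G⁻¹ - G'⁻¹ := by
    rw [Matrix.mul_sub, e1, Matrix.sub_mul, Matrix.one_mul, Matrix.mul_assoc,
      mul_eq_one_comm.1 e2, Matrix.mul_one]
  rw [e3, Matrix.transpose_sub, Matrix.mul_sub, Matrix.sub_mul]
  abel

theorem bigO_bias (H : IsNearRotation L h Z R Δ Y) (hR : BigO L h (-2) fun x => R x - 1)
    (hZ : Tendsto (fun x => (h x ^ 2)⁻¹ • ((Z x).transpose * Z x)) L (𝓝 S₀)) (h0 : S₀.det ≠ 0) :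
    BigO L h (-2) fun x => ((Y x).transpose * Y x)⁻¹ * ((Y x).transpose * (Z x - Y x)) :=
  (bigO_inv_of_tendsto H.scale (H.tendsto_gram hR hZ) h0).mul H.scale (H.bigO_transpose_mul_sub hR)

theorem bigO_leakage (H : IsNearRotation L h Z R Δ Y) (hR : BigO L h (-2) fun x => R x - 1)
    (hZ : Tendsto (fun x => (h x ^ 2)⁻¹ • ((Z x).transpose * Z x)) L (𝓝 S₀)) (h0 : S₀.det ≠ 0)
    {Z' : ∀ x, Matrix (n x) l ℝ} (hZ' : BigO L h 0 fun x => (Y x).transpose * Z' x) :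
    BigO L h (-2) fun x => ((Y x).transpose * Y x)⁻¹ * ((Y x).transpose * Z' x) :=
  (bigO_inv_of_tendsto H.scale (H.tendsto_gram hR hZ) h0).mul H.scale hZ'

end IsNearRotation

end Regression

/-! ### The filter of large samples -/

section SampleFilter

/-- A sample size together with a realized adjacency matrix. -/
abbrev Sample : Type := Σ n : ℕ, Matrix (Fin n) (Fin n) ℝ

/-- The filter of large samples with realizations in `S`. -/
def largeSamples (S : ∀ n, Set (Matrix (Fin n) (Fin n) ℝ)) : Filter Sample :=
  comap Sigma.fst atTop ⊓ 𝓟 {x | x.2 ∈ S x.1}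

variable {S : ∀ n, Set (Matrix (Fin n) (Fin n) ℝ)}

/-- Eventual statements along this filter are uniform over the realizations in `S`, so constants
obtained by the order calculus do not depend on the network. -/
theorem eventually_largeSamples {p : Sample → Prop} :
    (∀ᶠ x in largeSamples S, p x) ↔ ∀ᶠ n in atTop, ∀ B ∈ S n, p ⟨n, B⟩ := by
  rw [largeSamples, eventually_inf_principal, eventually_comap]
  refine eventually_congr (Eventually.of_forall fun n => ?_)
  constructor
  · intro h B hB
    exact h ⟨n, B⟩ rfl hB
  · rintro h ⟨m, B⟩ rfl hB
    exact h B hB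

theorem tendsto_fst_largeSamples : Tendsto (fun x : Sample => x.1) (largeSamples S) atTop :=
  tendsto_comap.mono_left inf_le_left

theorem tendsto_sqrt_largeSamples :
    Tendsto (fun x : Sample => √(x.1 : ℝ)) (largeSamples S) atTop :=
  Real.tendsto_sqrt_atTop.comp (tendsto_natCast_atTop_atTop.comp tendsto_fst_largeSamples)

end SampleFilter

/-! ### Low-rank designs and the size of their noise -/

section Design

variable {D l : Type} [Fintype D] [DecidableEq D] [Fintype l]

/-- A low-rank network design: `P = X Xᵀ` where `X` is a translate of the centered factors `Z`,
which have a nonsingular limit second moment matrix and are orthogonal to the remaining factors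
`Z'`. -/
structure IsDesign (P : ∀ n, Matrix (Fin n) (Fin n) ℝ) (X Z : ∀ n, Matrix (Fin n) D ℝ)
    (Z' : ∀ n, Matrix (Fin n) l ℝ) (S₀ : Matrix D D ℝ) : Prop where
  prob : ∀ n i j, P n i j ∈ Set.Icc (0 : ℝ) 1
  factor : ∀ᶠ n in atTop, P n = X n * (X n).transpose
  center : ∀ᶠ n in atTop, centering n * X n = Z n
  centered : ∀ᶠ n in atTop, centering n * Z n = Z n
  centered' : ∀ᶠ n in atTop, centering n * Z' n = Z' n
  ortho : ∀ᶠ n in atTop, (Z n).transpose * Z' n = 0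
  gram : Tendsto (fun n : ℕ => (n : ℝ)⁻¹ • ((Z n).transpose * Z n)) atTop (𝓝 S₀)
  nonsing : S₀.det ≠ 0
  bound' : ∃ c : ℝ, ∀ᶠ n : ℕ in atTop, fro (Z' n) ^ 2 ≤ c * n

/-- The typical realizations of the network. -/
def typicalSet (P : ∀ n, Matrix (Fin n) (Fin n) ℝ) (X Z : ∀ n, Matrix (Fin n) D ℝ)
    (Z' : ∀ n, Matrix (Fin n) l ℝ) (K : ℝ) (n : ℕ) : Set (Matrix (Fin n) (Fin n) ℝ) :=
  {B | IsAdjacency B ∧ IsTypical (P n) (X n) (Matrix.fromCols (Z n) (Z' n)) K B}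

theorem fro_fromRows_sq {m₁ m₂ n : Type*} [Fintype m₁] [Fintype m₂] [Fintype n]
    (M : Matrix m₁ n ℝ) (N : Matrix m₂ n ℝ) :
    fro (Matrix.fromRows M N) ^ 2 = fro M ^ 2 + fro N ^ 2 := by
  simp [fro_sq]

theorem fro_fromCols_sq {m n₁ n₂ : Type*} [Fintype m] [Fintype n₁] [Fintype n₂]
    (M : Matrix m n₁ ℝ) (N : Matrix m n₂ ℝ) :
    fro (Matrix.fromCols M N) ^ 2 = fro M ^ 2 + fro N ^ 2 := by
  simp [fro_sq, Finset.sum_add_distrib]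

theorem fro_le_fromRows_left {m₁ m₂ n : Type*} [Fintype m₁] [Fintype m₂] [Fintype n]
    (M : Matrix m₁ n ℝ) (N : Matrix m₂ n ℝ) : fro M ≤ fro (Matrix.fromRows M N) := by
  refine (pow_le_pow_iff_left₀ (fro_nonneg _) (fro_nonneg _) two_ne_zero).1 ?_
  rw [fro_fromRows_sq]
  exact le_add_of_nonneg_right (sq_nonneg _)

theorem fro_le_fromRows_right {m₁ m₂ n : Type*} [Fintype m₁] [Fintype m₂] [Fintype n]
    (M : Matrix m₁ n ℝ) (N : Matrix m₂ n ℝ) : fro N ≤ fro (Matrix.fromRows M N) := by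
  refine (pow_le_pow_iff_left₀ (fro_nonneg _) (fro_nonneg _) two_ne_zero).1 ?_
  rw [fro_fromRows_sq]
  exact le_add_of_nonneg_left (sq_nonneg _)

theorem fro_diagonal_mul_le {n : ℕ} {m : Type*} [Fintype m] {v : Fin n → ℝ}
    (hv : ∀ i, |v i| ≤ 1) (M : Matrix (Fin n) m ℝ) : fro (Matrix.diagonal v * M) ≤ fro M := by
  refine (pow_le_pow_iff_left₀ (fro_nonneg _) (fro_nonneg _) two_ne_zero).1 ?_
  rw [fro_sq, fro_sq]
  refine Finset.sum_le_sum fun i _ => Finset.sum_le_sum fun j _ => ?_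
  rw [Matrix.diagonal_mul, mul_pow]
  refine mul_le_of_le_one_left (sq_nonneg _) ?_
  rw [sq_le_one_iff_abs_le_one]
  exact hv i

/-- The noise of an adjacency matrix is its off-diagonal noise up to a bounded diagonal matrix. -/
theorem IsAdjacency.sub_eq {n : ℕ} {B P : Matrix (Fin n) (Fin n) ℝ} (hB : IsAdjacency B) :
    B - P = offDiag (B - P) + Matrix.diagonal fun i => -P i i := by
  ext i j
  rw [Matrix.add_apply, Matrix.diagonal_apply, offDiag, Matrix.of_apply]
  split_ifs with h
  · subst h
    simp [hB.2.1 i]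
  · simp

/-- The squared norm is the trace of P, whose diagonal entries are at most one. -/
theorem fro_sq_of_factor {n : ℕ} {P : Matrix (Fin n) (Fin n) ℝ} {X : Matrix (Fin n) D ℝ}
    (hP : ∀ i j, P i j ∈ Set.Icc (0 : ℝ) 1) (h : P = X * X.transpose) : fro X ^ 2 ≤ n := by
  have h1 : fro X ^ 2 = ∑ i, P i i := by
    rw [fro_sq, h]
    simp [Matrix.mul_apply, pow_two]
  rw [h1]
  refine (Finset.sum_le_sum fun i _ => (hP i i).2).trans (le_of_eq ?_)
  simp

namespace IsDesign

variable {P : ∀ n, Matrix (Fin n) (Fin n) ℝ} {X Z : ∀ n, Matrix (Fin n) D ℝ}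
  {Z' : ∀ n, Matrix (Fin n) l ℝ} {S₀ : Matrix D D ℝ} {K : ℝ}

theorem abs_diag_le (H : IsDesign P X Z Z' S₀) (n : ℕ) (i : Fin n) : |-P n i i| ≤ 1 := by
  rw [abs_neg, abs_of_nonneg (H.prob n i i).1]
  exact (H.prob n i i).2

theorem gram_sqrt (H : IsDesign P X Z Z' S₀) (S : ∀ n, Set (Matrix (Fin n) (Fin n) ℝ)) :
    Tendsto (fun x : Sample => (√(x.1 : ℝ) ^ 2)⁻¹ • ((Z x.1).transpose * Z x.1)) (largeSamples S)
      (𝓝 S₀) := by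
  simp only [Real.sq_sqrt (Nat.cast_nonneg _)]
  exact H.gram.comp tendsto_fst_largeSamples

theorem bigO_signal (H : IsDesign P X Z Z' S₀) (S : ∀ n, Set (Matrix (Fin n) (Fin n) ℝ)) :
    BigO (largeSamples S) (fun x => √(x.1 : ℝ)) 1 fun x => X x.1 := by
  refine ⟨1, ?_⟩
  filter_upwards [tendsto_fst_largeSamples.eventually H.factor] with x hx
  rw [one_mul, zpow_one]
  exact Real.le_sqrt_of_sq_le (fro_sq_of_factor (H.prob x.1) hx)

theorem bigO_factor (H : IsDesign P X Z Z' S₀) (S : ∀ n, Set (Matrix (Fin n) (Fin n) ℝ)) :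
    BigO (largeSamples S) (fun x => √(x.1 : ℝ)) 1 fun x => Z x.1 := by
  obtain ⟨C, hC⟩ := H.bigO_signal S
  refine ⟨2 * C, ?_⟩
  filter_upwards [hC, tendsto_fst_largeSamples.eventually H.center] with x h1 h2
  rw [← h2]
  have := fro_centering_mul_le (X x.1)
  linarith

theorem zpow_two_sqrt (n : ℕ) : √(n : ℝ) ^ (2 : ℤ) = n := by
  rw [show (2 : ℤ) = ((2 : ℕ) : ℤ) from rfl, zpow_natCast, Real.sq_sqrt (Nat.cast_nonneg n)]

theorem bigO_noise_of_offDiag (H : IsDesign P X Z Z' S₀) {m : Type} [Fintype m]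
    {U : ∀ n, Matrix (Fin n) m ℝ}
    (hU : BigO (largeSamples (typicalSet P X Z Z' K)) (fun x => √(x.1 : ℝ)) 1 fun x => U x.1)
    (hF : ∀ n, ∀ B ∈ typicalSet P X Z Z' K n,
      fro ((U n).transpose * offDiag (B - P n)) ≤ K * n) :
    BigO (largeSamples (typicalSet P X Z Z' K)) (fun x => √(x.1 : ℝ)) 2
      fun x => (U x.1).transpose * (x.2 - P x.1) := by
  have h1 : BigO (largeSamples (typicalSet P X Z Z' K)) (fun x => √(x.1 : ℝ)) 2
      fun x => (U x.1).transpose * offDiag (x.2 - P x.1) :=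
    ⟨K, eventually_largeSamples.2 (Eventually.of_forall fun n B hB => by
      rw [zpow_two_sqrt]; exact hF n B hB)⟩
  have h2 : BigO (largeSamples (typicalSet P X Z Z' K)) (fun x => √(x.1 : ℝ)) 1
      fun x => (U x.1).transpose * Matrix.diagonal fun i => -P x.1 i i := by
    obtain ⟨C, hC⟩ := hU
    refine ⟨C, hC.mono fun x hx => le_trans ?_ hx⟩
    rw [← fro_transpose, Matrix.transpose_mul, Matrix.diagonal_transpose,
      Matrix.transpose_transpose]
    exact fro_diagonal_mul_le (H.abs_diag_le x.1) _
  refine (h1.add (h2.mono tendsto_sqrt_largeSamples (by norm_num))).congr ?_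
  refine eventually_largeSamples.2 (Eventually.of_forall fun n B hB => ?_)
  conv_rhs => rw [hB.1.sub_eq]
  rw [Matrix.mul_add]

theorem bigO_noise_quadratic_of_offDiag (H : IsDesign P X Z Z' S₀) {m : Type} [Fintype m]
    {U : ∀ n, Matrix (Fin n) m ℝ}
    (hU : BigO (largeSamples (typicalSet P X Z Z' K)) (fun x => √(x.1 : ℝ)) 1 fun x => U x.1)
    (hF : ∀ n, ∀ B ∈ typicalSet P X Z Z' K n,
      fro ((U n).transpose * offDiag (B - P n) * X n) ≤ K * n) :
    BigO (largeSamples (typicalSet P X Z Z' K)) (fun x => √(x.1 : ℝ)) 2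
      fun x => (U x.1).transpose * (x.2 - P x.1) * X x.1 := by
  have h1 : BigO (largeSamples (typicalSet P X Z Z' K)) (fun x => √(x.1 : ℝ)) 2
      fun x => (U x.1).transpose * offDiag (x.2 - P x.1) * X x.1 :=
    ⟨K, eventually_largeSamples.2 (Eventually.of_forall fun n B hB => by
      rw [zpow_two_sqrt]; exact hF n B hB)⟩
  have h2 : BigO (largeSamples (typicalSet P X Z Z' K)) (fun x => √(x.1 : ℝ)) 1
      fun x => (Matrix.diagonal fun i => -P x.1 i i) * X x.1 := by
    obtain ⟨C, hC⟩ := H.bigO_signal (typicalSet P X Z Z' K)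
    exact ⟨C, hC.mono fun x hx => (fro_diagonal_mul_le (H.abs_diag_le x.1) _).trans hx⟩
  refine (h1.add (hU.transpose.mul tendsto_sqrt_largeSamples h2)).congr ?_
  refine eventually_largeSamples.2 (Eventually.of_forall fun n B hB => ?_)
  conv_rhs => rw [hB.1.sub_eq]
  rw [Matrix.mul_add, Matrix.add_mul, Matrix.mul_assoc _ (Matrix.diagonal _)]

theorem offDiag_transpose {n : ℕ} {M : Matrix (Fin n) (Fin n) ℝ} (hM : M.transpose = M) :
    (offDiag M).transpose = offDiag M := by
  ext i j
  have : M j i = M i j := congrFun (congrFun hM i) j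
  simp only [offDiag, Matrix.transpose_apply, Matrix.of_apply, this, eq_comm]

/-- The network noise is negligible in operator norm. -/
theorem eventually_noise_le (H : IsDesign P X Z Z' S₀) {δ : ℝ} (hδ : 0 < δ) :
    ∀ᶠ x in largeSamples (typicalSet P X Z Z' K), ∀ (m : Type) [Fintype m]
      (M : Matrix (Fin x.1) m ℝ), fro ((x.2 - P x.1) * M) ≤ δ * √(x.1 : ℝ) ^ (2 : ℤ) * fro M := by
  filter_upwards [tendsto_sqrt_largeSamples.eventually_ge_atTop 1,
    tendsto_sqrt_largeSamples.eventually_ge_atTop (2 / δ),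
    tendsto_sqrt_largeSamples.eventually_ge_atTop ((2 / δ) ^ 4),
    tendsto_fst_largeSamples.eventually H.factor,
    eventually_largeSamples (p := fun x => x.2 ∈ typicalSet P X Z Z' K x.1) |>.2
      (Eventually.of_forall fun n B hB => hB)]
    with x h1 h2 h3 hP hx m _ M
  set s := √(x.1 : ℝ) with hs
  have hs2 : s ^ (2 : ℤ) = s ^ 2 := by norm_cast
  have hPs : (P x.1).transpose = P x.1 := by
    rw [hP, Matrix.transpose_mul, Matrix.transpose_transpose]
  have hsymm : (x.2 - P x.1).transpose = x.2 - P x.1 := by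
    rw [Matrix.transpose_sub, hPs, hx.1.1]
  set F := offDiag (x.2 - P x.1) with hF
  -- As F is symmetric, `fro_mul_sq_le` bounds its operator norm by the root of ‖F F‖. Typicality
  -- gives ‖F F‖² ≤ s⁷, which is at most (δ/2)⁴ s⁸ once s ≥ (2/δ)⁴.
  have hFF : fro (F * F) ≤ (δ / 2 * s ^ 2) ^ 2 := by
    refine (pow_le_pow_iff_left₀ (fro_nonneg _) (sq_nonneg _) two_ne_zero).1
      (hx.2.spectral.trans ?_)
    rw [← hs]
    have h4 : 1 ≤ (δ / 2) ^ 4 * s := by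
      have : (δ / 2) ^ 4 * (2 / δ) ^ 4 = 1 := by
        rw [← mul_pow]; field_simp
      rw [← this]
      exact mul_le_mul_of_nonneg_left h3 (by positivity)
    calc s ^ 7 ≤ s ^ 7 * ((δ / 2) ^ 4 * s) := le_mul_of_one_le_right (by positivity) h4
      _ = _ := by ring
  have h5 : fro (F * M) ≤ δ / 2 * s ^ 2 * fro M := by
    refine (pow_le_pow_iff_left₀ (fro_nonneg _)
      (mul_nonneg (by positivity) (fro_nonneg _)) two_ne_zero).1 ?_
    refine (fro_mul_sq_le F M).trans ?_
    rw [hF, offDiag_transpose hsymm, ← hF, mul_pow]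
    exact mul_le_mul_of_nonneg_right hFF (sq_nonneg _)
  have h6 : fro ((Matrix.diagonal fun i => -P x.1 i i) * M) ≤ δ / 2 * s ^ 2 * fro M := by
    refine (fro_diagonal_mul_le (H.abs_diag_le x.1) M).trans
      (le_mul_of_one_le_left (fro_nonneg _) ?_)
    rw [div_le_iff₀ hδ] at h2
    nlinarith
  rw [hx.1.sub_eq, Matrix.add_mul, hs2]
  refine (fro_add_le _ _).trans ?_
  linarith

end IsDesign

end Design

/-! ### Expansion of the embedding of a typical network -/

section EmbeddingExpansion

variable {D l : Type} [Fintype D] [DecidableEq D] [Fintype l]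

/-- `Zh` is a centered adjacency spectral embedding of `B`, up to an orthogonal factor. -/
def IsRotatedEmbedding {n : ℕ} (d : ℕ) (B : Matrix (Fin n) (Fin n) ℝ)
    (Zh : Matrix (Fin n) D ℝ) : Prop :=
  ∃ X : Matrix (Fin n) (Fin d) ℝ, IsASE d B X ∧
    ∃ W : Matrix (Fin d) D ℝ, IsOrthogonal W ∧ Zh = centering n * X * W

namespace IsDesign

variable {P : ∀ n, Matrix (Fin n) (Fin n) ℝ} {X Z : ∀ n, Matrix (Fin n) D ℝ}
  {Z' : ∀ n, Matrix (Fin n) l ℝ} {S₀ : Matrix D D ℝ} {K : ℝ}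

/-- J is symmetric and fixes Z, so Xᵀ Z = Xᵀ J Z = (J X)ᵀ Z. -/
theorem signal_mul_factor (H : IsDesign P X Z Z' S₀) :
    ∀ᶠ n in atTop, (X n).transpose * Z n = (Z n).transpose * Z n := by
  filter_upwards [H.center, H.centered] with n h1 h2
  rw [← h1, Matrix.transpose_mul, centering_transpose, Matrix.mul_assoc, h1, h2]

/-- Typical networks have rotated embeddings that solve the perturbation problem. -/
theorem exists_eigen (H : IsDesign P X Z Z' S₀) {d : ℕ} (hd : d = Fintype.card D)
    {Zh : ∀ n, Matrix (Fin n) (Fin n) ℝ → Matrix (Fin n) D ℝ}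
    (hZ : ∀ᶠ n in atTop, ∀ B, IsAdjacency B → IsRotatedEmbedding d B (Zh n B)) :
    ∃ C : ℝ, ∀ᶠ x in largeSamples (typicalSet P X Z Z' K),
      ∃ (Y : Matrix (Fin x.1) D ℝ) (T : Matrix D D ℝ), x.2 * (Y * T) = Y ∧
        Y.transpose * Y * T = 1 ∧ fro T ≤ C * √(x.1 : ℝ) ^ (-2 : ℤ) ∧
        Zh x.1 x.2 = centering x.1 * Y := by
  set L := largeSamples (typicalSet P X Z Z' K)
  have hinv := bigO_inv_of_tendsto (tendsto_sqrt_largeSamples)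
    (H.gram_sqrt (typicalSet P X Z Z' K)) H.nonsing
  obtain ⟨C, hC⟩ := (H.bigO_factor (typicalSet P X Z Z' K)).mul tendsto_sqrt_largeSamples hinv
  have hpos : 0 < C ^ 2 + 1 := by positivity
  refine ⟨2 * Fintype.card D * d * (C ^ 2 + 1), ?_⟩
  filter_upwards [hC, eventually_inv_mul (H.gram_sqrt (typicalSet P X Z Z' K)) H.nonsing,
    H.eventually_noise_le (δ := 1 / (4 * (C ^ 2 + 1))) (by positivity),
    tendsto_sqrt_largeSamples.eventually_ge_atTop 1,
    tendsto_fst_largeSamples.eventually H.factor,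
    tendsto_fst_largeSamples.eventually H.signal_mul_factor,
    tendsto_fst_largeSamples.eventually hZ,
    eventually_largeSamples (p := fun x => x.2 ∈ typicalSet P X Z Z' K x.1) |>.2
      (Eventually.of_forall fun n B hB => hB)] with x e1 e2 e3 e4 e5 e6 e7 e8
  set s := √(x.1 : ℝ) with hs
  have hs0 : 0 < s := by positivity
  -- The signal strength on the column space of Z: ‖Z (Zᵀ Z)⁻¹‖² ≤ C² / s², with 1 added to avoid
  -- division by zero. The noise level was chosen above so as to be t / 4.
  set t := s ^ 2 / (C ^ 2 + 1) with ht
  have ht0 : 0 < t := by positivity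
  have hs2 : s ^ (2 : ℤ) = s ^ 2 := by norm_cast
  obtain ⟨Xh, hXh, W, hW, hZh⟩ := e7 x.2 e8.1
  have hg : fro (Z x.1 * ((Z x.1).transpose * Z x.1)⁻¹) ^ 2 * t ≤ 1 := by
    have h1 : fro (Z x.1 * ((Z x.1).transpose * Z x.1)⁻¹) ^ 2 ≤ C ^ 2 * (s ^ 2)⁻¹ := by
      refine (pow_le_pow_left₀ (fro_nonneg _) e1 2).trans (le_of_eq ?_)
      rw [mul_pow, show (1 + -2 : ℤ) = -1 by norm_num, zpow_neg_one, inv_pow]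
    refine (mul_le_mul_of_nonneg_right h1 ht0.le).trans ?_
    rw [ht, show C ^ 2 * (s ^ 2)⁻¹ * (s ^ 2 / (C ^ 2 + 1)) = C ^ 2 / (C ^ 2 + 1) by
      field_simp, div_le_one hpos]
    linarith
  have hκ : 1 / (4 * (C ^ 2 + 1)) * s ^ (2 : ℤ) = t / 4 := by
    rw [hs2, ht]; field_simp
  obtain ⟨σ, hσ, hB, hG⟩ := hXh.eigen (X := X x.1) (Z := Z x.1) (E := x.2 - P x.1) (t := t)
    (κ := t / 4) hd (by rw [← e5]; abel) e8.1.1 ht0 (by linarith) e6 e2 hg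
    (fun M => hκ ▸ e3 Unit M) (fun M => hκ ▸ e3 (Fin d) M)
  obtain ⟨T, h1, h2, h3⟩ := exists_inverse_gram_of_eigen ht0 hσ hB hG hW
  refine ⟨Xh * W, T, h1, h2, h3.trans (le_of_eq ?_), by rw [hZh, Matrix.mul_assoc]⟩
  rw [ht, zpow_neg, hs2]
  field_simp

/-- The centered embedding is a near rotation of the factors, nearly orthogonal to the remaining
factors. -/
theorem exists_isNearRotation (H : IsDesign P X Z Z' S₀) {d : ℕ} (hd : d = Fintype.card D)
    {Zh : ∀ n, Matrix (Fin n) (Fin n) ℝ → Matrix (Fin n) D ℝ}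
    (hZ : ∀ᶠ n in atTop, ∀ B, IsAdjacency B → IsRotatedEmbedding d B (Zh n B)) :
    ∃ (R : Sample → Matrix D D ℝ) (Δ : ∀ x : Sample, Matrix (Fin x.1) D ℝ),
      IsNearRotation (largeSamples (typicalSet P X Z Z' K)) (fun x => √(x.1 : ℝ))
        (fun x => Z x.1) R Δ (fun x => Zh x.1 x.2) ∧
      BigO (largeSamples (typicalSet P X Z Z' K)) (fun x => √(x.1 : ℝ)) 0
        fun x => (Zh x.1 x.2).transpose * Z' x.1 := by
  obtain ⟨C, hC⟩ := H.exists_eigen (K := K) hd hZ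
  -- Solutions exist only eventually. The implication, with the default value 0, allows them to be
  -- chosen as functions on all samples.
  have hchoice : ∀ x : Sample, ∃ (Y : Matrix (Fin x.1) D ℝ) (T : Matrix D D ℝ),
      (∃ (Y : Matrix (Fin x.1) D ℝ) (T : Matrix D D ℝ), x.2 * (Y * T) = Y ∧
        Y.transpose * Y * T = 1 ∧ fro T ≤ C * √(x.1 : ℝ) ^ (-2 : ℤ) ∧
        Zh x.1 x.2 = centering x.1 * Y) →
      (x.2 * (Y * T) = Y ∧ Y.transpose * Y * T = 1 ∧ fro T ≤ C * √(x.1 : ℝ) ^ (-2 : ℤ) ∧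
        Zh x.1 x.2 = centering x.1 * Y) := by
    intro x
    by_cases h : ∃ (Y : Matrix (Fin x.1) D ℝ) (T : Matrix D D ℝ), x.2 * (Y * T) = Y ∧
        Y.transpose * Y * T = 1 ∧ fro T ≤ C * √(x.1 : ℝ) ^ (-2 : ℤ) ∧
        Zh x.1 x.2 = centering x.1 * Y
    · obtain ⟨Y, T, hYT⟩ := h
      exact ⟨Y, T, fun _ => hYT⟩
    · exact ⟨0, 0, fun h' => absurd h' h⟩
  choose Y T hYT using hchoice
  set L := largeSamples (typicalSet P X Z Z' K) with hL
  have hprop : ∀ᶠ x in L, x.2 * (Y x * T x) = Y x ∧ (Y x).transpose * Y x * T x = 1 ∧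
      fro (T x) ≤ C * √(x.1 : ℝ) ^ (-2 : ℤ) ∧ Zh x.1 x.2 = centering x.1 * Y x :=
    hC.mono fun x hx => hYT x hx
  have hfac := tendsto_fst_largeSamples.eventually
    (f := fun x : Sample => x.1) (l₁ := L) H.factor
  have hcen := tendsto_fst_largeSamples.eventually (f := fun x : Sample => x.1) (l₁ := L) H.center
  have hcen2 := tendsto_fst_largeSamples.eventually
    (f := fun x : Sample => x.1) (l₁ := L) H.centered
  have hcen3 := tendsto_fst_largeSamples.eventually
    (f := fun x : Sample => x.1) (l₁ := L) H.centered'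
  have hort := tendsto_fst_largeSamples.eventually (f := fun x : Sample => x.1) (l₁ := L) H.ortho
  have hX := H.bigO_signal (typicalSet P X Z Z' K)
  have hZf := H.bigO_factor (typicalSet P X Z Z' K)
  have hZ'f : BigO L (fun x => √(x.1 : ℝ)) 1 fun x => Z' x.1 := by
    obtain ⟨c, hc⟩ := H.bound'
    refine ⟨√c, ?_⟩
    filter_upwards [tendsto_fst_largeSamples.eventually hc] with x hx
    rw [zpow_one, ← Real.sqrt_mul' _ (Nat.cast_nonneg _)]
    exact Real.le_sqrt_of_sq_le hx
  have hsym : ∀ᶠ x in L, (x.2 - P x.1).transpose = x.2 - P x.1 := by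
    filter_upwards [hfac, eventually_largeSamples (p := fun x => x.2 ∈ typicalSet P X Z Z' K x.1)
      |>.2 (Eventually.of_forall fun n B hB => hB)] with x h1 h2
    rw [Matrix.transpose_sub, h2.1.1, h1, Matrix.transpose_mul, Matrix.transpose_transpose]
  have hpert : IsPerturbation L (fun x => √(x.1 : ℝ)) (fun x => X x.1) (fun x => x.2 - P x.1)
      Y T :=
    { scale := tendsto_sqrt_largeSamples
      symm := hsym
      eigen := by
        filter_upwards [hfac, hprop] with x h1 h2
        rw [← h1, add_sub_cancel, h2.1]
      gram := hprop.mono fun x hx => hx.2.1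
      inv := ⟨C, hprop.mono fun x hx => hx.2.2.1⟩
      signal := hX
      noise := H.bigO_noise_of_offDiag hX fun n B hB => hB.2.signal
      noise_quadratic := H.bigO_noise_quadratic_of_offDiag hX fun n B hB => hB.2.signal_quadratic
      small := fun δ hδ => (H.eventually_noise_le hδ).mono fun x hx M => hx D M }
  have hsplit (n : ℕ) {m : Type} [Fintype m] (N : Matrix (Fin n) m ℝ) :
      (Matrix.fromCols (Z n) (Z' n)).transpose * N
        = Matrix.fromRows ((Z n).transpose * N) ((Z' n).transpose * N) := by
    rw [Matrix.transpose_fromCols, Matrix.fromRows_mul]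
  have hcross : BigO L (fun x => √(x.1 : ℝ)) 0
      fun x => (Z x.1).transpose * ((x.2 - P x.1) * (Y x * T x)) := by
    refine hpert.bigO_transpose_mul_residual (H.bigO_noise_of_offDiag hZf fun n B hB => ?_)
      (H.bigO_noise_quadratic_of_offDiag hZf fun n B hB => ?_)
    · refine le_trans ?_ hB.2.factor
      rw [hsplit]
      exact fro_le_fromRows_left _ _
    · refine le_trans ?_ hB.2.factor_quadratic
      rw [hsplit, Matrix.fromRows_mul]
      exact fro_le_fromRows_left _ _
  have hcross' : BigO L (fun x => √(x.1 : ℝ)) 0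
      fun x => (Z' x.1).transpose * ((x.2 - P x.1) * (Y x * T x)) := by
    refine hpert.bigO_transpose_mul_residual (H.bigO_noise_of_offDiag hZ'f fun n B hB => ?_)
      (H.bigO_noise_quadratic_of_offDiag hZ'f fun n B hB => ?_)
    · refine le_trans ?_ hB.2.factor
      rw [hsplit]
      exact fro_le_fromRows_right _ _
    · refine le_trans ?_ hB.2.factor_quadratic
      rw [hsplit, Matrix.fromRows_mul]
      exact fro_le_fromRows_right _ _
  have heq : ∀ᶠ x in L, Zh x.1 x.2 = Z x.1 * ((X x.1).transpose * (Y x * T x)) +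
      centering x.1 * ((x.2 - P x.1) * (Y x * T x)) := by
    filter_upwards [hprop, hpert.eq_add, hcen] with x h1 h2 h3
    rw [h1.2.2.2]
    conv_lhs => rw [h2]
    rw [Matrix.mul_add, ← Matrix.mul_assoc, h3]
  -- Centering Y = X R + E Y T turns X into Z, keeps R and replaces the residual by its centered
  -- version.
  refine ⟨fun x => (X x.1).transpose * (Y x * T x),
    fun x => centering x.1 * ((x.2 - P x.1) * (Y x * T x)), ?_, ?_⟩
  · exact
      { scale := tendsto_sqrt_largeSamples
        eq := heq
        coeff := hpert.bigO_coeff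
        orth := hpert.bigO_gram_coeff_sub_one
        error := by
          obtain ⟨c, hc⟩ := hpert.bigO_residual
          refine ⟨2 * c, hc.mono fun x hx => ?_⟩
          have := fro_centering_mul_le ((x.2 - P x.1) * (Y x * T x))
          linarith
        cross := by
          refine hcross.congr ?_
          filter_upwards [hcen2] with x hx
          rw [← Matrix.mul_assoc (Z x.1).transpose (centering x.1)]
          conv_rhs => rw [← centering_transpose, ← Matrix.transpose_mul, hx]
        factor := hZf
        inv := bigO_inv_of_tendsto tendsto_sqrt_largeSamples (H.gram_sqrt _) H.nonsing
        inv_mul := eventually_inv_mul (H.gram_sqrt _) H.nonsing }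
  -- Zᵀ Z' = 0 removes the main term of Ẑᵀ Z'; only the residual, bounded when tested against Z', is
  -- left.
  · refine hcross'.transpose.congr ?_
    filter_upwards [heq, hort, hcen3] with x h1 h2 h3
    rw [h1, Matrix.transpose_add, Matrix.add_mul, Matrix.transpose_mul (Z x.1), Matrix.mul_assoc,
      h2, Matrix.mul_zero, zero_add, Matrix.transpose_mul (centering x.1), centering_transpose,
      Matrix.mul_assoc _ (centering x.1), h3, Matrix.transpose_mul, Matrix.transpose_transpose]

end IsDesign

end EmbeddingExpansion

/-! ### Consequences of the choice of rotation -/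

section Rotations

variable {k1 k2 n : ℕ} {Z Zh : Matrix (Fin n) (Fin k1 ⊕ Fin k2) ℝ} {B : Matrix (Fin n) (Fin n) ℝ}

theorem IsAlignedEmbedding.isRotatedEmbedding (H : IsAlignedEmbedding Z B Zh) :
    IsRotatedEmbedding (k1 + k2) B Zh := by
  obtain ⟨X, h1, h2, -⟩ := H
  exact ⟨X, h1, h2⟩

theorem IsDiagonalizedEmbedding.isRotatedEmbedding (H : IsDiagonalizedEmbedding Z B Zh) :
    IsRotatedEmbedding (k1 + k2) B Zh := H.1

theorem IsOrthogonal.transpose {ι κ : Type*} [Fintype ι] [Fintype κ] [DecidableEq ι]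
    [DecidableEq κ] {W : Matrix ι κ ℝ} (hW : IsOrthogonal W) : IsOrthogonal W.transpose := by
  obtain ⟨h1, h2⟩ := hW
  exact ⟨by rw [Matrix.transpose_transpose, h2], by rw [Matrix.transpose_transpose, h1]⟩

theorem IsOrthogonal.mul {ι κ τ : Type*} [Fintype ι] [Fintype κ] [Fintype τ] [DecidableEq ι]
    [DecidableEq κ] [DecidableEq τ] {W : Matrix ι κ ℝ} {V : Matrix κ τ ℝ} (hW : IsOrthogonal W)
    (hV : IsOrthogonal V) : IsOrthogonal (W * V) := by
  constructor
  · rw [Matrix.transpose_mul, Matrix.mul_assoc, ← Matrix.mul_assoc W.transpose, hW.1,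
      Matrix.one_mul, hV.1]
  · rw [Matrix.transpose_mul, Matrix.mul_assoc, ← Matrix.mul_assoc V, hV.2, Matrix.one_mul, hW.2]

theorem fro_sub_sq {m p : Type*} [Fintype m] [Fintype p] (M N : Matrix m p ℝ) :
    fro (M - N) ^ 2 = fro M ^ 2 - 2 * (M.transpose * N).trace + fro N ^ 2 := by
  have h : (N.transpose * M).trace = (M.transpose * N).trace := by
    rw [← Matrix.trace_transpose, Matrix.transpose_mul, Matrix.transpose_transpose]
  simp only [fro_sq_eq_trace, Matrix.transpose_sub, Matrix.sub_mul, Matrix.mul_sub,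
    Matrix.trace_sub, h]
  ring

theorem IsOrthogonal.fro_mul {m ι κ : Type*} [Fintype m] [Fintype ι] [Fintype κ] [DecidableEq ι]
    [DecidableEq κ] {V : Matrix ι κ ℝ} (hV : IsOrthogonal V) (M : Matrix m ι ℝ) :
    fro (M * V) ^ 2 = fro M ^ 2 := by
  rw [fro_sq_eq_trace, fro_sq_eq_trace, Matrix.transpose_mul, Matrix.mul_assoc,
    Matrix.trace_mul_comm, Matrix.mul_assoc, Matrix.mul_assoc, hV.2, Matrix.mul_one]

/-- A further orthogonal factor changes only the cross term of the squared distance to Z, so minimal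
distance means that tr(V Ẑᵀ Z) is largest at V = 1. -/
theorem IsAlignedEmbedding.posSemidef (H : IsAlignedEmbedding Z B Zh) :
    (Zh.transpose * Z).PosSemidef := by
  obtain ⟨X, -, ⟨W, hW, rfl⟩, hmin⟩ := H
  refine posSemidef_of_trace_maximal fun V hV => ?_
  have h1 := hmin (W * V.transpose) (hW.mul hV.transpose)
  rw [← Matrix.mul_assoc] at h1
  simp only [← Matrix.sub_apply, ← fro_sq] at h1
  rw [fro_sub_sq, fro_sub_sq, hV.transpose.fro_mul, Matrix.transpose_mul (centering n * X * W) _,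
    Matrix.transpose_transpose, Matrix.mul_assoc V] at h1
  linarith

/-- Regression on `Y` is within `c` of regression on `Z`, in noise response, bias and leakage. -/
structure IsCloseRegressor {n : ℕ} {D l : Type} [Fintype D] [DecidableEq D] [Fintype l]
    (Z : Matrix (Fin n) D ℝ) (Z' : Matrix (Fin n) l ℝ) (Y : Matrix (Fin n) D ℝ) (c : ℝ) :
    Prop where
  inv_mul : (Y.transpose * Y)⁻¹ * (Y.transpose * Y) = 1
  response : fro ((Y.transpose * Y)⁻¹ * Y.transpose - (Z.transpose * Z)⁻¹ * Z.transpose) ≤ c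
  bias : fro ((Y.transpose * Y)⁻¹ * (Y.transpose * (Z - Y))) ≤ c
  leakage : fro ((Y.transpose * Y)⁻¹ * (Y.transpose * Z')) ≤ c

end Rotations

/-! ### The estimated factors as regressors -/

section CloseRegressor

variable {k1 k2 : ℕ} {l : Type} [Fintype l] {P : ∀ n, Matrix (Fin n) (Fin n) ℝ}
  {X Z : ∀ n, Matrix (Fin n) (Fin k1 ⊕ Fin k2) ℝ} {Z' : ∀ n, Matrix (Fin n) l ℝ}
  {S₀ : Matrix (Fin k1 ⊕ Fin k2) (Fin k1 ⊕ Fin k2) ℝ} {K : ℝ}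
  {Zh : ∀ n, Matrix (Fin n) (Fin n) ℝ → Matrix (Fin n) (Fin k1 ⊕ Fin k2) ℝ}

namespace IsDesign

theorem exists_isCloseRegressor (H : IsDesign P X Z Z' S₀)
    {R : Sample → Matrix (Fin k1 ⊕ Fin k2) (Fin k1 ⊕ Fin k2) ℝ}
    {Δ : ∀ x : Sample, Matrix (Fin x.1) (Fin k1 ⊕ Fin k2) ℝ}
    (h1 : IsNearRotation (largeSamples (typicalSet P X Z Z' K)) (fun x => √(x.1 : ℝ))
        (fun x => Z x.1) R Δ (fun x => Zh x.1 x.2))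
    (h2 : BigO (largeSamples (typicalSet P X Z Z' K)) (fun x => √(x.1 : ℝ)) 0
        fun x => (Zh x.1 x.2).transpose * Z' x.1)
    (hR : BigO (largeSamples (typicalSet P X Z Z' K)) (fun x => √(x.1 : ℝ)) (-2)
        fun x => R x - 1) :
    ∃ C : ℝ, ∀ᶠ n : ℕ in atTop, ∀ B ∈ typicalSet P X Z Z' K n,
      IsCloseRegressor (Z n) (Z' n) (Zh n B) (C / n) := by
  have hg := H.gram_sqrt (typicalSet P X Z Z' K)
  obtain ⟨C₁, hC₁⟩ := h1.bigO_regression_sub hR hg H.nonsing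
  obtain ⟨C₂, hC₂⟩ := h1.bigO_bias hR hg H.nonsing
  obtain ⟨C₃, hC₃⟩ := h1.bigO_leakage hR hg H.nonsing h2
  have hi := eventually_inv_mul (h1.tendsto_gram hR hg) H.nonsing
  refine ⟨max C₁ (max C₂ C₃), ?_⟩
  refine (eventually_largeSamples (p := fun x => IsCloseRegressor (Z x.1) (Z' x.1) (Zh x.1 x.2)
    (max C₁ (max C₂ C₃) / x.1))).1 ?_
  filter_upwards [hC₁, hC₂, hC₃, hi] with x e1 e2 e3 e4
  rw [zpow_neg, zpow_two_sqrt, ← div_eq_mul_inv] at e1 e2 e3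
  exact ⟨e4, e1.trans (by gcongr; exact le_max_left _ _),
    e2.trans (by gcongr; exact (le_max_left _ _).trans (le_max_right _ _)),
    e3.trans (by gcongr; exact (le_max_right _ _).trans (le_max_right _ _))⟩

theorem isCloseRegressor_of_isAlignedEmbedding (H : IsDesign P X Z Z' S₀)
    (hZ : ∀ᶠ n in atTop, ∀ B, IsAdjacency B → IsAlignedEmbedding (Z n) B (Zh n B)) (K : ℝ) :
    ∃ C : ℝ, ∀ᶠ n : ℕ in atTop, ∀ B ∈ typicalSet P X Z Z' K n,
      IsCloseRegressor (Z n) (Z' n) (Zh n B) (C / n) := by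
  obtain ⟨R, Δ, h1, h2⟩ := H.exists_isNearRotation (K := K) (d := k1 + k2) (by simp)
    (hZ.mono fun n hn B hB => (hn B hB).isRotatedEmbedding)
  refine H.exists_isCloseRegressor h1 h2 (h1.bigO_sub_one_of_posSemidef ?_)
  exact eventually_largeSamples.2 (hZ.mono fun n hn B hB => (hn B hB.1).posSemidef)

/-- The diagonal entries of Zᵀ Z / n have positive and distinct limits, so those of Zᵀ Z are
eventually bounded below and separated by a multiple of n, as eigenvalue matching requires. -/
theorem isCloseRegressor_of_isDiagonalizedEmbedding (H : IsDesign P X Z Z' S₀)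
    (hZ : ∀ᶠ n in atTop, ∀ B, IsAdjacency B → IsDiagonalizedEmbedding (Z n) B (Zh n B))
    (hG : ∀ᶠ n in atTop, ((Z n).transpose * Z n).IsDiag) (hS : DistinctDiag S₀)
    (hpos : ∀ a, 0 < S₀ a a) (K : ℝ) :
    ∃ C : ℝ, ∀ᶠ n : ℕ in atTop, ∀ B ∈ typicalSet P X Z Z' K n,
      IsCloseRegressor (Z n) (Z' n) (Zh n B) (C / n) := by
  obtain ⟨R, Δ, h1, h2⟩ := H.exists_isNearRotation (K := K) (d := k1 + k2) (by simp)
    (hZ.mono fun n hn B hB => (hn B hB).isRotatedEmbedding)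
  obtain ⟨c, hc, hcpos, hcgap⟩ : ∃ c : ℝ, 0 < c ∧ (∀ a, c < S₀ a a) ∧
      ∀ a b, a ≠ b → c < |S₀ a a - S₀ b b| := by
    have hsm {ι : Type} [Finite ι] (f : ι → ℝ) (hf : ∀ i, 0 < f i) : ∃ c, 0 < c ∧ ∀ i, c < f i := by
      have h : ∀ᶠ c in 𝓝[>] (0 : ℝ), ∀ i, c < f i := eventually_all.2 fun i =>
        (gt_mem_nhds (hf i)).filter_mono nhdsWithin_le_nhds
      obtain ⟨c, h1, h2⟩ := (h.and self_mem_nhdsWithin).exists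
      exact ⟨c, h2, h1⟩
    obtain ⟨c₁, h₁, h₁'⟩ := hsm (fun a => S₀ a a) hpos
    obtain ⟨c₂, h₂, h₂'⟩ := hsm
      (fun q : {q : (Fin k1 ⊕ Fin k2) × (Fin k1 ⊕ Fin k2) // q.1 ≠ q.2} =>
        |S₀ q.1.1 q.1.1 - S₀ q.1.2 q.1.2|)
      fun q => abs_pos.2 (sub_ne_zero.2 fun h => q.2 (hS.2 h))
    exact ⟨min c₁ c₂, lt_min h₁ h₂, fun a => (min_le_left _ _).trans_lt (h₁' a),
      fun a b hab => (min_le_right _ _).trans_lt (h₂' ⟨(a, b), hab⟩)⟩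
  have hent (a : Fin k1 ⊕ Fin k2) : Tendsto (fun n : ℕ => (n : ℝ)⁻¹ * ((Z n).transpose * Z n) a a)
      atTop (𝓝 (S₀ a a)) :=
    ((continuous_id.matrix_elem a a).tendsto S₀).comp H.gram
  have hev : ∀ᶠ n : ℕ in atTop, (∀ a, c * √(n : ℝ) ^ (2 : ℤ) ≤ ((Z n).transpose * Z n) a a) ∧
      ∀ a b, a ≠ b → c * √(n : ℝ) ^ (2 : ℤ) ≤
        |((Z n).transpose * Z n) a a - ((Z n).transpose * Z n) b b| := by
    have e1 : ∀ᶠ n : ℕ in atTop, ∀ a, c < (n : ℝ)⁻¹ * ((Z n).transpose * Z n) a a :=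
      eventually_all.2 fun a => (hent a).eventually (lt_mem_nhds (hcpos a))
    have e2 : ∀ᶠ n : ℕ in atTop, ∀ a b, a ≠ b → c <
        |(n : ℝ)⁻¹ * ((Z n).transpose * Z n) a a - (n : ℝ)⁻¹ * ((Z n).transpose * Z n) b b| :=
      eventually_all.2 fun a => eventually_all.2 fun b => by
        by_cases hab : a = b
        · exact Eventually.of_forall fun n h => absurd hab h
        · exact (((hent a).sub (hent b)).abs.eventually (lt_mem_nhds (hcgap a b hab))).mono
            fun n hn _ => hn
    filter_upwards [e1, e2, eventually_gt_atTop 0] with n h1 h2 h3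
    have h3' : (0 : ℝ) < n := by exact_mod_cast h3
    rw [zpow_two_sqrt]
    refine ⟨fun a => ?_, fun a b hab => ?_⟩
    · have := h1 a
      rw [lt_inv_mul_iff₀ h3'] at this
      linarith
    · have := h2 a b hab
      rw [← mul_sub, abs_mul, abs_of_pos (inv_pos.2 h3'), lt_inv_mul_iff₀ h3'] at this
      linarith
  have hev' := tendsto_fst_largeSamples (S := typicalSet P X Z Z' K) |>.eventually hev
  refine H.exists_isCloseRegressor h1 h2 (h1.bigO_sub_one_of_isDiag ?_
    (tendsto_fst_largeSamples.eventually hG) hc (hev'.mono fun x hx => hx.2)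
    (hev'.mono fun x hx => hx.1) ?_ ?_)
  · exact eventually_largeSamples.2 (hZ.mono fun n hn B hB => (hn B hB.1).2.1)
  · exact eventually_largeSamples.2 (hZ.mono fun n hn B hB => (hn B hB.1).2.2.1)
  · refine eventually_largeSamples.2 (hZ.mono fun n hn B hB a => ?_)
    simpa [Matrix.mul_apply] using (hn B hB.1).2.2.2 a

end IsDesign

end CloseRegressor

/-! ### Adjacency matrices as finite data -/

section Codes

variable {n : ℕ}

/-- The Boolean array of a binary matrix. -/
noncomputable def bits (B : Matrix (Fin n) (Fin n) ℝ) : Fin n → Fin n → Bool :=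
  fun i j => decide (B i j = 1)

/-- The binary matrix of a Boolean array. -/
def ofBits (b : Fin n → Fin n → Bool) : Matrix (Fin n) (Fin n) ℝ :=
  Matrix.of fun i j => if b i j then 1 else 0

theorem IsAdjacency.ofBits_bits {B : Matrix (Fin n) (Fin n) ℝ} (hB : IsAdjacency B) :
    ofBits (bits B) = B := by
  ext i j
  rcases hB.2.2 i j with h | h <;> simp [ofBits, bits, h]

theorem measurable_bits : Measurable (fun B : Fin n → Fin n → ℝ => bits (Matrix.of B)) := by
  refine measurable_pi_lambda _ fun i => measurable_pi_lambda _ fun j => ?_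
  refine measurable_to_bool ?_
  have : (fun B : Fin n → Fin n → ℝ => bits (Matrix.of B) i j) ⁻¹' {true}
      = (fun B => B i j) ⁻¹' {1} := by
    ext B
    exact decide_eq_true_iff
  rw [this]
  exact (measurable_pi_apply j).comp (measurable_pi_apply i) (measurableSet_singleton 1)

/-- The embedding is chosen from a network in an arbitrary way. Measurability is automatic because
the network has finitely many possible values, recorded by a Boolean array. -/
theorem measurable_comp_of_isAdjacency {Ω β : Type*} [MeasurableSpace Ω] [MeasurableSpace β]
    {A : Ω → Matrix (Fin n) (Fin n) ℝ} (hA : ∀ ω, IsAdjacency (A ω))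
    (hm : ∀ i j, Measurable fun ω => A ω i j) (f : Matrix (Fin n) (Fin n) ℝ → β) :
    Measurable fun ω => f (A ω) := by
  have h : (fun ω => f (A ω)) = (fun b => f (ofBits b)) ∘ (fun B : Fin n → Fin n → ℝ =>
      bits (Matrix.of B)) ∘ fun ω i j => A ω i j := by
    funext ω
    exact congrArg f (hA ω).ofBits_bits.symm
  rw [h]
  exact (Measurable.of_discrete).comp (measurable_bits.comp
    (measurable_pi_lambda _ fun i => measurable_pi_lambda _ fun j => hm i j))

end Codes

/-! ### Noise and its independence of the network -/

section Probability

variable {Ω : Type*} [MeasurableSpace Ω] {Pr : Measure Ω} [IsProbabilityMeasure Pr]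

/-- A uniform bound for fixed parameters persists for an independent discrete parameter. -/
theorem measureReal_le_of_indepFun {α β : Type*} [Fintype α] [MeasurableSpace α]
    [MeasurableSingletonClass α] [MeasurableSpace β] {U : Ω → α} {e : Ω → β}
    (hU : Measurable U) (h : IndepFun U e Pr) {E : α → Set β} (hE : ∀ a, MeasurableSet (E a))
    {c : ℝ} (hc : ∀ a, Pr.real {ω | e ω ∈ E a} ≤ c) :
    Pr.real {ω | e ω ∈ E (U ω)} ≤ c := by
  have h1 : {ω | e ω ∈ E (U ω)} ⊆ ⋃ a, U ⁻¹' {a} ∩ e ⁻¹' E a := by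
    intro ω hω
    exact Set.mem_iUnion.2 ⟨U ω, rfl, hω⟩
  have h2 : ∀ a, Pr.real (U ⁻¹' {a} ∩ e ⁻¹' E a) ≤ Pr.real (U ⁻¹' {a}) * c := by
    intro a
    rw [measureReal_def, h.measure_inter_preimage_eq_mul _ _ (measurableSet_singleton a) (hE a),
      ENNReal.toReal_mul]
    exact mul_le_mul_of_nonneg_left (hc a) ENNReal.toReal_nonneg
  have h3 : ∑ a, Pr.real (U ⁻¹' {a}) = 1 := by
    rw [sum_measureReal_preimage_singleton _ fun a _ => hU (measurableSet_singleton a)]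
    simp
  calc _ ≤ Pr.real (⋃ a, U ⁻¹' {a} ∩ e ⁻¹' E a) := measureReal_mono h1
    _ ≤ ∑ a, Pr.real (U ⁻¹' {a} ∩ e ⁻¹' E a) := measureReal_iUnion_fintype_le _
    _ ≤ ∑ a, Pr.real (U ⁻¹' {a}) * c := Finset.sum_le_sum fun a _ => h2 a
    _ = c := by rw [← Finset.sum_mul, h3, one_mul]

/-- I.i.d. square-integrable random variables with mean zero and variance `v`. -/
structure IsWhiteNoise (Pr : Measure Ω) (ξ : ℕ → Ω → ℝ) (v : ℝ) : Prop where
  indep : iIndepFun ξ Pr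
  ident : ∀ i, IdentDistrib (ξ i) (ξ 0) Pr Pr
  memLp : ∀ i, MemLp (ξ i) 2 Pr
  mean : ∀ i, ∫ ω, ξ i ω ∂Pr = 0
  var : ∀ i, ∫ ω, ξ i ω * ξ i ω ∂Pr = v

variable {k1 k2 k3 : ℕ} {M : Params k1 k2 k3} {A : (n : ℕ) → Ω → Matrix (Fin n) (Fin n) ℝ}
  {ε : ℕ → ℕ → Ω → ℝ}

theorem IsNoise.isWhiteNoise (H : IsNoise Pr M ε) {n j : ℕ} (hj : j < M.p n) :
    IsWhiteNoise Pr (fun i => ε i j) (M.Ψ j) where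
  indep := (H.indep n).comp (fun _ x => x ⟨j, hj⟩) fun _ => measurable_pi_apply _
  ident i := (H.ident n i).comp (measurable_pi_apply (⟨j, hj⟩ : Fin (M.p n)))
  memLp i := H.memLp n i ⟨j, hj⟩
  mean i := H.mean n i ⟨j, hj⟩
  var i := by
    rw [H.cov n i ⟨j, hj⟩ ⟨j, hj⟩, Params.Ψmat, Matrix.diagonal_apply_eq]

namespace IsWhiteNoise

variable {ξ : ℕ → Ω → ℝ} {v : ℝ}

theorem integrable_mul (H : IsWhiteNoise Pr ξ v) (i k : ℕ) :
    Integrable (fun ω => ξ i ω * ξ k ω) Pr := (H.memLp i).integrable_mul (H.memLp k)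

theorem integral_mul (H : IsWhiteNoise Pr ξ v) (i k : ℕ) :
    ∫ ω, ξ i ω * ξ k ω ∂Pr = if i = k then v else 0 := by
  split_ifs with h
  · subst h
    exact H.var i
  · have := (H.indep.indepFun h).integral_fun_mul_eq_mul_integral
      (H.memLp i).aestronglyMeasurable (H.memLp k).aestronglyMeasurable
    rw [this, H.mean i, zero_mul]

/-- Chebyshev's inequality: the second moment of ‖T ξ‖ is v ‖T‖², as the coordinates of ξ are
uncorrelated. -/
theorem measureReal_le_norm_mulVec (H : IsWhiteNoise Pr ξ v) {n : ℕ} {D : Type*} [Fintype D]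
    (T : Matrix D (Fin n) ℝ) {δ : ℝ} (hδ : 0 < δ) :
    Pr.real {ω | δ ≤ ‖WithLp.toLp 2 (T.mulVec fun i => ξ i ω)‖} ≤ v * fro T ^ 2 / δ ^ 2 := by
  have h1 : ∀ ω, ‖WithLp.toLp 2 (T.mulVec fun i : Fin n => ξ i ω)‖ ^ 2
      = ∑ a, ∑ i, ∑ k, T a i * T a k * (ξ i ω * ξ k ω) := by
    intro ω
    rw [EuclideanSpace.norm_sq_eq]
    refine Finset.sum_congr rfl fun a _ => ?_
    simp only [Matrix.mulVec, dotProduct, Real.norm_eq_abs, sq_abs]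
    rw [pow_two, Finset.sum_mul_sum]
    refine Finset.sum_congr rfl fun i _ => Finset.sum_congr rfl fun k _ => by ring
  have hint : ∀ a i k, Integrable (fun ω => T a i * T a k * (ξ (i : Fin n) ω * ξ (k : Fin n) ω)) Pr :=
    fun a i k => (H.integrable_mul i k).const_mul _
  have h2 : Integrable (fun ω => ‖WithLp.toLp 2 (T.mulVec fun i : Fin n => ξ i ω)‖ ^ 2) Pr := by
    simp only [h1]
    exact integrable_finsetSum _ fun a _ => integrable_finsetSum _ fun i _ =>
      integrable_finsetSum _ fun k _ => hint a i k
  have h3 : ∫ ω, ‖WithLp.toLp 2 (T.mulVec fun i : Fin n => ξ i ω)‖ ^ 2 ∂Pr = v * fro T ^ 2 := by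
    simp only [h1]
    rw [integral_finsetSum _ fun a _ => integrable_finsetSum _ fun i _ =>
      integrable_finsetSum _ fun k _ => hint a i k, fro_sq, Finset.mul_sum]
    refine Finset.sum_congr rfl fun a _ => ?_
    rw [integral_finsetSum _ fun i _ => integrable_finsetSum _ fun k _ => hint a i k,
      Finset.mul_sum]
    refine Finset.sum_congr rfl fun i _ => ?_
    rw [integral_finsetSum _ fun k _ => hint a i k]
    simp only [integral_const_mul, H.integral_mul, Fin.val_inj, mul_ite, mul_zero,
      Finset.sum_ite_eq, Finset.mem_univ, if_true]
    ring
  have h4 := mul_meas_ge_le_integral_of_nonneg (Eventually.of_forall fun ω => sq_nonneg _) h2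
    (δ ^ 2)
  rw [h3] at h4
  rw [le_div_iff₀ (by positivity), mul_comm]
  refine le_trans (le_of_eq ?_) h4
  congr 3
  ext ω
  exact (pow_le_pow_iff_left₀ hδ.le (norm_nonneg _) two_ne_zero).symm

end IsWhiteNoise

/-- Given the Boolean code of the network the matrix `T (A n ω)` is fixed, while the noise keeps its
law by independence; Chebyshev's bound then holds code by code. -/
theorem IsModel.measureReal_mem_and_le (H : IsModel Pr M A ε) (h2 : AssumptionII A) {n j : ℕ}
    (hj : j < M.p n) {D : Type*} [Fintype D] (S : Set (Matrix (Fin n) (Fin n) ℝ))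
    (T : Matrix (Fin n) (Fin n) ℝ → Matrix D (Fin n) ℝ) {c δ : ℝ} (hv : 0 ≤ M.Ψ j)
    (hT : ∀ B ∈ S, fro (T B) ≤ c) (hδ : 0 < δ) :
    Pr.real {ω | A n ω ∈ S ∧ δ ≤ ‖WithLp.toLp 2 ((T (A n ω)).mulVec fun i => ε i j ω)‖}
      ≤ M.Ψ j * c ^ 2 / δ ^ 2 := by
  have hW := H.noise.isWhiteNoise hj
  have hI : IndepFun (fun ω => bits (A n ω)) (fun ω (i : Fin n) => ε i j ω) Pr := by
    have h : Measurable fun (x : Fin n → Fin (M.p n) → ℝ) (i : Fin n) => x i ⟨j, hj⟩ :=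
      measurable_pi_lambda _ fun i => (measurable_pi_apply _).comp (measurable_pi_apply i)
    exact (H.indep n).comp measurable_bits h
  have hm := measurable_comp_of_isAdjacency (h2 n) (H.network.measurable n) bits
  have key := measureReal_le_of_indepFun (c := M.Ψ j * c ^ 2 / δ ^ 2) hm hI
    (E := fun b => {_x | ofBits b ∈ S} ∩
      {x | δ ≤ ‖WithLp.toLp 2 ((T (ofBits b)).mulVec x)‖})
    (fun b => ?_) fun b => ?_
  · simpa only [Set.mem_inter_iff, Set.mem_ofPred_eq, (h2 n _).ofBits_bits] using key
  · refine MeasurableSet.inter (MeasurableSet.const _) (measurableSet_le measurable_const ?_)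
    refine Continuous.measurable ?_
    exact ((PiLp.continuous_toLp 2 _).comp (Continuous.matrix_mulVec continuous_const
      continuous_id)).norm
  · by_cases hb : ofBits b ∈ S
    · simp only [Set.mem_inter_iff, Set.mem_ofPred_eq, hb, true_and]
      refine (hW.measureReal_le_norm_mulVec _ hδ).trans ?_
      have := hT _ hb
      have := fro_nonneg (T (ofBits b))
      gcongr
    · have : {ω | (fun i : Fin n => ε i j ω) ∈ {_x | ofBits b ∈ S} ∩
          {x | δ ≤ ‖WithLp.toLp 2 ((T (ofBits b)).mulVec x)‖}} = ∅ := by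
        ext ω
        simp [hb]
      rw [this, measureReal_empty]
      positivity

end Probability

/-! ### Decomposition of the regression error -/

section Regression

variable {Ω : Type*} {k1 k2 k3 n : ℕ} {M : Params k1 k2 k3} {ε : ℕ → ℕ → Ω → ℝ}

theorem norm_toLp_mulVec_le {m p : Type} [Fintype m] [Fintype p] (N : Matrix m p ℝ) (v : p → ℝ) :
    ‖WithLp.toLp 2 (N.mulVec v)‖ ≤ fro N * ‖WithLp.toLp 2 v‖ := by
  rw [norm_eq_fro_replicateCol, norm_eq_fro_replicateCol]
  simp only
  rw [Matrix.replicateCol_mulVec]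
  exact fro_mul_le _ _

theorem Params.Z23_mul_transpose (M : Params k1 k2 k3) (n : ℕ) :
    M.Z23 n * (M.Λ n).transpose
      = M.Z12 n * (M.Λ12 n).transpose + M.Z3 n * (M.Λ3 n).transpose := by
  simp [Params.Z23, Params.Z12, Params.Λ, Params.Λ12, Matrix.transpose_fromCols,
    Matrix.fromCols_mul_fromRows]

theorem transpose_mul_const_of_centered (hn : n ≠ 0) {D p : Type*} [Fintype D]
    {F : Matrix (Fin n) D ℝ} (hF : centering n * F = F) (m : p → ℝ) :
    F.transpose * Matrix.of (fun (_ : Fin n) b => m b) = 0 := by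
  have hJ : F.transpose * centering n = F.transpose := by
    rw [← centering_transpose, ← Matrix.transpose_mul, hF]
  have h1 : centering n * Matrix.of (fun (_ : Fin n) b => m b) = 0 := by
    ext i b
    rw [centering_mul_apply]
    simp [hn]
  rw [← hJ, Matrix.mul_assoc, h1, Matrix.mul_zero]

/-- The regression error is the noise response plus bias plus leakage. -/
theorem ols_sub (hn : n ≠ 0) {F : Matrix (Fin n) (Fin k1 ⊕ Fin k2) ℝ}
    (hF : centering n * F = F) (hinv : (F.transpose * F)⁻¹ * (F.transpose * F) = 1) (ω : Ω) :
    (ols F (M.Y ε n ω) - M.Λ12 n).transpose =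
      (F.transpose * F)⁻¹ * F.transpose * Matrix.of (fun (i : Fin n) (j : Fin (M.p n)) => ε i j ω)
      + (F.transpose * F)⁻¹ * (F.transpose * (M.Z12 n - F)) * (M.Λ12 n).transpose
      + (F.transpose * F)⁻¹ * (F.transpose * M.Z3 n) * (M.Λ3 n).transpose := by
  have hJ : F.transpose * centering n = F.transpose := by
    rw [← centering_transpose, ← Matrix.transpose_mul, hF]
  rw [ols, Matrix.transpose_sub, Matrix.transpose_transpose, Matrix.mul_assoc, ← Matrix.mul_assoc
    F.transpose, hJ, Params.Y, Matrix.mul_add, Matrix.mul_add F.transpose, transpose_mul_const_of_centered hn hF,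
    zero_add, Params.Z23_mul_transpose, Matrix.mul_sub, Matrix.mul_sub, hinv, Matrix.sub_mul,
    Matrix.one_mul]
  simp only [Matrix.mul_add, Matrix.mul_assoc]
  abel

theorem scaledError_ols (hn : n ≠ 0) {F : Matrix (Fin n) (Fin k1 ⊕ Fin k2) ℝ}
    (hF : centering n * F = F) (hinv : (F.transpose * F)⁻¹ * (F.transpose * F) = 1) {j : ℕ}
    (hj : j < M.p n) (ω : Ω) :
    scaledError M n (ols F (M.Y ε n ω)) j =
      WithLp.toLp 2 ((√(n : ℝ) • ((F.transpose * F)⁻¹ * F.transpose)).mulVec fun i => ε i j ω)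
      + (WithLp.toLp 2 ((√(n : ℝ) • ((F.transpose * F)⁻¹ * (F.transpose * (M.Z12 n - F)))).mulVec
          (M.Λ12 n ⟨j, hj⟩))
        + WithLp.toLp 2 ((√(n : ℝ) • ((F.transpose * F)⁻¹ * (F.transpose * M.Z3 n))).mulVec
          (M.Λ3 n ⟨j, hj⟩))) := by
  have h := ols_sub (M := M) (ε := ε) hn hF hinv ω
  ext a
  have h' := congrFun (congrFun h a) ⟨j, hj⟩
  rw [Matrix.transpose_apply, Matrix.sub_apply] at h'
  simp only [scaledError, hj, dif_pos, h', PiLp.add_apply, Matrix.smul_mulVec, Pi.smul_apply,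
    smul_eq_mul, Matrix.add_apply, Matrix.mul_apply, Matrix.mulVec, dotProduct, Matrix.of_apply,
    Matrix.transpose_apply]
  ring

end Regression

/-! ### Comparison with the oracle regression -/

section Consistency

variable {Ω : Type*} [MeasurableSpace Ω] {Pr : Measure Ω} [IsProbabilityMeasure Pr]
  {k1 k2 k3 : ℕ} {M : Params k1 k2 k3} {A : (n : ℕ) → Ω → Matrix (Fin n) (Fin n) ℝ}
  {ε : ℕ → ℕ → Ω → ℝ}

/-- The linear part of the regression on the true factors. -/
noncomputable def linearError (M : Params k1 k2 k3) (ε : ℕ → ℕ → Ω → ℝ) (j n : ℕ) (ω : Ω) :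
    EuclideanSpace ℝ (Fin k1 ⊕ Fin k2) :=
  WithLp.toLp 2 ((√(n : ℝ) • (((M.Z12 n).transpose * M.Z12 n)⁻¹ * (M.Z12 n).transpose)).mulVec
    fun i => ε i j ω)

theorem aemeasurable_scaledError (hmodel : IsModel Pr M A ε) (h2 : AssumptionII A)
    (F : (n : ℕ) → Matrix (Fin n) (Fin n) ℝ → Matrix (Fin n) (Fin k1 ⊕ Fin k2) ℝ) (n j : ℕ) :
    AEMeasurable (fun ω => scaledError M n (ols (F n (A n ω)) (M.Y ε n ω)) j) Pr := by
  refine (WithLp.measurable_toLp 2 _).comp_aemeasurable (aemeasurable_pi_lambda _ fun a => ?_)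
  by_cases hj : j < M.p n
  · simp only [hj, dif_pos]
    refine AEMeasurable.const_mul (AEMeasurable.sub_const ?_ _) _
    have hols : ∀ ω, ols (F n (A n ω)) (M.Y ε n ω) ⟨j, hj⟩ a
        = ∑ i, (((F n (A n ω)).transpose * F n (A n ω))⁻¹ * (F n (A n ω)).transpose) a i
          * (centering n * M.Y ε n ω) i ⟨j, hj⟩ := fun ω => by
      rw [ols, Matrix.transpose_apply, Matrix.mul_apply]
    simp only [hols]
    refine Finset.aemeasurable_fun_sum _ fun i _ => AEMeasurable.mul ?_ ?_
    · exact (measurable_comp_of_isAdjacency (h2 n) (hmodel.network.measurable n)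
        fun B => (((F n B).transpose * F n B)⁻¹ * (F n B).transpose) a i).aemeasurable
    · simp only [Matrix.mul_apply]
      refine Finset.aemeasurable_fun_sum _ fun k _ => AEMeasurable.const_mul ?_ _
      simp only [Params.Y, Matrix.add_apply, Matrix.of_apply]
      exact (hmodel.noise.memLp n k ⟨j, hj⟩).aestronglyMeasurable.aemeasurable.const_add _
  · simp only [hj, dif_neg, not_false_eq_true]
    exact aemeasurable_const

variable {S₀ : Matrix (Fin k1 ⊕ Fin k2) (Fin k1 ⊕ Fin k2) ℝ}
  {X : ∀ n, Matrix (Fin n) (Fin k1 ⊕ Fin k2) ℝ}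

theorem IsDesign.gram_sqrt_atTop {P : ∀ n, Matrix (Fin n) (Fin n) ℝ} {D l : Type} [Fintype D]
    [DecidableEq D] [Fintype l] {X Z : ∀ n, Matrix (Fin n) D ℝ} {Z' : ∀ n, Matrix (Fin n) l ℝ}
    {S₀ : Matrix D D ℝ} (H : IsDesign P X Z Z' S₀) :
    Tendsto (fun n : ℕ => (√(n : ℝ) ^ 2)⁻¹ • ((Z n).transpose * Z n)) atTop (𝓝 S₀) := by
  simpa only [Real.sq_sqrt (Nat.cast_nonneg _)] using H.gram

theorem IsDesign.exists_fro_sq_le {P : ∀ n, Matrix (Fin n) (Fin n) ℝ} {D l : Type} [Fintype D]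
    [DecidableEq D] [Fintype l] {X Z : ∀ n, Matrix (Fin n) D ℝ} {Z' : ∀ n, Matrix (Fin n) l ℝ}
    {S₀ : Matrix D D ℝ} (H : IsDesign P X Z Z' S₀) :
    ∃ c : ℝ, 1 ≤ c ∧ (∀ᶠ n : ℕ in atTop, fro (X n) ^ 2 ≤ c * n) ∧
      ∀ᶠ n : ℕ in atTop, fro (Matrix.fromCols (Z n) (Z' n)) ^ 2 ≤ c * n := by
  obtain ⟨c, hc⟩ := H.bound'
  refine ⟨4 + |c|, by linarith [abs_nonneg c], ?_, ?_⟩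
  · filter_upwards [H.factor] with n hn
    refine (fro_sq_of_factor (H.prob n) hn).trans (le_mul_of_one_le_left (Nat.cast_nonneg n) ?_)
    linarith [abs_nonneg c]
  · filter_upwards [H.factor, H.center, hc] with n h1 h2 h3
    have h4 := fro_sq_of_factor (H.prob n) h1
    have h5 : fro (Z n) ^ 2 ≤ (2 * fro (X n)) ^ 2 := by
      rw [← h2]
      exact pow_le_pow_left₀ (fro_nonneg _) (fro_centering_mul_le (X n)) 2
    have h6 : c * n ≤ |c| * n := mul_le_mul_of_nonneg_right (le_abs_self c) (Nat.cast_nonneg n)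
    rw [fro_fromCols_sq]
    linarith

/-- On the true factors there is no bias, and Z₁₂ᵀ Z₃ = 0 excludes leakage, so the oracle error is
exactly linear in the noise. -/
theorem eventually_scaledError_eq_linearError (H : IsDesign M.P X M.Z12 M.Z3 S₀) {j : ℕ}
    (hj : ∀ᶠ n in atTop, j < M.p n) :
    ∀ᶠ n in atTop, ∀ ω : Ω,
      scaledError M n (ols (M.Z12 n) (M.Y ε n ω)) j = linearError M ε j n ω := by
  filter_upwards [hj, H.centered, H.ortho, eventually_ne_atTop 0,
    eventually_inv_mul H.gram_sqrt_atTop H.nonsing] with n h1 h2 h3 h4 h5 ω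
  rw [scaledError_ols h4 h2 h5 h1, h3]
  simp [linearError]

/-- Atypical networks cost probability η / 2. On typical ones the scaled bias and leakage are
deterministically O(n^(-1/2)), and the scaled change of the noise response has second moment O(1/n).
-/
theorem tendstoInMeasure_scaledError_sub_linearError (hmodel : IsModel Pr M A ε)
    (h2 : AssumptionII A) (H : IsDesign M.P X M.Z12 M.Z3 S₀) {j : ℕ}
    (hj : ∀ᶠ n in atTop, j < M.p n) (hΨ : 0 ≤ M.Ψ j) {C₁ : ℝ}
    (hΛ : ∀ n (h : j < M.p n), ‖WithLp.toLp 2 (M.Λ12 n ⟨j, h⟩)‖ ≤ C₁ ∧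
      ‖WithLp.toLp 2 (M.Λ3 n ⟨j, h⟩)‖ ≤ C₁)
    {F : (n : ℕ) → Matrix (Fin n) (Fin n) ℝ → Matrix (Fin n) (Fin k1 ⊕ Fin k2) ℝ}
    (hF : ∀ᶠ n in atTop, ∀ B, IsAdjacency B → centering n * F n B = F n B)
    (hclose : ∀ K, ∃ C, ∀ᶠ n : ℕ in atTop, ∀ B ∈ typicalSet M.P X M.Z12 M.Z3 K n,
      IsCloseRegressor (M.Z12 n) (M.Z3 n) (F n B) (C / n)) :
    TendstoInMeasure Pr
      ((fun n ω => scaledError M n (ols (F n (A n ω)) (M.Y ε n ω)) j) - linearError M ε j) atTop 0 := by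
  rw [tendstoInMeasure_iff_measureReal_norm]
  intro δ hδ
  refine tendsto_order.2 ⟨fun a ha => Eventually.of_forall fun n => ha.trans_le measureReal_nonneg,
    fun η hη => ?_⟩
  obtain ⟨c, hc1, hcX, hcZ⟩ := H.exists_fro_sq_le
  obtain ⟨K, hK⟩ := hmodel.network.eventually_isTypical h2 hc1 hcX hcZ (half_pos hη)
  obtain ⟨C, hC⟩ := hclose K
  have hrate : Tendsto (fun n : ℕ => √(n : ℝ) * (C / n)) atTop (𝓝 0) := by
    have h : Tendsto (fun n : ℕ => C / √(n : ℝ)) atTop (𝓝 0) :=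
      tendsto_const_nhds.div_atTop (Real.tendsto_sqrt_atTop.comp tendsto_natCast_atTop_atTop)
    refine h.congr fun n => ?_
    rw [mul_div_left_comm, Real.sqrt_div_self', mul_one_div]
  have hbias : ∀ᶠ n : ℕ in atTop, √(n : ℝ) * (C / n) * C₁ + √(n : ℝ) * (C / n) * C₁ < δ / 2 := by
    have h := (hrate.mul_const C₁).add (hrate.mul_const C₁)
    rw [zero_mul, add_zero] at h
    exact h.eventually_lt_const (half_pos hδ)
  have hvar : ∀ᶠ n : ℕ in atTop, M.Ψ j * (√(n : ℝ) * (C / n)) ^ 2 / (δ / 2) ^ 2 < η / 2 := by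
    have h := ((hrate.pow 2).const_mul (M.Ψ j)).div_const ((δ / 2) ^ 2)
    rw [zero_pow two_ne_zero, mul_zero, zero_div] at h
    exact h.eventually_lt_const (half_pos hη)
  filter_upwards [hK, hC, hbias, hvar, hj, hF, eventually_ne_atTop 0]
    with n hK hC hbias hvar hj hF hn
  set T : Matrix (Fin n) (Fin n) ℝ → Matrix (Fin k1 ⊕ Fin k2) (Fin n) ℝ := fun B =>
    √(n : ℝ) • (((F n B).transpose * F n B)⁻¹ * (F n B).transpose
      - ((M.Z12 n).transpose * M.Z12 n)⁻¹ * (M.Z12 n).transpose) with hT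
  set S := typicalSet M.P X M.Z12 M.Z3 K n with hS
  have hscale : ∀ {m p : Type} [Fintype m] [Fintype p] (N : Matrix m p ℝ), fro N ≤ C / n →
      fro (√(n : ℝ) • N) ≤ √(n : ℝ) * (C / n) := fun N hN => by
    rw [fro_smul, abs_of_nonneg (Real.sqrt_nonneg _)]
    exact mul_le_mul_of_nonneg_left hN (Real.sqrt_nonneg _)
  have hTS : ∀ B ∈ S, fro (T B) ≤ √(n : ℝ) * (C / n) := fun B hB => hscale _ (hC B hB).response
  have hP := hmodel.measureReal_mem_and_le h2 hj S T hΨ hTS (half_pos hδ)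
  refine lt_of_le_of_lt (measureReal_mono (s₂ := {ω | ¬ IsTypical (M.P n) (X n)
    (Matrix.fromCols (M.Z12 n) (M.Z3 n)) K (A n ω)} ∪ {ω | A n ω ∈ S ∧
      δ / 2 ≤ ‖WithLp.toLp 2 ((T (A n ω)).mulVec fun i => ε i j ω)‖}) ?_)
    ((measureReal_union_le _ _).trans_lt (by linarith))
  intro ω hω
  by_cases htyp : IsTypical (M.P n) (X n) (Matrix.fromCols (M.Z12 n) (M.Z3 n)) K (A n ω)
  swap
  · exact Or.inl htyp
  refine Or.inr ⟨⟨h2 n ω, htyp⟩, ?_⟩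
  have hB : A n ω ∈ S := ⟨h2 n ω, htyp⟩
  have hreg := hC _ hB
  have hω' : δ ≤ ‖scaledError M n (ols (F n (A n ω)) (M.Y ε n ω)) j - linearError M ε j n ω‖ := by
    simpa using hω
  rw [scaledError_ols hn (hF _ (h2 n ω)) hreg.inv_mul hj, linearError, add_sub_right_comm,
    ← WithLp.toLp_sub, ← Matrix.sub_mulVec, ← smul_sub] at hω'
  have hb : ∀ {p : Type} [Fintype p] (N : Matrix (Fin k1 ⊕ Fin k2) p ℝ) (v : p → ℝ),
      fro N ≤ C / n → ‖WithLp.toLp 2 v‖ ≤ C₁ →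
      ‖WithLp.toLp 2 ((√(n : ℝ) • N).mulVec v)‖ ≤ √(n : ℝ) * (C / n) * C₁ := fun N v hN hv =>
    (norm_toLp_mulVec_le _ _).trans (mul_le_mul (hscale N hN) hv (norm_nonneg _)
      ((fro_nonneg _).trans (hscale N hN)))
  have h3 := hω'.trans (norm_add_le _ _)
  have h4 := h3.trans (add_le_add_right ((norm_add_le _ _).trans
    (add_le_add (hb _ _ hreg.bias (hΛ n hj).1) (hb _ _ hreg.leakage (hΛ n hj).2))) _)
  linarith

end Consistency

/-! ### Central limit theorem for weighted sums -/

section Gaussian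

/-- Telescoping: the factors are exchanged one at a time, the others having norm at most one. -/
theorem norm_prod_sub_prod_le {ι : Type*} (s : Finset ι) {f g : ι → ℂ} (hf : ∀ i, ‖f i‖ ≤ 1)
    (hg : ∀ i, ‖g i‖ ≤ 1) : ‖∏ i ∈ s, f i - ∏ i ∈ s, g i‖ ≤ ∑ i ∈ s, ‖f i - g i‖ := by
  classical
  induction s using Finset.induction_on with
  | empty => simp
  | insert a s ha ih =>
    rw [Finset.prod_insert ha, Finset.prod_insert ha, Finset.sum_insert ha]
    have h1 : f a * ∏ i ∈ s, f i - g a * ∏ i ∈ s, g i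
        = (f a - g a) * ∏ i ∈ s, f i + g a * (∏ i ∈ s, f i - ∏ i ∈ s, g i) := by ring
    have h2 : ‖∏ i ∈ s, f i‖ ≤ 1 := by
      rw [norm_prod]
      exact Finset.prod_le_one (fun i _ => norm_nonneg _) fun i _ => hf i
    rw [h1]
    refine (norm_add_le _ _).trans (add_le_add ?_ ?_)
    · rw [norm_mul]
      exact mul_le_of_le_one_right (norm_nonneg _) h2
    · rw [norm_mul]
      exact (mul_le_of_le_one_left (norm_nonneg _) (hg a)).trans ih

variable {Ω : Type*} [MeasurableSpace Ω] {Pr : Measure Ω} [IsProbabilityMeasure Pr]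
  {ξ : ℕ → Ω → ℝ} {v : ℝ}

namespace IsWhiteNoise

theorem aemeasurable (H : IsWhiteNoise Pr ξ v) (i : ℕ) : AEMeasurable (ξ i) Pr :=
  (H.ident i).aemeasurable_fst

/-- Near the origin the characteristic function is that of a normal law to second order. -/
theorem charFun_sub_exp_isLittleO (H : IsWhiteNoise Pr ξ v) (hv : 0 < v) :
    (fun s : ℝ => charFun (Pr.map (ξ 0)) s - Complex.exp (-(v * s ^ 2 / 2 : ℝ)))
      =o[𝓝 0] fun s => s ^ 2 := by
  have hs : 0 < √v := Real.sqrt_pos.2 hv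
  have hvs : √v ^ 2 = v := Real.sq_sqrt hv.le
  -- The Taylor expansion is available for unit variance; the argument is scaled back by √v
  -- afterwards.
  have h1 := taylor_charFun_two (P := Pr) (X := fun ω => (√v)⁻¹ * ξ 0 ω)
    ((H.aemeasurable 0).const_mul _) (by rw [integral_const_mul, H.mean, mul_zero]) (by
      have h : (fun ω => (√v)⁻¹ * ξ 0 ω) ^ 2 = fun ω => v⁻¹ * (ξ 0 ω * ξ 0 ω) := by
        funext ω
        rw [Pi.pow_apply, mul_pow, inv_pow, hvs, pow_two (ξ 0 ω)]
      rw [h, integral_const_mul, H.var, inv_mul_cancel₀ hv.ne'])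
  have hlim : Tendsto (fun s : ℝ => √v * s) (𝓝 0) (𝓝 0) := by
    have := (continuous_const_mul (√v)).tendsto (0 : ℝ)
    rwa [mul_zero] at this
  have h2 := h1.comp_tendsto hlim
  have h3 : (fun s : ℝ => charFun (Pr.map (ξ 0)) s - (1 - (v * s ^ 2 / 2 : ℝ)))
      =o[𝓝 0] fun s => s ^ 2 := by
    refine (h2.congr (fun s => ?_) fun s => ?_).of_const_mul_right (c := v)
    · simp only [Function.comp_apply]
      rw [charFun_map_mul_comp (H.aemeasurable 0), inv_mul_cancel_left₀ hs.ne']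
      have h : ((√v : ℝ) : ℂ) ^ 2 = v := by exact_mod_cast hvs
      push_cast
      rw [mul_pow, h]
    · simp only [Function.comp_apply]
      rw [mul_pow, hvs]
  have h4 : (fun s : ℝ => (1 - (v * s ^ 2 / 2 : ℝ) : ℂ) - Complex.exp (-(v * s ^ 2 / 2 : ℝ)))
      =o[𝓝 0] fun s => s ^ 2 := by
    have hsq : Tendsto (fun s : ℝ => -(v * s ^ 2 / 2)) (𝓝 0) (𝓝 0) := by
      have : Continuous fun s : ℝ => -(v * s ^ 2 / 2) := by fun_prop
      simpa using this.tendsto 0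
    have h5 : (fun s : ℝ => (1 - (v * s ^ 2 / 2 : ℝ) : ℂ) - Complex.exp (-(v * s ^ 2 / 2 : ℝ)))
        =O[𝓝 0] fun s => (-(v * s ^ 2 / 2)) ^ 2 := by
      refine Asymptotics.IsBigO.of_bound 1 ?_
      filter_upwards [hsq.eventually (Metric.closedBall_mem_nhds 0 one_pos)] with s hs
      have hs' : |-(v * s ^ 2 / 2)| ≤ 1 := by
        rwa [dist_zero_right, Real.norm_eq_abs] at hs
      have h6 := Real.abs_exp_sub_one_sub_id_le hs'
      have h7 : (1 - (v * s ^ 2 / 2 : ℝ) : ℂ) - Complex.exp (-(v * s ^ 2 / 2 : ℝ))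
          = ((-(Real.exp (-(v * s ^ 2 / 2)) - 1 - -(v * s ^ 2 / 2)) : ℝ) : ℂ) := by
        push_cast
        ring
      rw [h7, Complex.norm_real, Real.norm_eq_abs, abs_neg, one_mul, Real.norm_eq_abs, abs_sq]
      exact h6
    refine h5.trans_isLittleO ?_
    have h8 : (fun s : ℝ => (-(v * s ^ 2 / 2)) ^ 2) = fun s => (v ^ 2 / 4 * s ^ 2) * s ^ 2 := by
      funext s
      ring
    rw [h8]
    have h9 : (fun s : ℝ => v ^ 2 / 4 * s ^ 2) =o[𝓝 0] fun _ => (1 : ℝ) := by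
      rw [Asymptotics.isLittleO_one_iff]
      have : Continuous fun s : ℝ => v ^ 2 / 4 * s ^ 2 := by fun_prop
      simpa using this.tendsto 0
    simpa using h9.mul_isBigO (Asymptotics.isBigO_refl (fun s : ℝ => s ^ 2) (𝓝 0))
  refine (h3.add h4).congr_left fun s => ?_
  ring

/-- Each factor is replaced by its Gaussian counterpart at a cost o(w²), uniformly since the weights
are uniformly small. The total cost is o(1) because the sums of w² stay bounded. -/
theorem tendsto_prod_charFun (H : IsWhiteNoise Pr ξ v) (hv : 0 < v) {w : ∀ n : ℕ, Fin n → ℝ}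
    (hsmall : ∀ δ > 0, ∀ᶠ n in atTop, ∀ i, |w n i| ≤ δ) {q : ℝ}
    (hq : Tendsto (fun n => ∑ i, w n i ^ 2) atTop (𝓝 q)) :
    Tendsto (fun n => ∏ i, charFun (Pr.map (ξ 0)) (w n i)) atTop
      (𝓝 (Complex.exp (-(v * q / 2 : ℝ)))) := by
  have hprob : IsProbabilityMeasure (Pr.map (ξ 0)) :=
    Measure.isProbabilityMeasure_map (H.aemeasurable 0)
  have h1 : ∀ n, ∏ i, Complex.exp (-(v * w n i ^ 2 / 2 : ℝ))
      = Complex.exp (-(v * ∑ i, w n i ^ 2) / 2 : ℝ) := by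
    intro n
    rw [← Complex.exp_sum]
    congr 1
    push_cast
    rw [Finset.sum_neg_distrib, ← Finset.sum_div, ← Finset.mul_sum, neg_div]
  have h2 : Tendsto (fun n => ∏ i, Complex.exp (-(v * w n i ^ 2 / 2 : ℝ))) atTop
      (𝓝 (Complex.exp (-(v * q / 2 : ℝ)))) := by
    simp only [h1]
    have h3 : Tendsto (fun n => -(v * ∑ i, w n i ^ 2) / 2) atTop (𝓝 (-(v * q / 2))) := by
      rw [← neg_div]
      exact ((hq.const_mul v).neg).div_const 2
    have h4 := (Complex.continuous_exp.comp Complex.continuous_ofReal).tendsto (-(v * q / 2))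
    simpa [Function.comp_def] using h4.comp h3
  have h5 : Tendsto (fun n => ∏ i, charFun (Pr.map (ξ 0)) (w n i)
      - ∏ i, Complex.exp (-(v * w n i ^ 2 / 2 : ℝ))) atTop (𝓝 0) := by
    rw [Metric.tendsto_nhds]
    intro η hη
    have hq0 : 0 ≤ q := ge_of_tendsto' hq fun n => Finset.sum_nonneg fun i _ => sq_nonneg _
    -- The sum of the squared weights is eventually below q + 1.
    have hη' : 0 < η / (q + 1) := by positivity
    have h6 := (H.charFun_sub_exp_isLittleO hv).bound hη'
    obtain ⟨δ, hδ, hball⟩ := Metric.eventually_nhds_iff.1 h6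
    filter_upwards [hsmall (δ / 2) (half_pos hδ), hq.eventually_lt_const (lt_add_one q)]
      with n h7 h8
    rw [dist_zero_right]
    calc _ ≤ ∑ i, ‖charFun (Pr.map (ξ 0)) (w n i) - Complex.exp (-(v * w n i ^ 2 / 2 : ℝ))‖ := by
          refine norm_prod_sub_prod_le _ (fun i => norm_charFun_le_one _) fun i => ?_
          rw [← Complex.ofReal_neg, Complex.norm_exp_ofReal, Real.exp_le_one_iff]
          have : 0 ≤ v * w n i ^ 2 := by positivity
          linarith
      _ ≤ ∑ i, η / (q + 1) * w n i ^ 2 := by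
          refine Finset.sum_le_sum fun i _ => ?_
          have h9 := hball (y := w n i) (by
            rw [Real.dist_eq, sub_zero]; exact (h7 i).trans_lt (half_lt_self hδ))
          simpa using h9
      _ = η / (q + 1) * ∑ i, w n i ^ 2 := by rw [Finset.mul_sum]
      _ < η / (q + 1) * (q + 1) := mul_lt_mul_of_pos_left h8 hη'
      _ = η := div_mul_cancel₀ _ (by positivity)
  simpa using h5.add h2

theorem aemeasurable_mulVec (H : IsWhiteNoise Pr ξ v) {D : Type*} [Fintype D] {n : ℕ}
    (W : Matrix D (Fin n) ℝ) :
    AEMeasurable (fun ω => WithLp.toLp 2 (W.mulVec fun i => ξ i ω)) Pr := by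
  refine (WithLp.measurable_toLp 2 _).comp_aemeasurable (aemeasurable_pi_lambda _ fun a => ?_)
  simp only [Matrix.mulVec, dotProduct]
  exact Finset.aemeasurable_fun_sum _ fun i _ => (H.aemeasurable i).const_mul _

/-- Pairing with t reduces the vector to a scalar sum of independent terms with weights Wᵀ t, as in
the Cramér–Wold device. -/
theorem charFun_mulVec (H : IsWhiteNoise Pr ξ v) {D : Type*} [Fintype D] {n : ℕ}
    (W : Matrix D (Fin n) ℝ) (t : EuclideanSpace ℝ D) :
    charFun (Pr.map fun ω => WithLp.toLp 2 (W.mulVec fun i => ξ i ω)) t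
      = ∏ i, charFun (Pr.map (ξ 0)) (W.transpose.mulVec t.ofLp i) := by
  set w := W.transpose.mulVec t.ofLp with hw
  have h1 : ∀ ω, inner ℝ (WithLp.toLp 2 (W.mulVec fun i : Fin n => ξ i ω)) t
      = ∑ i, w i * ξ i ω := by
    intro ω
    rw [EuclideanSpace.inner_eq_star_dotProduct, star_trivial, Matrix.dotProduct_mulVec,
      ← Matrix.mulVec_transpose, dotProduct]
  have hind : iIndepFun (fun (i : Fin n) ω => w i * ξ i ω) Pr :=
    (H.indep.precomp Fin.val_injective).comp (fun i x => w i * x) fun i => measurable_const_mul _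
  have hm : ∀ i : Fin n, AEMeasurable (fun ω => w i * ξ i ω) Pr :=
    fun i => (H.aemeasurable i).const_mul _
  have h2 : charFun (Pr.map fun ω => WithLp.toLp 2 (W.mulVec fun i : Fin n => ξ i ω)) t
      = charFun (Pr.map fun ω => ∑ i : Fin n, w i * ξ i ω) 1 := by
    rw [charFun_apply, charFun_apply_real, integral_map (H.aemeasurable_mulVec W) (by fun_prop),
      integral_map (Finset.aemeasurable_fun_sum _ fun i _ => hm i) (by fun_prop)]
    simp only [h1, Complex.ofReal_one, one_mul]
  rw [h2, hind.charFun_map_fun_sum_eq_prod hm, Finset.prod_apply]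
  refine Finset.prod_congr rfl fun i _ => ?_
  rw [charFun_map_mul_comp (H.aemeasurable i), mul_one, (H.ident i).map_eq]

/-- Multivariate central limit theorem for weighted sums of white noise with negligible weights. -/
theorem tendstoInDistribution_mulVec (H : IsWhiteNoise Pr ξ v) (hv : 0 < v) {D : Type*}
    [Fintype D] [DecidableEq D] {W : ∀ n, Matrix D (Fin n) ℝ} {S : Matrix D D ℝ}
    (hS : S.PosSemidef) (hW : Tendsto (fun n => W n * (W n).transpose) atTop (𝓝 S))
    (hsmall : ∀ δ > 0, ∀ᶠ n in atTop, ∀ a i, |W n a i| ≤ δ) :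
    TendstoInDistribution (fun n ω => WithLp.toLp 2 ((W n).mulVec fun i => ξ i ω)) atTop id
      (fun _ => Pr) (multivariateGaussian 0 (v • S)) where
  forall_aemeasurable n := H.aemeasurable_mulVec (W n)
  tendsto := by
    refine ProbabilityMeasure.tendsto_iff_tendsto_charFun.2 fun t => ?_
    simp only [ProbabilityMeasure.coe_mk, Measure.map_id]
    simp only [H.charFun_mulVec]
    rw [charFun_multivariateGaussian (hS.smul hv.le)]
    have hsum : Tendsto (fun n => ∑ i, (W n).transpose.mulVec t.ofLp i ^ 2) atTop
        (𝓝 (t.ofLp ⬝ᵥ S.mulVec t.ofLp)) := by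
      have h1 : ∀ n, ∑ i, (W n).transpose.mulVec t.ofLp i ^ 2
          = t.ofLp ⬝ᵥ (W n * (W n).transpose).mulVec t.ofLp := by
        intro n
        rw [← Matrix.mulVec_mulVec, Matrix.dotProduct_mulVec, ← Matrix.mulVec_transpose, dotProduct]
        simp only [pow_two]
      simp only [h1]
      have hc : Continuous fun N : Matrix D D ℝ => t.ofLp ⬝ᵥ N.mulVec t.ofLp := by
        simp only [Matrix.mulVec, dotProduct]
        fun_prop
      exact (hc.tendsto S).comp hW
    have hweights : ∀ δ > 0, ∀ᶠ n in atTop, ∀ i, |(W n).transpose.mulVec t.ofLp i| ≤ δ := by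
      intro δ hδ
      have hT : 0 < ∑ a, |t a| + 1 := by positivity
      filter_upwards [hsmall (δ / (∑ a, |t a| + 1)) (by positivity)] with n hn i
      simp only [Matrix.mulVec, dotProduct, Matrix.transpose_apply]
      calc _ ≤ ∑ a, |W n a i * t a| := Finset.abs_sum_le_sum_abs _ _
        _ ≤ ∑ a, δ / (∑ a, |t a| + 1) * |t a| := Finset.sum_le_sum fun a _ => by
            rw [abs_mul]; exact mul_le_mul_of_nonneg_right (hn a i) (abs_nonneg _)
        _ = δ / (∑ a, |t a| + 1) * ∑ a, |t a| := by rw [Finset.mul_sum]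
        _ ≤ δ / (∑ a, |t a| + 1) * (∑ a, |t a| + 1) :=
            mul_le_mul_of_nonneg_left (by linarith) (by positivity)
        _ = δ := div_mul_cancel₀ _ hT.ne'
    convert H.tendsto_prod_charFun hv hweights hsum using 2
    simp [Matrix.smul_mulVec, dotProduct_smul]

end IsWhiteNoise

end Gaussian

/-! ### The weights of the oracle regression -/

section Oracle

variable {D l : Type} [Fintype D] [DecidableEq D] [Fintype l]
  {P : ∀ n, Matrix (Fin n) (Fin n) ℝ} {X Z : ∀ n, Matrix (Fin n) D ℝ}
  {Z' : ∀ n, Matrix (Fin n) l ℝ} {S₀ : Matrix D D ℝ}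

/-- The squared norm of a row is a diagonal entry of Q, a probability. This boundedness takes the
place of a Lindeberg condition on the factors. -/
theorem abs_apply_le_one_of_factor {n : ℕ} {Q : Matrix (Fin n) (Fin n) ℝ} {Y : Matrix (Fin n) D ℝ}
    (hQ : ∀ i j, Q i j ∈ Set.Icc (0 : ℝ) 1) (h : Q = Y * Y.transpose) (i : Fin n) (a : D) :
    |Y i a| ≤ 1 := by
  rw [← sq_le_one_iff_abs_le_one]
  refine le_trans ?_ (hQ i i).2
  rw [h, Matrix.mul_apply, pow_two]
  exact Finset.single_le_sum (f := fun b => Y i b * Y.transpose b i)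
    (fun b _ => mul_self_nonneg (Y i b)) (Finset.mem_univ a)

theorem abs_centering_mul_apply_le {n : ℕ} {Y : Matrix (Fin n) D ℝ} (hY : ∀ i a, |Y i a| ≤ 1)
    (i : Fin n) (a : D) : |(centering n * Y) i a| ≤ 2 := by
  rw [centering_mul_apply]
  have hn : (0 : ℝ) < n := by exact_mod_cast i.pos
  have h1 : |∑ k, Y k a| ≤ n := by
    refine (Finset.abs_sum_le_sum_abs _ _).trans ((Finset.sum_le_sum fun k _ => hY k a).trans ?_)
    simp
  have h2 : |(n : ℝ)⁻¹ * ∑ k, Y k a| ≤ 1 := by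
    rw [abs_mul, abs_of_pos (inv_pos.2 hn)]
    exact (mul_le_mul_of_nonneg_left h1 (inv_pos.2 hn).le).trans
      (le_of_eq (inv_mul_cancel₀ hn.ne'))
  have h3 := hY i a
  exact (abs_sub _ _).trans (by linarith)

namespace IsDesign

/-- The product collapses to n (Zᵀ Z)⁻¹. -/
theorem tendsto_weights_mul_transpose (H : IsDesign P X Z Z' S₀) :
    Tendsto (fun n : ℕ => (√(n : ℝ) • (((Z n).transpose * Z n)⁻¹ * (Z n).transpose))
      * (√(n : ℝ) • (((Z n).transpose * Z n)⁻¹ * (Z n).transpose)).transpose) atTop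
      (𝓝 S₀⁻¹) := by
  refine (tendsto_smul_inv (Real.tendsto_sqrt_atTop.comp tendsto_natCast_atTop_atTop)
    H.gram_sqrt_atTop H.nonsing).congr' ?_
  filter_upwards [eventually_inv_mul H.gram_sqrt_atTop H.nonsing] with n h1
  have h2 : ((Z n).transpose * Z n)⁻¹.transpose = ((Z n).transpose * Z n)⁻¹ := by
    rw [Matrix.transpose_nonsing_inv, Matrix.transpose_mul, Matrix.transpose_transpose]
  rw [Matrix.transpose_smul, Matrix.transpose_mul, Matrix.transpose_transpose, h2,
    Matrix.smul_mul, Matrix.mul_smul, smul_smul, Matrix.mul_assoc, ← Matrix.mul_assoc _ (Z n),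
    ← Matrix.mul_assoc, h1, Matrix.one_mul, pow_two]
  rfl

theorem eventually_abs_weights_le (H : IsDesign P X Z Z' S₀) {δ : ℝ} (hδ : 0 < δ) :
    ∀ᶠ n : ℕ in atTop, ∀ a i,
      |(√(n : ℝ) • (((Z n).transpose * Z n)⁻¹ * (Z n).transpose)) a i| ≤ δ := by
  have hsqrt : Tendsto (fun n : ℕ => √(n : ℝ)) atTop atTop :=
    Real.tendsto_sqrt_atTop.comp tendsto_natCast_atTop_atTop
  have h1 : Tendsto (fun n : ℕ => √(n : ℝ) • ((Z n).transpose * Z n)⁻¹) atTop (𝓝 0) := by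
    have h := (tendsto_inv_atTop_zero.comp hsqrt).smul
      (tendsto_smul_inv hsqrt H.gram_sqrt_atTop H.nonsing)
    rw [zero_smul] at h
    refine h.congr' ?_
    filter_upwards [hsqrt.eventually_gt_atTop 0] with n hn
    rw [Function.comp_apply, smul_smul]
    congr 1
    field_simp
  -- The 2 bounds the entries of the centered factors, and there are |D| summands; the added 1
  -- covers an empty `D`.
  set η := δ / (2 * (Fintype.card D + 1)) with hη
  have hη0 : 0 < η := by positivity
  have h2 : ∀ᶠ n : ℕ in atTop, ∀ a b, |(√(n : ℝ) • ((Z n).transpose * Z n)⁻¹) a b| < η := by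
    refine eventually_all.2 fun a => eventually_all.2 fun b => ?_
    have h := ((continuous_id.matrix_elem a b).abs.tendsto (0 : Matrix D D ℝ)).comp h1
    simp only [id, Matrix.zero_apply, abs_zero] at h
    exact h.eventually_lt_const hη0
  filter_upwards [h2, H.factor, H.center] with n h3 h4 h5 a i
  have h6 : ∀ b, |Z n i b| ≤ 2 := fun b => by
    rw [← h5]
    exact abs_centering_mul_apply_le (abs_apply_le_one_of_factor (H.prob n) h4) i b
  rw [← Matrix.smul_mul, Matrix.mul_apply]
  calc _ ≤ ∑ b, |(√(n : ℝ) • ((Z n).transpose * Z n)⁻¹) a b * (Z n).transpose b i| :=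
        Finset.abs_sum_le_sum_abs _ _
    _ ≤ ∑ _b : D, η * 2 := Finset.sum_le_sum fun b _ => by
        rw [abs_mul]
        exact mul_le_mul (h3 a b).le (h6 b) (abs_nonneg _) hη0.le
    _ = Fintype.card D * (η * 2) := by simp
    _ ≤ (Fintype.card D + 1) * (η * 2) := by
        refine mul_le_mul_of_nonneg_right ?_ (by positivity)
        linarith
    _ = δ := by
        rw [hη]
        field_simp

end IsDesign

end Oracle

/-! ### Limit law of the linear error -/

section LinearError

variable {Ω : Type*} [MeasurableSpace Ω] {Pr : Measure Ω} [IsProbabilityMeasure Pr]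
  {k1 k2 k3 : ℕ} {M : Params k1 k2 k3} {A : (n : ℕ) → Ω → Matrix (Fin n) (Fin n) ℝ}
  {ε : ℕ → ℕ → Ω → ℝ} {X : ∀ n, Matrix (Fin n) (Fin k1 ⊕ Fin k2) ℝ}
  {S₀ : Matrix (Fin k1 ⊕ Fin k2) (Fin k1 ⊕ Fin k2) ℝ}

theorem tendstoInDistribution_linearError (H : IsDesign M.P X M.Z12 M.Z3 S₀) {j : ℕ}
    (hW : IsWhiteNoise Pr (fun i => ε i j) (M.Ψ j)) (hΨ : 0 < M.Ψ j) (hS : S₀.PosSemidef) :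
    TendstoInDistribution (linearError M ε j) atTop id (fun _ => Pr)
      (multivariateGaussian 0 (M.Ψ j • S₀⁻¹)) :=
  hW.tendstoInDistribution_mulVec hΨ hS.inv H.tendsto_weights_mul_transpose
    fun _ hδ => H.eventually_abs_weights_le hδ

end LinearError

/-! ### From the assumptions to a design -/

section Params

variable {k1 k2 k3 : ℕ} {M : Params k1 k2 k3}
  {Mbar : Matrix ((Fin k1 ⊕ Fin k2) ⊕ Fin k3) ((Fin k1 ⊕ Fin k2) ⊕ Fin k3) ℝ}

theorem posSemidef_of_tendsto {ι D : Type*} [Fintype D] {L : Filter ι} [L.NeBot]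
    {S : ι → Matrix D D ℝ} {S₀ : Matrix D D ℝ} (hS : ∀ x, (S x).PosSemidef)
    (h : Tendsto S L (𝓝 S₀)) : S₀.PosSemidef := by
  refine Matrix.PosSemidef.of_dotProduct_mulVec_nonneg ?_ fun x => ?_
  · have h1 : Tendsto (fun x => (S x).conjTranspose) L (𝓝 S₀.conjTranspose) :=
      ((continuous_id.matrix_conjTranspose).tendsto S₀).comp h
    refine tendsto_nhds_unique h1 (h.congr fun x => (hS x).1.symm)
  · have hc : Continuous fun N : Matrix D D ℝ => star x ⬝ᵥ N.mulVec x := by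
      simp only [Matrix.mulVec, dotProduct]
      fun_prop
    exact ge_of_tendsto' ((hc.tendsto S₀).comp h) fun y => (hS y).dotProduct_mulVec_nonneg x

theorem posDef_of_posSemidef_of_rank {D : Type*} [Fintype D] [DecidableEq D] {S : Matrix D D ℝ}
    (hS : S.PosSemidef) (hr : S.rank = Fintype.card D) : S.PosDef := by
  rw [hS.posDef_iff_isUnit, ← Matrix.mulVec_surjective_iff_isUnit]
  have h : LinearMap.range S.mulVecLin = ⊤ :=
    Submodule.eq_top_of_finrank_eq (by rw [Module.finrank_fintype_fun_eq_card]; exact hr)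
  exact LinearMap.range_eq_top.1 h

theorem AssumptionI.posDef (h : AssumptionI M Mbar) : Mbar.PosDef := by
  refine posDef_of_posSemidef_of_rank (posSemidef_of_tendsto (fun n => ?_) h.1) ?_
  · have h1 := Matrix.posSemidef_conjTranspose_mul_self (M.Z n)
    rw [Matrix.conjTranspose_eq_transpose_of_trivial] at h1
    exact h1.smul (inv_nonneg.2 (Nat.cast_nonneg n))
  · rw [h.2]
    simp

theorem AssumptionI.posDef_toBlocks₁₁ (h : AssumptionI M Mbar) : Mbar.toBlocks₁₁.PosDef :=
  h.posDef.submatrix Sum.inl_injective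

theorem AssumptionI.tendsto_gram (h : AssumptionI M Mbar) :
    Tendsto (fun n : ℕ => (n : ℝ)⁻¹ • ((M.Z12 n).transpose * M.Z12 n)) atTop
      (𝓝 Mbar.toBlocks₁₁) := by
  have hc : Continuous fun N : Matrix ((Fin k1 ⊕ Fin k2) ⊕ Fin k3) ((Fin k1 ⊕ Fin k2) ⊕ Fin k3) ℝ =>
      N.toBlocks₁₁ := continuous_id.matrix_submatrix Sum.inl Sum.inl
  refine ((hc.tendsto Mbar).comp h.1).congr fun n => ?_
  rw [Function.comp_apply, Params.Z, Matrix.transpose_fromCols, Matrix.fromRows_mul_fromCols]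
  rfl

theorem AssumptionI.exists_fro_sq_le (h : AssumptionI M Mbar) :
    ∃ c : ℝ, ∀ᶠ n : ℕ in atTop, fro (M.Z3 n) ^ 2 ≤ c * n := by
  have hc : Continuous fun N : Matrix ((Fin k1 ⊕ Fin k2) ⊕ Fin k3) ((Fin k1 ⊕ Fin k2) ⊕ Fin k3) ℝ =>
      N.trace := continuous_id.matrix_trace
  refine ⟨Mbar.trace + 1, ?_⟩
  filter_upwards [((hc.tendsto Mbar).comp h.1).eventually_lt_const (lt_add_one _),
    eventually_gt_atTop 0] with n h1 hn
  have hn' : (0 : ℝ) < n := by exact_mod_cast hn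
  rw [Function.comp_apply, Matrix.trace_smul, ← fro_sq_eq_trace, smul_eq_mul, Params.Z,
    fro_fromCols_sq, inv_mul_lt_iff₀ hn', mul_comm] at h1
  linarith [sq_nonneg (fro (M.Z12 n))]

theorem AssumptionV.eventually_centered (h : AssumptionV M) : ∀ᶠ n in atTop, Centered M n := by
  filter_upwards [h] with n hn
  rcases hn with h | h | h
  exacts [h.1, h.1, h.1]

theorem Params.transpose_Z_mul_Z (M : Params k1 k2 k3) (n : ℕ) :
    (M.Z n).transpose * M.Z n = Matrix.fromBlocks ((M.Z12 n).transpose * M.Z12 n)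
      ((M.Z12 n).transpose * M.Z3 n) ((M.Z3 n).transpose * M.Z12 n)
      ((M.Z3 n).transpose * M.Z3 n) := by
  rw [Params.Z, Matrix.transpose_fromCols, Matrix.fromRows_mul_fromCols]

theorem Ident2.transpose_Z12_mul_Z3 {n : ℕ} (h : Ident2 M n) :
    (M.Z12 n).transpose * M.Z3 n = 0 := by
  have h1 := h.2.1.1
  rw [Params.transpose_Z_mul_Z] at h1
  ext a b
  exact h1 (Sum.inl_ne_inr (a := a) (b := b))

theorem Ident2.isDiag {n : ℕ} (h : Ident2 M n) : ((M.Z12 n).transpose * M.Z12 n).IsDiag := by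
  have h1 := h.2.1.1
  rw [Params.transpose_Z_mul_Z] at h1
  intro a b hab
  exact h1 (Sum.inl_injective.ne hab)

/-- All three sets of conditions contain this orthogonality, the second one as an off-diagonal block
of a diagonal matrix. It prevents an omitted-variable bias from Z₃. -/
theorem AssumptionV.eventually_ortho (h : AssumptionV M) :
    ∀ᶠ n in atTop, (M.Z12 n).transpose * M.Z3 n = 0 := by
  filter_upwards [h] with n hn
  rcases hn with h | h | h
  exacts [h.2.1, h.transpose_Z12_mul_Z3, h.2.1]

theorem Centered.centering_mul_Z12 {n : ℕ} (h : Centered M n) :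
    centering n * M.Z12 n = M.Z12 n :=
  centering_mul_of_sum_eq_zero fun a => h (Sum.inl a)

theorem Centered.centering_mul_Z3 {n : ℕ} (h : Centered M n) : centering n * M.Z3 n = M.Z3 n :=
  centering_mul_of_sum_eq_zero fun a => h (Sum.inr a)

theorem Params.P_transpose (M : Params k1 k2 k3) (n : ℕ) : (M.P n).transpose = M.P n := by
  rw [Params.P, Matrix.transpose_add, Matrix.transpose_mul, Matrix.transpose_transpose]
  congr 1
  ext i j
  simp [add_comm]

/-- The term α 1ᵀ is killed by centering on the right and 1 αᵀ by centering on the left. -/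
theorem Centered.centering_mul_P_mul_centering {n : ℕ} (hn : n ≠ 0) (h : Centered M n) :
    centering n * M.P n * centering n = M.Z12 n * (M.Z12 n).transpose := by
  have hn' : (n : ℝ) ≠ 0 := by exact_mod_cast hn
  have hsplit : Matrix.of (fun i j => M.α n i + M.α n j)
      = Matrix.of (fun i (_ : Fin n) => M.α n i)
        + (Matrix.of fun i (_ : Fin n) => M.α n i).transpose := by
    ext i j
    simp
  have h1 : centering n * (Matrix.of fun i (_ : Fin n) => M.α n i).transpose = 0 := by
    ext i a
    rw [centering_mul_apply]
    simp [hn']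
  have h2 : Matrix.of (fun i (_ : Fin n) => M.α n i) * centering n = 0 := by
    have := congrArg Matrix.transpose h1
    rwa [Matrix.transpose_mul, Matrix.transpose_transpose, centering_transpose,
      Matrix.transpose_zero] at this
  have h3 : (M.Z12 n).transpose * centering n = (M.Z12 n).transpose := by
    rw [← centering_transpose, ← Matrix.transpose_mul, h.centering_mul_Z12]
  rw [Params.P, hsplit, Matrix.mul_add, Matrix.mul_add, h1, add_zero, Matrix.add_mul,
    Matrix.mul_assoc, h2, Matrix.mul_zero, zero_add, ← Matrix.mul_assoc, h.centering_mul_Z12,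
    Matrix.mul_assoc, h3]

theorem exists_isDesign (hP : ∀ n i j, M.P n i j ∈ Set.Icc (0 : ℝ) 1) (h1 : AssumptionI M Mbar)
    (h3 : AssumptionIII M) (h5 : AssumptionV M) :
    ∃ X : ∀ n, Matrix (Fin n) (Fin k1 ⊕ Fin k2) ℝ,
      IsDesign M.P X M.Z12 M.Z3 Mbar.toBlocks₁₁ := by
  have hdet : Mbar.toBlocks₁₁.det ≠ 0 := h1.posDef_toBlocks₁₁.det_pos.ne'
  have hinv := eventually_inv_mul (h := fun n : ℕ => √(n : ℝ))
    (S := fun n => (M.Z12 n).transpose * M.Z12 n)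
    (by simpa only [Real.sq_sqrt (Nat.cast_nonneg _)] using h1.tendsto_gram) hdet
  have hX : ∀ᶠ n in atTop, ∃ X : Matrix (Fin n) (Fin k1 ⊕ Fin k2) ℝ,
      M.P n = X * X.transpose ∧ centering n * X = M.Z12 n := by
    filter_upwards [hinv, h3.1, h5.eventually_centered, eventually_ne_atTop 0] with n e1 e2 e3 hn
    exact exists_factor_of_centering hn (M.P_transpose n) e1 e3.centering_mul_Z12
      (e3.centering_mul_P_mul_centering hn) (e2.2.trans (le_of_eq (by simp)))
  classical
  -- The factor is known to exist only for large n; the default 0 is harmless, as a design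
  -- constrains X only eventually.
  refine ⟨fun n => if h : ∃ X : Matrix (Fin n) (Fin k1 ⊕ Fin k2) ℝ,
      M.P n = X * X.transpose ∧ centering n * X = M.Z12 n then h.choose else 0, ?_⟩
  exact {
    prob := hP
    factor := by
      filter_upwards [hX] with n h
      rw [dif_pos h]
      exact h.choose_spec.1
    center := by
      filter_upwards [hX] with n h
      rw [dif_pos h]
      exact h.choose_spec.2
    centered := h5.eventually_centered.mono fun n h => h.centering_mul_Z12
    centered' := h5.eventually_centered.mono fun n h => h.centering_mul_Z3
    ortho := h5.eventually_ortho
    gram := h1.tendsto_gram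
    nonsing := hdet
    bound' := h1.exists_fro_sq_le }

theorem AssumptionIV.exists_norm_loadings_le (h : AssumptionIV M Mbar) :
    ∃ C : ℝ, ∀ n j (hj : j < M.p n), ‖WithLp.toLp 2 (M.Λ12 n ⟨j, hj⟩)‖ ≤ C ∧
      ‖WithLp.toLp 2 (M.Λ3 n ⟨j, hj⟩)‖ ≤ C := by
  obtain ⟨C, hC, hb, -⟩ := h
  refine ⟨C, fun n j hj => ?_⟩
  have h1 := (hb n ⟨j, hj⟩).2.2
  have h2 : ∑ q, M.Λ n ⟨j, hj⟩ q ^ 2 = ∑ q, M.Λ2 n ⟨j, hj⟩ q ^ 2 + ∑ q, M.Λ3 n ⟨j, hj⟩ q ^ 2 := by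
    simp [Params.Λ]
  rw [h2] at h1
  constructor
  · refine le_trans ?_ h1
    rw [EuclideanSpace.norm_eq]
    refine Real.sqrt_le_sqrt ?_
    simp only [Params.Λ12, Real.norm_eq_abs, sq_abs, Fintype.sum_sum_type, Matrix.fromCols_apply_inl,
      Matrix.fromCols_apply_inr, Matrix.zero_apply]
    have : 0 ≤ ∑ q, M.Λ3 n ⟨j, hj⟩ q ^ 2 := Finset.sum_nonneg fun q _ => sq_nonneg _
    simpa using this
  · refine le_trans ?_ h1
    rw [EuclideanSpace.norm_eq]
    refine Real.sqrt_le_sqrt ?_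
    simp only [Real.norm_eq_abs, sq_abs]
    have : 0 ≤ ∑ q, M.Λ2 n ⟨j, hj⟩ q ^ 2 := Finset.sum_nonneg fun q _ => sq_nonneg _
    linarith

end Params

/-! ### Centeredness of the embedding -/

section Embedding

variable {n : ℕ}

theorem centering_mul_centering_mul {l : Type*} (N : Matrix (Fin n) l ℝ) :
    centering n * (centering n * N) = centering n * N := by
  refine centering_mul_of_sum_eq_zero fun a => ?_
  simp only [centering_mul_apply, Finset.sum_sub_distrib, Finset.sum_const, Finset.card_univ,
    Fintype.card_fin, nsmul_eq_mul]
  rcases Nat.eq_zero_or_pos n with rfl | hn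
  · simp
  · have : (n : ℝ) ≠ 0 := by positivity
    rw [mul_inv_cancel_left₀ this, sub_self]

theorem IsRotatedEmbedding.centering_mul {d : ℕ} {B : Matrix (Fin n) (Fin n) ℝ} {D : Type}
    [Fintype D] [DecidableEq D] {F : Matrix (Fin n) D ℝ} (h : IsRotatedEmbedding d B F) :
    centering n * F = F := by
  obtain ⟨X, -, W, -, rfl⟩ := h
  rw [Matrix.mul_assoc, centering_mul_centering_mul]

end Embedding

end GFM
-- The limit theorem
theorem theorem4 {Ω : Type*} [MeasurableSpace Ω] (Pr : Measure Ω) [IsProbabilityMeasure Pr]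
    {k1 k2 k3 : ℕ} (M : GFM.Params k1 k2 k3)
    (A : (n : ℕ) → Ω → Matrix (Fin n) (Fin n) ℝ) (ε : ℕ → ℕ → Ω → ℝ)
    (hmodel : GFM.IsModel Pr M A ε)
    (Mbar : Matrix ((Fin k1 ⊕ Fin k2) ⊕ Fin k3) ((Fin k1 ⊕ Fin k2) ⊕ Fin k3) ℝ)
    (h1 : GFM.AssumptionI M Mbar) (h2 : GFM.AssumptionII A) (h3 : GFM.AssumptionIII M)
    (h4 : GFM.AssumptionIV M Mbar) (h5 : GFM.AssumptionV M)
    (j : ℕ) (hj : ∀ᶠ n in atTop, j < M.p n) :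
    -- the embedding, with its rotation aligned to the identified factors
    (∀ Zhat : (n : ℕ) → Matrix (Fin n) (Fin n) ℝ → Matrix (Fin n) (Fin k1 ⊕ Fin k2) ℝ,
      (∀ᶠ n in atTop, ∀ B, GFM.IsAdjacency B →
        GFM.IsAlignedEmbedding (M.Z12 n) B (Zhat n B)) →
      TendstoInDistribution
        (fun n ω => GFM.scaledError M n (GFM.ols (Zhat n (A n ω)) (M.Y ε n ω)) j) atTop id
        (fun _ => Pr) (multivariateGaussian 0 (M.Ψ j • Mbar.toBlocks₁₁⁻¹))) ∧
    -- under the second set of conditions, the embedding rotated to satisfy these conditions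
    (∀ Zhat : (n : ℕ) → Matrix (Fin n) (Fin n) ℝ → Matrix (Fin n) (Fin k1 ⊕ Fin k2) ℝ,
      (∀ᶠ n in atTop, GFM.Ident2 M n) → GFM.DistinctDiag Mbar.toBlocks₁₁ →
      (∀ᶠ n in atTop, ∀ B, GFM.IsAdjacency B →
        GFM.IsDiagonalizedEmbedding (M.Z12 n) B (Zhat n B)) →
      TendstoInDistribution
        (fun n ω => GFM.scaledError M n (GFM.ols (Zhat n (A n ω)) (M.Y ε n ω)) j) atTop id
        (fun _ => Pr) (multivariateGaussian 0 (M.Ψ j • Mbar.toBlocks₁₁⁻¹))) ∧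
    -- the oracle that observes the network factors has the same limit law
    TendstoInDistribution
      (fun n ω => GFM.scaledError M n (GFM.ols (M.Z12 n) (M.Y ε n ω)) j) atTop id
      (fun _ => Pr) (multivariateGaussian 0 (M.Ψ j • Mbar.toBlocks₁₁⁻¹)) := by
  obtain ⟨X, hX⟩ := GFM.exists_isDesign hmodel.network.prob_mem h1 h3 h5
  obtain ⟨C, hC⟩ := h4.exists_norm_loadings_le
  have hpos := h1.posDef_toBlocks₁₁
  obtain ⟨n₀, hn₀⟩ := hj.exists
  have hΨ : 0 < M.Ψ j := by
    obtain ⟨_, -, h, -⟩ := h4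
    exact (h n₀ ⟨j, hn₀⟩).1
  have hclt := GFM.tendstoInDistribution_linearError hX (hmodel.noise.isWhiteNoise hn₀) hΨ
    hpos.posSemidef
  -- Slutsky's theorem in all three cases: the scaled error differs from the linear error by a term
  -- that tends to zero in probability, and for the oracle by nothing once n is large.
  refine ⟨fun Zhat hZ => ?_, fun Zhat h2' hdist hZ => ?_, ?_⟩
  · refine tendstoInDistribution_of_tendstoInMeasure_sub _ _ hclt
      (GFM.tendstoInMeasure_scaledError_sub_linearError hmodel h2 hX hj hΨ.le (hC · j)
        (hZ.mono fun n h B hB => (h B hB).isRotatedEmbedding.centering_mul)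
        (hX.isCloseRegressor_of_isAlignedEmbedding hZ))
      fun n => GFM.aemeasurable_scaledError hmodel h2 Zhat n j
  · refine tendstoInDistribution_of_tendstoInMeasure_sub _ _ hclt
      (GFM.tendstoInMeasure_scaledError_sub_linearError hmodel h2 hX hj hΨ.le (hC · j)
        (hZ.mono fun n h B hB => (h B hB).isRotatedEmbedding.centering_mul)
        (hX.isCloseRegressor_of_isDiagonalizedEmbedding hZ (h2'.mono fun n h => h.isDiag) hdist
          fun a => hpos.diag_pos))
      fun n => GFM.aemeasurable_scaledError hmodel h2 Zhat n j
  · refine tendstoInDistribution_of_tendstoInMeasure_sub _ _ hclt ?_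
      fun n => GFM.aemeasurable_scaledError hmodel h2 (fun n _ => M.Z12 n) n j
    rw [tendstoInMeasure_iff_measureReal_norm]
    intro δ hδ
    refine tendsto_const_nhds.congr' ?_
    filter_upwards [GFM.eventually_scaledError_eq_linearError (ε := ε) hX hj] with n hn
    simp [hn, hδ.not_ge]
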